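/- Let $V=(V,Y,\mathbf 1,\omega)$ be a simple vertex operator algebra over $\mathbb C$ of central charge $c$ and of strong CFT-type, i.e. $V=\bigoplus_{n\ge 0}V_n$ (the grading by $L_0$-eigenvalues), $V_0=\mathbb C\mathbf 1$ and $L_1V_1=0$, and assume $\dim V_1>0$. Let $\langle\ ,\ \rangle$ be its Li–Zamolodchikov metric, that is, the invariant bilinear form on $V$ normalized by $\langle\mathbf 1,\mathbf 1\rangle=1$; let $\{u^\alpha\}$ be a basis of $V_1$ with dual basis $\{\bar u^\alpha\}$, $\langle u^\alpha,\bar u^\beta\rangle=\delta_{\alpha\beta}$, and let $$\lambda^{(4)}=\sum_\alpha u^\alpha_{-3}\,\bar u^\alpha\in V_4,\qquad\text{where } Y(u,z)=\sum_{n\in\mathbb Z}u_nz^{-n-1}.$$ Let $\mathrm{Vir}_c\subseteq V$ be the vertex operator subalgebra generated by $\omega$. For $\tau$ in the upper half-plane $\mathfrak H$ write $q^s=e^{2\pi i s\tau}$, $\theta=q\frac{d}{dq}=\frac1{2\pi i}\frac{d}{d\tau}$, $$E_k(\tau)=-\frac{B_k}{k!}+\frac{2}{(k-1)!}\sum_{n\ge1}\sigma_{k-1}(n)q^n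 ,\qquad D_k=\theta+kE_2(\tau),\qquad D^2=D_2D_0 .$$ Suppose that $\lambda^{(4)}\in\mathrm{Vir}_c$. Then the series $$Z_V(\tau)=\mathrm{Tr}_V\,q^{L_0-c/24}=\sum_{n}\dim V_n\;q^{\,n-c/24}$$ converges absolutely for every $\tau\in\mathfrak H$, defines a holomorphic function on $\mathfrak H$, and satisfies the second-order modular linear differential equation $$\Big[D^2-\tfrac54\,c(c+4)E_4(\tau)\Big]Z=0 .$$ Moreover $Z_V=q^{-c/24}(1+O(q))$ as $\operatorname{Im}\tau\to\infty$, and $Z_V$ is the unique holomorphic function on $\mathfrak H$ that satisfies this equation and has such a leading expansion. -/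

import Mathlib

open Complex UpperHalfPlane
open scoped Manifold

noncomputable section

/-! ### Vertex operator algebras -/

/-- The fields `a(z)` and `b(z)` are mutually local of order `k`, that is
`(z₁ - z₂)^k [a(z₁), b(z₂)] = 0`; the identity below is the coefficient of
`z₁^(-r-1) z₂^(-s-1)`, where `a(z) = ∑ aₙ z^(-n-1)` and `aₙ = VertexOperator.ncoeff a n`. -/
def MutuallyLocal {V : Type*} [AddCommGroup V] [Module ℂ V] (k : ℕ)
    (a b : VertexOperator ℂ V) : Prop :=
  ∀ r s : ℤ, ∑ j ∈ Finset.range (k + 1),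
    ((-1 : ℂ) ^ j * (k.choose j : ℂ)) •
      (VertexOperator.ncoeff a ((k : ℤ) - j + r) * VertexOperator.ncoeff b ((j : ℤ) + s) -
        VertexOperator.ncoeff b ((j : ℤ) + s) * VertexOperator.ncoeff a ((k : ℤ) - j + r)) = 0

/-- A vertex operator algebra `(V, Y, 𝟏, ω)` over `ℂ`. A field on `V` is Mathlib's
`VertexOperator ℂ V`, a linear map from `V` to the Laurent series with coefficients in `V`; the
Virasoro mode `Lₙ` is `VertexOperator.ncoeff (Y ω) (n + 1)`. -/
structure VertexOperatorAlgebra (V : Type*) [AddCommGroup V] [Module ℂ V] where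
  /-- the state-field correspondence -/
  Y : V →ₗ[ℂ] VertexOperator ℂ V
  /-- the vacuum `𝟏` -/
  vac : V
  /-- the conformal vector `ω` -/
  conf : V
  /-- the central charge `c` -/
  centralCharge : ℂ
  vac_ne_zero : vac ≠ 0
  locality : ∀ u v : V, ∃ k : ℕ, MutuallyLocal k (Y u) (Y v)
  creative_nonneg : ∀ (v : V) (n : ℤ), 0 ≤ n → VertexOperator.ncoeff (Y v) n vac = 0
  creative : ∀ v : V, VertexOperator.ncoeff (Y v) (-1) vac = v
  virasoro : ∀ m n : ℤ,
    VertexOperator.ncoeff (Y conf) (m + 1) * VertexOperator.ncoeff (Y conf) (n + 1) -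
        VertexOperator.ncoeff (Y conf) (n + 1) * VertexOperator.ncoeff (Y conf) (m + 1) =
      ((m : ℂ) - n) • VertexOperator.ncoeff (Y conf) (m + n + 1) +
        (if m = -n then ((m : ℂ) ^ 3 - m) / 12 * centralCharge else 0) • (1 : Module.End ℂ V)
  grading : DirectSum.IsInternal fun n : ℤ =>
    Module.End.eigenspace (VertexOperator.ncoeff (Y conf) (0 + 1)) (n : ℂ)
  finite_weightSpace : ∀ n : ℤ,
    FiniteDimensional ℂ (Module.End.eigenspace (VertexOperator.ncoeff (Y conf) (0 + 1)) (n : ℂ))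
  bounded_below : ∃ N : ℤ, ∀ n < N,
    Module.End.eigenspace (VertexOperator.ncoeff (Y conf) (0 + 1)) (n : ℂ) = ⊥
  /-- `Y(L₋₁ u, z) = ∂ Y(u, z)` -/
  translation : ∀ (u : V) (n : ℤ),
    VertexOperator.ncoeff (Y (VertexOperator.ncoeff (Y conf) (-1 + 1) u)) n =
      (-(n : ℂ)) • VertexOperator.ncoeff (Y u) (n - 1)

namespace VertexOperatorAlgebra

variable {V : Type*} [AddCommGroup V] [Module ℂ V] (𝒱 : VertexOperatorAlgebra V)

/-- The mode `uₙ`, where `Y(u, z) = ∑ uₙ z^(-n-1)`. -/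
def mode (u : V) (n : ℤ) : Module.End ℂ V := VertexOperator.ncoeff (𝒱.Y u) n

/-- The Virasoro modes `Lₙ`, where `Y(ω, z) = ∑ Lₙ z^(-n-2)`. -/
def L (n : ℤ) : Module.End ℂ V := 𝒱.mode 𝒱.conf (n + 1)

/-- The homogeneous space `Vₙ = {v | L₀ v = n v}`. -/
def weightSpace (n : ℤ) : Submodule ℂ V := Module.End.eigenspace (𝒱.L 0) (n : ℂ)

/-- CFT-type: `V = ⊕_{n ≥ 0} Vₙ` with `V₀ = ℂ 𝟏`. Strong CFT-type: moreover `L₁ V₁ = 0`. -/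
structure IsStrongCFTType : Prop where
  weightSpace_neg : ∀ n : ℤ, n < 0 → 𝒱.weightSpace n = ⊥
  weightSpace_zero : 𝒱.weightSpace 0 = Submodule.span ℂ {𝒱.vac}
  L_one : ∀ v ∈ 𝒱.weightSpace 1, 𝒱.L 1 v = 0

/-- `V` is simple: no proper nonzero subspace is invariant under all modes. -/
def IsSimple : Prop :=
  ∀ I : Submodule ℂ V, (∀ (u : V) (n : ℤ), ∀ b ∈ I, 𝒱.mode u n b ∈ I) → I = ⊥ ∨ I = ⊤

/-- The mode `uₙ†` of the adjoint vertex operator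
`Y†(u, z) = Y(exp(z L₁) (-z²)^(-L₀) u, z⁻¹)` for `u` of weight `m`, namely
`uₙ† = (-1)^m ∑_{k=0}^{m} (1/k!) (L₁^k u)_{2m-n-k-2}`. -/
def adjointMode (m : ℕ) (u : V) (n : ℤ) : Module.End ℂ V :=
  (-1 : ℂ) ^ m • ∑ k ∈ Finset.range (m + 1),
    ((k.factorial : ℂ)⁻¹) • 𝒱.mode ((𝒱.L 1 ^ k) u) (2 * (m : ℤ) - n - k - 2)

/-- `B` is the Li-Zamolodchikov metric of `V` (of CFT-type): the invariant bilinear form,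
`⟨uₙ a, b⟩ = ⟨a, uₙ† b⟩`, with the normalization `⟨𝟏, 𝟏⟩ = 1`. -/
structure IsLiZMetric (B : LinearMap.BilinForm ℂ V) : Prop where
  invariant : ∀ (m : ℕ), ∀ u ∈ 𝒱.weightSpace m, ∀ (n : ℤ) (a b : V),
    B (𝒱.mode u n a) b = B a (𝒱.adjointMode m u n b)
  normalized : B 𝒱.vac 𝒱.vac = 1

/-- `Vir_c`, the vertex operator subalgebra generated by `ω`: the smallest subspace of `V` that
contains `𝟏` and `ω` and is closed under all the products `(u, v) ↦ uₙ v`. -/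
def virasoroSubalgebra : Submodule ℂ V :=
  sInf {W : Submodule ℂ V | 𝒱.vac ∈ W ∧ 𝒱.conf ∈ W ∧
    ∀ u ∈ W, ∀ v ∈ W, ∀ n : ℤ, 𝒱.mode u n v ∈ W}

/-- The quadratic Casimir vector `λ⁽ⁿ⁾ = ∑_α u^α_{1-n} ū^α`. -/
def casimir {ι : Type*} [Fintype ι] (u ubar : ι → V) (n : ℤ) : V :=
  ∑ α, 𝒱.mode (u α) (1 - n) (ubar α)

end VertexOperatorAlgebra

/-! ### Functions on the upper half-plane -/

/-- `q^s = exp(2πi s τ)`. -/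
def qPow (s : ℂ) (τ : ℍ) : ℂ := Complex.exp (2 * Real.pi * Complex.I * s * (τ : ℂ))

namespace VertexOperatorAlgebra

variable {V : Type*} [AddCommGroup V] [Module ℂ V] (𝒱 : VertexOperatorAlgebra V)

/-- The `n`-th term `dim Vₙ q^(n - c/24)` of `Z_V(τ)`. -/
def partitionTerm (τ : ℍ) (n : ℤ) : ℂ :=
  (Module.finrank ℂ (𝒱.weightSpace n) : ℂ) * qPow ((n : ℂ) - 𝒱.centralCharge / 24) τ

/-- The genus one partition function `Z_V(τ) = Tr_V q^(L₀ - c/24) = ∑ₙ dim Vₙ q^(n - c/24)`. -/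
def partitionFunction (τ : ℍ) : ℂ := ∑' n : ℤ, 𝒱.partitionTerm τ n

end VertexOperatorAlgebra

/-- The Eisenstein series
`E_k(τ) = -B_k/k! + (2/(k-1)!) ∑_{n ≥ 1} σ_{k-1}(n) q^n`, for `k ≥ 2`. -/
def eisensteinE (k : ℕ) (τ : ℍ) : ℂ :=
  -((bernoulli k : ℚ) : ℂ) / (k.factorial : ℂ) +
    2 / ((k - 1).factorial : ℂ) *
      ∑' n : ℕ, (ArithmeticFunction.sigma (k - 1) (n + 1) : ℂ) * qPow ((n : ℂ) + 1) τ

/-- The modular derivative `D_k f = θ f + k E₂ f`, with `θ = q d/dq = (2πi)⁻¹ d/dτ`. -/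
def modularD (k : ℕ) (f : ℍ → ℂ) (τ : ℍ) : ℂ :=
  Derivative.normalizedDerivOfComplex f τ + (k : ℂ) * eisensteinE 2 τ * f τ

/-- `f` satisfies `[D² - (5/4) c (c + 4) E₄] f = 0` on the upper half-plane, `D² = D₂ ∘ D₀`. -/
def SolvesMLDE (c : ℂ) (f : ℍ → ℂ) : Prop :=
  ∀ τ : ℍ, modularD 2 (modularD 0 f) τ - 5 / 4 * c * (c + 4) * eisensteinE 4 τ * f τ = 0

/-- `f = q^(-c/24) (1 + O(q))` as `Im τ → ∞`. -/
def HasLeadingTerm (c : ℂ) (f : ℍ → ℂ) : Prop :=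
  (fun τ : ℍ => qPow (c / 24) τ * f τ - 1) =O[atImInfty] (fun τ : ℍ => qPow 1 τ)

end

/-! The differential equation is a recursion for `dim Vₙ`, and the recursion comes from computing
the trace over `Vₙ` of the weight-preserving mode `λ⁽⁴⁾₃` in two ways.

As a Casimir vector, `λ⁽⁴⁾` is half of `∑ (L₋₁² u)₋₁ ū`, so its mode is a sum of normally ordered
products `u₋ₖ ūₖ`. Cyclicity of the trace gives `Tr_{Vₙ}(u₋ₖ ūₖ) = Tr_{Vₙ₋ₖ}(u₋ₖ ūₖ) + Tr_{Vₙ₋ₖ}[ūₖ,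
u₋ₖ]`. The commutator is `[ū₀, u₀] - k⟨u, ū⟩`, whose first term is traceless. Iterating over the
multiples of `k` and summing over `k` produces divisor sums. The unknown trace of the zero modes
cancels against that of `λ⁽²⁾₁`, and what remains is `-d ∑ σ₃(l) dim Vₙ₋ₗ` with `d = dim V₁`
(`wtrace_casimir`).

As a Virasoro descendant, `λ⁽⁴⁾ = a L₋₂²𝟏 + b L₋₄𝟏`, because the weight four part of `Vir_c` is
spanned by these two vectors. Applying `L₂` and `L₄` makes `λ⁽²⁾` a multiple of `ω` and determines
`a` and `b` in terms of `c` and `d` (`casimir_coefficients`). The same trace method applies to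
`L₋₂²𝟏` (`wtrace_L_neg_two_sq`). Comparison gives `dim_recursion`, which is the equation coefficient
by coefficient.

The recursion bounds the growth of `dim Vₙ` below every exponential (`Subexp.of_recursion`); hence
convergence, holomorphy and the equation itself. The exponents at `i∞` are `-c/24` and `-c/24 +
(c+2)/12`. The case `n = 1` of the recursion reads `d(10 - c) = c(5c + 22)` and forces `c` to be
real and less than `10`, so the exponents differ by less than `1`. A Wronskian argument then
excludes a second solution with the same leading term (`eq_zero_of_solvesMLDE`).

Since the only field axiom is locality, the product and commutator formulas are derived first. In
terms of modes, multiplication by `z₁ - z₂` is a difference operator on functions on `ℤ × ℤ`. Dong's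
lemma, together with the fact that a local field is determined by its action on the vacuum,
identifies the modes of `uₙ₋₁ v` with differences of one formal product (`mode_mode`). -/

/-! ### Difference operators on functions on a lattice -/

section Lattice

variable {P Q M N : Type*} [AddCommGroup P] [AddCommGroup Q] [AddCommGroup M] [Module ℂ M]
  [AddCommGroup N] [Module ℂ N]

/-- Translation of functions by `d`. -/
def shiftEnd (d : P) : Module.End ℂ (P → M) := LinearMap.funLeft ℂ M (· + d)

/-- The difference of the translations by `d` and by `e`. -/
def diffEnd (d e : P) : Module.End ℂ (P → M) := shiftEnd d - shiftEnd e

theorem shiftEnd_apply (d : P) (F : P → M) (p : P) : shiftEnd d F p = F (p + d) := rfl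

theorem diffEnd_apply (d e : P) (F : P → M) (p : P) :
    diffEnd d e F p = F (p + d) - F (p + e) := rfl

theorem shiftEnd_commute (d e : P) : Commute (shiftEnd d : Module.End ℂ (P → M)) (shiftEnd e) := by
  ext F p
  simp [Module.End.mul_apply, shiftEnd_apply, add_right_comm]

theorem diffEnd_commute (d e d' e' : P) :
    Commute (diffEnd d e : Module.End ℂ (P → M)) (diffEnd d' e') :=
  ((shiftEnd_commute d d').sub_right (shiftEnd_commute d e')).sub_left
    ((shiftEnd_commute e d').sub_right (shiftEnd_commute e e'))

theorem shiftEnd_pow_apply (d : P) (n : ℕ) (F : P → M) (p : P) :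
    (shiftEnd d ^ n) F p = F (p + (n : ℤ) • d) := by
  induction n generalizing p with
  | zero => simp
  | succ n ih =>
    rw [pow_succ', Module.End.mul_apply, shiftEnd_apply, ih]
    congr 1
    push_cast
    rw [add_smul, one_smul]
    abel

/-- Binomial expansion for commuting translations; it matches the sum in `MutuallyLocal` with an
iterated difference. -/
theorem diffEnd_pow_apply (d e : P) (k : ℕ) (F : P → M) (p : P) :
    (diffEnd d e ^ k) F p = ∑ j ∈ Finset.range (k + 1),
      ((-1 : ℂ) ^ j * (k.choose j : ℂ)) • F (p + ((k : ℤ) - j) • d + (j : ℤ) • e) := by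
  have h : (diffEnd d e : Module.End ℂ (P → M)) = -shiftEnd e + shiftEnd d := by
    rw [diffEnd]; abel
  rw [h, ((shiftEnd_commute (M := M) e d).neg_left).add_pow, LinearMap.sum_apply, Finset.sum_apply]
  refine Finset.sum_congr rfl fun j hj => ?_
  have hj' : j ≤ k := Nat.lt_succ_iff.mp (Finset.mem_range.mp hj)
  have h1 : (-shiftEnd e : Module.End ℂ (P → M)) ^ j = ((-1 : ℂ) ^ j) • shiftEnd e ^ j := by
    rw [← neg_one_smul ℂ, smul_pow]
  have h2 : ((k.choose j : ℕ) : Module.End ℂ (P → M)) = (k.choose j : ℂ) • 1 := by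
    ext F p; simp [Nat.cast_smul_eq_nsmul]
  rw [h1, h2, mul_smul_comm, mul_one, smul_mul_assoc, smul_smul, LinearMap.smul_apply,
    Pi.smul_apply, Module.End.mul_apply, shiftEnd_pow_apply, shiftEnd_pow_apply, mul_comm]
  congr 2
  rw [Nat.cast_sub hj']
  abel

/-- Serves to pass between functions on `ℤ × ℤ` and slices of functions on `ℤ × ℤ × ℤ`. -/
theorem diffEnd_pow_comp (d e : P) (d' e' : Q) (φ : P → Q) (hd : ∀ p, φ (p + d) = φ p + d')
    (he : ∀ p, φ (p + e) = φ p + e') (k : ℕ) (F : Q → M) :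
    (diffEnd d e ^ k) (F ∘ φ) = (diffEnd d' e' ^ k) F ∘ φ := by
  induction k generalizing F with
  | zero => rfl
  | succ k ih =>
    rw [pow_succ, pow_succ, Module.End.mul_apply, Module.End.mul_apply, ← ih]
    congr 1
    funext p
    simp [diffEnd_apply, hd, he]

theorem diffEnd_pow_map (d e : P) (L : M →ₗ[ℂ] N) (k : ℕ) (F : P → M) :
    (diffEnd d e ^ k) (fun p => L (F p)) = fun p => L ((diffEnd d e ^ k) F p) := by
  funext p
  simp [diffEnd_pow_apply]

theorem diffEnd_pow_eventuallyEq (d e : P) (k : ℕ) {F : P → M} {G : ℕ → P → M}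
    (h : ∀ p, ∀ᶠ n in Filter.atTop, G n p = F p) :
    ∀ p, ∀ᶠ n in Filter.atTop, (diffEnd d e ^ k) (G n) p = (diffEnd d e ^ k) F p := by
  intro p
  simp only [diffEnd_pow_apply]
  have := (Finset.range (k + 1)).eventually_all (l := Filter.atTop)
    (p := fun j n => G n (p + ((k : ℤ) - j) • d + (j : ℤ) • e) =
      F (p + ((k : ℤ) - j) • d + (j : ℤ) • e))
  filter_upwards [this.mpr fun j _ => h _] with n hn
  exact Finset.sum_congr rfl fun j hj => by rw [hn j hj]

/-- In the expansion of `(B - A)^(p + k)` every monomial contains `A^p` or `B^k`. -/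
theorem Commute.sub_pow_apply_eq_zero {A B : Module.End ℂ M} (hAB : Commute A B) :
    ∀ (p k : ℕ) (y : M), (A ^ p) y = 0 → (B ^ k) y = 0 → ((B - A) ^ (p + k)) y = 0 := by
  suffices H : ∀ n p k : ℕ, p + k = n → ∀ y : M, (A ^ p) y = 0 → (B ^ k) y = 0 →
      ((B - A) ^ n) y = 0 from fun p k y h1 h2 => H _ p k rfl y h1 h2
  intro n
  induction n with
  | zero =>
    intro p k hpk y h1 _
    obtain rfl : p = 0 := by omega
    simpa using h1
  | succ n ih =>
    intro p k hpk y h1 h2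
    rw [pow_succ, Module.End.mul_apply, LinearMap.sub_apply, map_sub]
    rcases p with _ | p
    · have : y = 0 := by simpa using h1
      simp [this]
    rcases k with _ | k
    · have : y = 0 := by simpa using h2
      simp [this]
    rw [ih (p + 1) k (by omega) (B y) ?_ ?_, ih p (k + 1) (by omega) (A y) ?_ ?_, sub_zero]
    · rwa [pow_succ, Module.End.mul_apply] at h1
    · rw [← Module.End.mul_apply, ← (hAB.pow_right (k + 1)).eq, Module.End.mul_apply, h2, map_zero]
    · rw [← Module.End.mul_apply, (hAB.pow_left (p + 1)).eq, Module.End.mul_apply, h1, map_zero]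
    · rwa [pow_succ, Module.End.mul_apply] at h2

end Lattice

/-! ### Locality -/

section Locality

variable {V : Type*} [AddCommGroup V] [Module ℂ V]

/-- Locality of order `k` of two families of operators, as the vanishing of an iterated
difference of the family of commutators. -/
def ModesLocal (k : ℕ) (a b : ℤ → Module.End ℂ V) : Prop :=
  (diffEnd ((1, 0) : ℤ × ℤ) (0, 1) ^ k) (fun p => ⁅a p.1, b p.2⁆) = 0

theorem modesLocal_iff {k : ℕ} {a b : ℤ → Module.End ℂ V} :
    ModesLocal k a b ↔ ∀ r s : ℤ, ∑ j ∈ Finset.range (k + 1),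
      ((-1 : ℂ) ^ j * (k.choose j : ℂ)) • ⁅a ((k : ℤ) - j + r), b ((j : ℤ) + s)⁆ = 0 := by
  simp only [ModesLocal, funext_iff, Prod.forall, diffEnd_pow_apply, Pi.zero_apply]
  refine forall_congr' fun r => forall_congr' fun s => ?_
  simp [add_comm]

theorem MutuallyLocal.modesLocal {k : ℕ} {a b : VertexOperator ℂ V} (h : MutuallyLocal k a b) :
    ModesLocal k (VertexOperator.ncoeff a) (VertexOperator.ncoeff b) :=
  modesLocal_iff.mpr h

theorem ModesLocal.mono {k l : ℕ} {a b : ℤ → Module.End ℂ V} (h : ModesLocal k a b)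
    (hkl : k ≤ l) : ModesLocal l a b := by
  obtain ⟨m, rfl⟩ := Nat.exists_eq_add_of_le hkl
  rw [ModesLocal, add_comm, pow_add, Module.End.mul_apply, h, map_zero]

theorem ModesLocal.sub {k : ℕ} {a a' b : ℤ → Module.End ℂ V} (h : ModesLocal k a b)
    (h' : ModesLocal k a' b) : ModesLocal k (a - a') b := by
  have : (fun p : ℤ × ℤ => ⁅(a - a') p.1, b p.2⁆) =
      (fun p => ⁅a p.1, b p.2⁆) - fun p => ⁅a' p.1, b p.2⁆ := by
    funext p; simp only [Pi.sub_apply, Ring.lie_def]; noncomm_ring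
  rw [ModesLocal, this, map_sub, h, h', sub_zero]

theorem ModesLocal.shift {k : ℕ} {a b : ℤ → Module.End ℂ V} (h : ModesLocal k a b) (i : ℤ) :
    ModesLocal k (fun m => a (m + i)) b := by
  have := diffEnd_pow_comp ((1, 0) : ℤ × ℤ) (0, 1) (1, 0) (0, 1) (fun p => (p.1 + i, p.2))
    (fun p => by ext <;> simp [add_right_comm]) (fun p => by ext <;> simp) k
    (fun p : ℤ × ℤ => ⁅a p.1, b p.2⁆)
  rw [ModesLocal, show (fun p : ℤ × ℤ => ⁅a (p.1 + i), b p.2⁆) =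
    (fun p : ℤ × ℤ => ⁅a p.1, b p.2⁆) ∘ (fun p => (p.1 + i, p.2)) from rfl, this, h]
  rfl

abbrev e₁ : ℤ × ℤ × ℤ := (1, 0, 0)
abbrev e₂ : ℤ × ℤ × ℤ := (0, 1, 0)
abbrev e₃ : ℤ × ℤ × ℤ := (0, 0, 1)

theorem ModesLocal.diffEnd_pow₁₃ {k : ℕ} {a c : ℤ → Module.End ℂ V} (h : ModesLocal k a c)
    (x y : ℤ → Module.End ℂ V) (i : ℤ) :
    (diffEnd e₁ e₃ ^ k) (fun p => x p.2.1 * ⁅a (p.1 + i), c p.2.2⁆ * y p.2.1) = 0 := by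
  funext ⟨r, s, t⟩
  have h1 := diffEnd_pow_comp ((1, 0) : ℤ × ℤ) (0, 1) e₁ e₃ (fun p => (p.1, s, p.2))
    (fun p => by ext <;> simp) (fun p => by ext <;> simp) k
    (fun p : ℤ × ℤ × ℤ => x p.2.1 * ⁅a (p.1 + i), c p.2.2⁆ * y p.2.1)
  have h2 := diffEnd_pow_map ((1, 0) : ℤ × ℤ) (0, 1)
    (LinearMap.mulLeft ℂ (x s) ∘ₗ LinearMap.mulRight ℂ (y s)) k
    (fun p : ℤ × ℤ => ⁅a (p.1 + i), c p.2⁆)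
  have h3 := congrFun h1 (r, t)
  simp only [Function.comp_apply] at h3
  rw [← h3]
  have h4 : ModesLocal k (fun m => a (m + i)) c := h.shift i
  rw [ModesLocal] at h4
  rw [h4] at h2
  simpa [Function.comp_def, mul_assoc] using congrFun h2 (r, t)

theorem ModesLocal.diffEnd_pow₂₃ {k : ℕ} {b c : ℤ → Module.End ℂ V} (h : ModesLocal k b c)
    (x y : ℤ → Module.End ℂ V) (i : ℤ) :
    (diffEnd e₂ e₃ ^ k) (fun p => x p.1 * ⁅b (p.2.1 + i), c p.2.2⁆ * y p.1) = 0 := by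
  have h1 := diffEnd_pow_comp e₂ e₃ e₁ e₃ (fun p : ℤ × ℤ × ℤ => (p.2.1, p.1, p.2.2))
    (fun p => by ext <;> simp) (fun p => by ext <;> simp) k
    (fun p : ℤ × ℤ × ℤ => x p.2.1 * ⁅b (p.1 + i), c p.2.2⁆ * y p.2.1)
  rw [h.diffEnd_pow₁₃ x y i] at h1
  exact h1

theorem diffEnd_pow_commute_apply {P M : Type*} [AddCommGroup P] [AddCommGroup M] [Module ℂ M]
    (d e d' e' : P) (k l : ℕ) (F : P → M) :
    (diffEnd d e ^ k) ((diffEnd d' e' ^ l) F) = (diffEnd d' e' ^ l) ((diffEnd d e ^ k) F) := by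
  rw [← Module.End.mul_apply, ← Module.End.mul_apply,
    ((diffEnd_commute d e d' e').pow_pow k l).eq]

theorem lie_mul_eq (a b c : Module.End ℂ V) : ⁅a * b, c⁆ = a * ⁅b, c⁆ * 1 + 1 * ⁅a, c⁆ * b := by
  simp only [Ring.lie_def]; noncomm_ring

/-- By the Leibniz rule each summand contains the commutator of `c` with a single factor, and is
killed by one of the two commuting differences. -/
theorem ModesLocal.diffEnd_lie_mul {k : ℕ} {a b c : ℤ → Module.End ℂ V} (ha : ModesLocal k a c)
    (hb : ModesLocal k b c) (i j : ℤ) :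
    (diffEnd e₁ e₃ ^ k) ((diffEnd e₂ e₃ ^ k)
      (fun p => ⁅a (p.1 + i) * b (p.2.1 + j), c p.2.2⁆)) = 0 := by
  have h : (fun p : ℤ × ℤ × ℤ => ⁅a (p.1 + i) * b (p.2.1 + j), c p.2.2⁆) =
      (fun p => a (p.1 + i) * ⁅b (p.2.1 + j), c p.2.2⁆ * 1) +
        fun p => 1 * ⁅a (p.1 + i), c p.2.2⁆ * b (p.2.1 + j) := by
    funext p; simp only [lie_mul_eq, Pi.add_apply]
  rw [h, map_add, map_add, hb.diffEnd_pow₂₃ (fun m => a (m + i)) (fun _ => 1) j,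
    map_zero, zero_add,
    diffEnd_pow_commute_apply, ha.diffEnd_pow₁₃ (fun _ => 1) (fun m => b (m + j)) i, map_zero]

theorem ModesLocal.diffEnd_lie_mul' {k : ℕ} {a b c : ℤ → Module.End ℂ V} (ha : ModesLocal k a c)
    (hb : ModesLocal k b c) (i j : ℤ) :
    (diffEnd e₁ e₃ ^ k) ((diffEnd e₂ e₃ ^ k)
      (fun p => ⁅b (p.2.1 + j) * a (p.1 + i), c p.2.2⁆)) = 0 := by
  have h : (fun p : ℤ × ℤ × ℤ => ⁅b (p.2.1 + j) * a (p.1 + i), c p.2.2⁆) =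
      (fun p => b (p.2.1 + j) * ⁅a (p.1 + i), c p.2.2⁆ * 1) +
        fun p => 1 * ⁅b (p.2.1 + j), c p.2.2⁆ * a (p.1 + i) := by
    funext p; simp only [lie_mul_eq, Pi.add_apply]
  rw [h, map_add, map_add, hb.diffEnd_pow₂₃ (fun _ => 1) (fun m => a (m + i)) j, map_zero, add_zero,
    diffEnd_pow_commute_apply, ha.diffEnd_pow₁₃ (fun m => b (m + j)) (fun _ => 1) i, map_zero]

/-! ### Formal products of two fields and Dong's lemma. -/

theorem VertexOperator.eventually_ncoeff_eq_zero (a : VertexOperator ℂ V) (v : V) (s : ℤ) :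
    ∀ᶠ n : ℕ in Filter.atTop, VertexOperator.ncoeff a (s + n) v = 0 := by
  have : Filter.Tendsto (fun n : ℕ => s + (n : ℤ)) Filter.atTop Filter.atTop :=
    Filter.tendsto_atTop_add_const_left _ _ tendsto_natCast_atTop_atTop
  filter_upwards [this.eventually (Filter.eventually_gt_atTop
    (-((HahnModule.of ℂ).symm (a v)).order - 1))] with n hn
  exact VertexOperator.ncoeff_eq_zero_of_lt_order a _ v (by omega)

open VertexOperator in
/-- The operator `∑_{j ≥ 0} a_{r-1-j} b_{s+j}`. -/
noncomputable def halfProduct (a b : VertexOperator ℂ V) (r s : ℤ) : Module.End ℂ V where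
  toFun v := ∑ᶠ j : ℕ, ncoeff a (r - 1 - j) (ncoeff b (s + j) v)
  map_add' v w := by
    have h : ∀ v, (Function.support fun j : ℕ =>
        ncoeff a (r - 1 - j) (ncoeff b (s + j) v)).Finite := fun v => by
      obtain ⟨N, hN⟩ := Filter.eventually_atTop.mp (eventually_ncoeff_eq_zero b v s)
      refine (Set.finite_lt_nat N).subset fun j hj => ?_
      by_contra h
      exact hj (by simp [hN j (not_lt.mp h)])
    simp only [map_add]
    exact finsum_add_distrib (h v) (h w)
  map_smul' c v := by
    simp only [map_smul, RingHom.id_apply]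
    exact (smul_finsum c _).symm

open VertexOperator in
theorem halfProduct_eventually (a b : VertexOperator ℂ V) (r s : ℤ) (v : V) :
    ∀ᶠ N : ℕ in Filter.atTop, ∑ j ∈ Finset.range N,
      ncoeff a (r - 1 - j) (ncoeff b (s + j) v) = halfProduct a b r s v := by
  obtain ⟨N, hN⟩ := Filter.eventually_atTop.mp (eventually_ncoeff_eq_zero b v s)
  filter_upwards [Filter.eventually_ge_atTop N] with n hn
  refine (finsum_eq_sum_of_support_subset _ fun j hj => ?_).symm
  simp only [Finset.coe_range, Set.mem_Iio]
  by_contra h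
  exact hj (by simp [hN j (hn.trans (not_lt.mp h))])

-- `halfProduct` is the expansion of `(z₁ - z₂)⁻¹ a(z₁) b(z₂)` for `|z₁| > |z₂|`. The difference
-- multiplies by `z₁ - z₂`, and the sum telescopes to its first term.
open VertexOperator in
theorem halfProduct_sub (a b : VertexOperator ℂ V) (r s : ℤ) :
    halfProduct a b (r + 1) s - halfProduct a b r (s + 1) = ncoeff a r * ncoeff b s := by
  ext v
  obtain ⟨N, h1, h2⟩ := ((Filter.tendsto_add_atTop_nat 1).eventually
    (halfProduct_eventually a b (r + 1) s v) |>.and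
      (halfProduct_eventually a b r (s + 1) v)).exists
  rw [LinearMap.sub_apply, ← h1, ← h2, Finset.sum_range_succ']
  have : ∀ j : ℕ, ncoeff a (r + 1 - 1 - ((j + 1 : ℕ) : ℤ)) (ncoeff b (s + ((j + 1 : ℕ) : ℤ)) v) =
      ncoeff a (r - 1 - j) (ncoeff b (s + 1 + j) v) := fun j => by
    rw [show r + 1 - 1 - ((j + 1 : ℕ) : ℤ) = r - 1 - j by push_cast; ring,
      show s + ((j + 1 : ℕ) : ℤ) = s + 1 + j by push_cast; ring]
  simp only [this]
  simp

/-- The formal product `(z₁ - z₂)⁻¹ [a(z₁), b(z₂)]`, expanded in the two domains. -/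
noncomputable def fullProduct (a b : VertexOperator ℂ V) (p : ℤ × ℤ) : Module.End ℂ V :=
  halfProduct a b p.1 p.2 + halfProduct b a p.2 p.1

theorem diffEnd_fullProduct (a b : VertexOperator ℂ V) :
    diffEnd (1, 0) (0, 1) (fullProduct a b) =
      fun p => ⁅VertexOperator.ncoeff a p.1, VertexOperator.ncoeff b p.2⁆ := by
  funext ⟨r, s⟩
  have h1 := halfProduct_sub a b r s
  have h2 := halfProduct_sub b a s r
  simp only [diffEnd_apply, fullProduct, Prod.mk_add_mk, add_zero, Ring.lie_def, ← h1, ← h2]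
  abel

-- On a fixed vector the infinite sums are finite, and a difference involves finitely many lattice
-- points. So the vanishing for single products `a b` passes to the half products.
open VertexOperator in
theorem diffEnd_halfProduct {k : ℕ} {a b c : VertexOperator ℂ V}
    (ha : ModesLocal k (ncoeff a) (ncoeff c)) (hb : ModesLocal k (ncoeff b) (ncoeff c)) :
    (diffEnd e₁ e₃ ^ k) ((diffEnd e₂ e₃ ^ k)
      (fun p => ⁅halfProduct a b p.1 p.2.1, ncoeff c p.2.2⁆)) = 0 ∧
    (diffEnd e₁ e₃ ^ k) ((diffEnd e₂ e₃ ^ k)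
      (fun p => ⁅halfProduct b a p.2.1 p.1, ncoeff c p.2.2⁆)) = 0 := by
  have key : ∀ (F : ℤ × ℤ × ℤ → Module.End ℂ V) (f : ℕ → ℤ × ℤ × ℤ → Module.End ℂ V),
      (∀ p v, ∀ᶠ N in Filter.atTop, (∑ j ∈ Finset.range N, f j) p v = F p v) →
      (∀ j, (diffEnd e₁ e₃ ^ k) ((diffEnd e₂ e₃ ^ k) (f j)) = 0) →
      (diffEnd e₁ e₃ ^ k) ((diffEnd e₂ e₃ ^ k) F) = 0 := by
    intro F f hF hf
    funext p
    ext v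
    have hmap : ∀ F : ℤ × ℤ × ℤ → Module.End ℂ V,
        (diffEnd e₁ e₃ ^ k) ((diffEnd e₂ e₃ ^ k) (fun p => F p v)) p =
          (diffEnd e₁ e₃ ^ k) ((diffEnd e₂ e₃ ^ k) F) p v := by
      intro F
      have h1 := diffEnd_pow_map e₂ e₃ (LinearMap.applyₗ v : Module.End ℂ V →ₗ[ℂ] V) k F
      have h2 := diffEnd_pow_map e₁ e₃ (LinearMap.applyₗ v : Module.End ℂ V →ₗ[ℂ] V) k
        ((diffEnd e₂ e₃ ^ k) F)
      simp only [LinearMap.applyₗ_apply_apply] at h1 h2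
      rw [h1, h2]
    obtain ⟨N, hN⟩ := (diffEnd_pow_eventuallyEq e₁ e₃ k (diffEnd_pow_eventuallyEq e₂ e₃ k
      (fun p => hF p v)) p).exists
    rw [← hmap, ← hN, hmap, map_sum, map_sum, Finset.sum_eq_zero fun j _ => hf j]
  constructor
  · refine key _ (fun j p => ⁅ncoeff a (p.1 + (-1 - j)) * ncoeff b (p.2.1 + j), ncoeff c p.2.2⁆)
      (fun p v => ?_) (fun j => ha.diffEnd_lie_mul hb _ _)
    filter_upwards [halfProduct_eventually a b p.1 p.2.1 v,
      halfProduct_eventually a b p.1 p.2.1 (ncoeff c p.2.2 v)] with N h1 h2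
    simp [Ring.lie_def, ← h1, ← h2, Finset.sum_apply, LinearMap.sum_apply, sub_eq_add_neg,
      Finset.sum_add_distrib, add_assoc]
  · refine key _ (fun j p => ⁅ncoeff b (p.2.1 + (-1 - j)) * ncoeff a (p.1 + j), ncoeff c p.2.2⁆)
      (fun p v => ?_) (fun j => ha.diffEnd_lie_mul' hb _ _)
    filter_upwards [halfProduct_eventually b a p.2.1 p.1 v,
      halfProduct_eventually b a p.2.1 p.1 (ncoeff c p.2.2 v)] with N h1 h2
    simp [Ring.lie_def, ← h1, ← h2, Finset.sum_apply, LinearMap.sum_apply, sub_eq_add_neg,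
      Finset.sum_add_distrib, add_assoc]

open VertexOperator in
/-- Dong's lemma for the formal product `(z₁ - z₂)⁻¹ [a(z₁), b(z₂)]`. -/
theorem fullProduct_local {k : ℕ} {a b c : VertexOperator ℂ V}
    (hab : ModesLocal k (ncoeff a) (ncoeff b)) (ha : ModesLocal k (ncoeff a) (ncoeff c))
    (hb : ModesLocal k (ncoeff b) (ncoeff c)) (r : ℤ) :
    ModesLocal (k + 1 + k + k) (fun s => fullProduct a b (r, s)) (ncoeff c) := by
  set F : ℤ × ℤ × ℤ → Module.End ℂ V := fun p => ⁅fullProduct a b (p.1, p.2.1), ncoeff c p.2.2⁆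
    with hF
  have h13 : (diffEnd e₁ e₃ ^ k) ((diffEnd e₂ e₃ ^ k) F) = 0 := by
    have : F = (fun p => ⁅halfProduct a b p.1 p.2.1, ncoeff c p.2.2⁆) +
        fun p => ⁅halfProduct b a p.2.1 p.1, ncoeff c p.2.2⁆ := by
      funext p; simp only [hF, fullProduct, Pi.add_apply, Ring.lie_def]; noncomm_ring
    rw [this, map_add, map_add, (diffEnd_halfProduct ha hb).1, (diffEnd_halfProduct ha hb).2,
      add_zero]
  -- One difference turns the formal product into the commutator of `a` and `b`; the other `k`
  -- annihilate it by locality.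
  have h12 : (diffEnd e₁ e₂ ^ (k + 1)) F = 0 := by
    funext ⟨r, s, t⟩
    have h1 := diffEnd_pow_comp ((1, 0) : ℤ × ℤ) (0, 1) e₁ e₂ (fun p => (p.1, p.2, t))
      (fun p => by ext <;> simp) (fun p => by ext <;> simp) (k + 1) F
    have h2 := diffEnd_pow_map ((1, 0) : ℤ × ℤ) (0, 1)
      (LinearMap.mulRight ℂ (ncoeff c t) - LinearMap.mulLeft ℂ (ncoeff c t)) (k + 1)
      (fullProduct a b)
    have h3 := congrFun h1 (r, s)
    simp only [Function.comp_apply] at h3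
    rw [← h3, pow_succ]
    rw [pow_succ] at h2
    simp only [Module.End.mul_apply] at h2 ⊢
    rw [diffEnd_fullProduct, hab] at h2
    simpa [Function.comp_def, hF, Ring.lie_def] using congrFun h2 (r, s)
  -- This is `z₂ - z₃ = (z₁ - z₃) - (z₁ - z₂)`: powers of both terms on the right kill the function,
  -- hence so does a power of the left side.
  have h23 : (diffEnd e₂ e₃ ^ (k + 1 + k)) ((diffEnd e₂ e₃ ^ k) F) = 0 := by
    have hd : (diffEnd e₂ e₃ : Module.End ℂ (ℤ × ℤ × ℤ → Module.End ℂ V)) =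
        diffEnd e₁ e₃ - diffEnd e₁ e₂ := by simp only [diffEnd]; abel
    have := Commute.sub_pow_apply_eq_zero
      (diffEnd_commute (M := Module.End ℂ V) e₁ e₂ e₁ e₃) (k + 1) k ((diffEnd e₂ e₃ ^ k) F)
      (by rw [diffEnd_pow_commute_apply, h12, map_zero]) h13
    rw [← hd] at this
    exact this
  have h := diffEnd_pow_comp ((1, 0) : ℤ × ℤ) (0, 1) e₂ e₃ (fun p => (r, p.1, p.2))
      (fun p => by ext <;> simp) (fun p => by ext <;> simp) (k + 1 + k + k) F
  rw [pow_add (diffEnd e₂ e₃), Module.End.mul_apply, h23] at h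
  exact h

open VertexOperator in
theorem diffEnd_pow_fullProduct_local {k : ℕ} {a b c : VertexOperator ℂ V}
    (hab : ModesLocal k (ncoeff a) (ncoeff b)) (ha : ModesLocal k (ncoeff a) (ncoeff c))
    (hb : ModesLocal k (ncoeff b) (ncoeff c)) (n : ℕ) (r : ℤ) :
    ModesLocal (k + 1 + k + k)
      (fun s => (diffEnd (1, 0) (0, 1) ^ n) (fullProduct a b) (r, s)) (ncoeff c) := by
  induction n generalizing r with
  | zero => exact fullProduct_local hab ha hb r
  | succ n ih =>
    rw [pow_succ']
    simp only [Module.End.mul_apply, diffEnd_apply, Prod.mk_add_mk, add_zero]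
    exact (ih (r + 1)).sub ((ih r).shift 1)

end Locality

/-! ### Products of fields in a vertex operator algebra -/

namespace VertexOperatorAlgebra

variable {V : Type*} [AddCommGroup V] [Module ℂ V] (𝒱 : VertexOperatorAlgebra V)

theorem exists_modesLocal (u v : V) : ∃ k, ModesLocal k (𝒱.mode u) (𝒱.mode v) :=
  let ⟨k, hk⟩ := 𝒱.locality u v
  ⟨k, hk.modesLocal⟩

theorem mode_vac {n : ℤ} (hn : 0 ≤ n) (u : V) : 𝒱.mode u n 𝒱.vac = 0 :=
  𝒱.creative_nonneg u n hn

theorem mode_neg_one_vac (u : V) : 𝒱.mode u (-1) 𝒱.vac = u := 𝒱.creative u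

theorem L_eq (n : ℤ) : 𝒱.L n = 𝒱.mode 𝒱.conf (n + 1) := rfl

theorem L_neg_one : 𝒱.L (-1) = 𝒱.mode 𝒱.conf 0 := rfl

theorem mode_L_neg_one (u : V) (n : ℤ) :
    𝒱.mode (𝒱.L (-1) u) n = (-(n : ℂ)) • 𝒱.mode u (n - 1) := 𝒱.translation u n

theorem eventually_mode_eq_zero (u v : V) (s : ℤ) :
    ∀ᶠ n : ℕ in Filter.atTop, 𝒱.mode u (s + n) v = 0 :=
  VertexOperator.eventually_ncoeff_eq_zero _ v s

/-- A family of operators that annihilates the vacuum and is local with all fields vanishes. -/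
theorem eq_zero_of_local {X : ℤ → Module.End ℂ V}
    (hloc : ∀ w, ∃ k, ModesLocal k X (𝒱.mode w)) (hvac : ∀ m, X m 𝒱.vac = 0) : X = 0 := by
  funext m
  ext w
  -- With these indices only `j = 0` survives on the vacuum, because `w_{j-1} 𝟏 = 0` for `j ≥ 1`;
  -- the surviving term is `X m (w₋₁ 𝟏) = X m w`.
  obtain ⟨k, hk⟩ := hloc w
  have h := LinearMap.congr_fun (modesLocal_iff.mp hk (m - k) (-1)) 𝒱.vac
  rw [LinearMap.sum_apply, Finset.sum_eq_single 0] at h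
  · simpa [Ring.lie_def, hvac, mode_neg_one_vac] using h
  · intro j _ hj
    have : 𝒱.mode w ((j : ℤ) + -1) 𝒱.vac = 0 := 𝒱.mode_vac (by omega) w
    simp [Ring.lie_def, hvac, this]
  · simp

theorem eq_of_local {X X' : ℤ → Module.End ℂ V}
    (hloc : ∀ w, ∃ k, ModesLocal k X (𝒱.mode w)) (hloc' : ∀ w, ∃ k, ModesLocal k X' (𝒱.mode w))
    (hvac : ∀ m, X m 𝒱.vac = X' m 𝒱.vac) : X = X' := by
  refine sub_eq_zero.mp (𝒱.eq_zero_of_local (fun w => ?_) fun m => by simp [hvac])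
  obtain ⟨k, hk⟩ := hloc w
  obtain ⟨l, hl⟩ := hloc' w
  exact ⟨max k l, (hk.mono (le_max_left _ _)).sub (hl.mono (le_max_right _ _))⟩

theorem L_neg_one_mode_vac (u : V) (m : ℤ) :
    𝒱.L (-1) (𝒱.mode u m 𝒱.vac) = (-(m : ℂ)) • 𝒱.mode u (m - 1) 𝒱.vac := by
  rcases lt_trichotomy 0 m with hm | rfl | hm
  · rw [𝒱.mode_vac hm.le, 𝒱.mode_vac (by omega : 0 ≤ m - 1)]; simp
  · rw [𝒱.mode_vac le_rfl]; simp
  -- This is the coefficientwise form of `Y(u, z)𝟏 = exp(z L₋₁) u`.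
  · have key : ∀ (k : ℕ) (u : V), (k.factorial : ℂ) • 𝒱.mode u (-1 - k) 𝒱.vac =
        (𝒱.L (-1) ^ k) u := by
      intro k
      induction k with
      | zero => intro u; simp [mode_neg_one_vac]
      | succ k ih =>
        intro u
        rw [pow_succ, Module.End.mul_apply, ← ih, mode_L_neg_one, LinearMap.smul_apply, smul_smul,
          show (-1 - (k : ℤ) - 1) = -1 - ((k + 1 : ℕ) : ℤ) by push_cast; ring, Nat.factorial_succ]
        congr 1
        push_cast
        ring
    obtain ⟨k, rfl⟩ : ∃ k : ℕ, m = -1 - k := ⟨(-1 - m).toNat, by omega⟩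
    have h1 := key k u
    have h2 := key (k + 1) u
    rw [pow_succ', Module.End.mul_apply, ← h1, map_smul, Nat.factorial_succ,
      show -1 - ((k + 1 : ℕ) : ℤ) = -1 - (k : ℤ) - 1 by push_cast; ring] at h2
    have h3 : (k.factorial : ℂ) ≠ 0 := Nat.cast_ne_zero.mpr k.factorial_ne_zero
    apply smul_right_injective V h3
    simp only
    rw [← h2, smul_smul]
    congr 1
    push_cast
    ring

theorem exists_diffEnd_pow_fullProduct_local (u v w : V) (n : ℕ) (r : ℤ) :
    ∃ k, ModesLocal k (fun s => (diffEnd (1, 0) (0, 1) ^ n) (fullProduct (𝒱.Y u) (𝒱.Y v)) (r, s))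
      (𝒱.mode w) := by
  obtain ⟨k₁, h₁⟩ := 𝒱.exists_modesLocal u v
  obtain ⟨k₂, h₂⟩ := 𝒱.exists_modesLocal u w
  obtain ⟨k₃, h₃⟩ := 𝒱.exists_modesLocal v w
  exact ⟨_, diffEnd_pow_fullProduct_local (k := max k₁ (max k₂ k₃)) (h₁.mono (le_max_left _ _))
    (h₂.mono ((le_max_left _ _).trans (le_max_right _ _)))
    (h₃.mono ((le_max_right _ _).trans (le_max_right _ _))) n r⟩

/-- The translation axiom concerns only modes of `L₋₁ u`. Since `L₋₁ = ω₀`, the bracket is a first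
difference of a formal product, hence local by Dong's lemma, and it agrees with the modes of `L₋₁ u`
on the vacuum. -/
theorem L_neg_one_lie_mode (u : V) (m : ℤ) :
    ⁅𝒱.L (-1), 𝒱.mode u m⁆ = (-(m : ℂ)) • 𝒱.mode u (m - 1) := by
  rw [← mode_L_neg_one]
  refine congrFun (𝒱.eq_of_local (X := fun m => ⁅𝒱.L (-1), 𝒱.mode u m⁆)
    (X' := 𝒱.mode (𝒱.L (-1) u)) (fun w => ?_) (fun w => 𝒱.exists_modesLocal _ w) fun m => ?_) m
  · have := 𝒱.exists_diffEnd_pow_fullProduct_local 𝒱.conf u w 1 0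
    rw [pow_one, diffEnd_fullProduct] at this
    exact this
  · rw [mode_L_neg_one, LinearMap.smul_apply, ← L_neg_one_mode_vac, Ring.lie_def,
      LinearMap.sub_apply, Module.End.mul_apply, Module.End.mul_apply, 𝒱.L_neg_one,
      𝒱.mode_vac le_rfl, map_zero, sub_zero]

theorem L_neg_one_mode (u v : V) (m : ℤ) :
    𝒱.L (-1) (𝒱.mode u m v) = 𝒱.mode u m (𝒱.L (-1) v) - (m : ℂ) • 𝒱.mode u (m - 1) v := by
  have := LinearMap.congr_fun (𝒱.L_neg_one_lie_mode u m) v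
  simp only [Ring.lie_def, LinearMap.sub_apply, Module.End.mul_apply, LinearMap.smul_apply] at this
  rw [sub_eq_iff_eq_add.mp this]
  module

theorem halfProduct_vac {s : ℤ} (hs : 0 ≤ s) (u v : V) (r : ℤ) :
    halfProduct (𝒱.Y u) (𝒱.Y v) r s 𝒱.vac = 0 := by
  obtain ⟨N, hN⟩ := (halfProduct_eventually (𝒱.Y u) (𝒱.Y v) r s 𝒱.vac).exists
  rw [← hN]
  refine Finset.sum_eq_zero fun j _ => ?_
  have : VertexOperator.ncoeff (𝒱.Y v) (s + j) 𝒱.vac = 0 := 𝒱.mode_vac (by omega) v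
  rw [this, map_zero]

/-- Translation covariance of the formal product: termwise the two sides differ by a telescoping sum
whose boundary terms vanish. -/
theorem L_neg_one_halfProduct_vac (u v : V) (r s : ℤ) :
    𝒱.L (-1) (halfProduct (𝒱.Y u) (𝒱.Y v) r s 𝒱.vac) =
      (-(r : ℂ)) • halfProduct (𝒱.Y u) (𝒱.Y v) (r - 1) s 𝒱.vac -
        (s : ℂ) • halfProduct (𝒱.Y u) (𝒱.Y v) r (s - 1) 𝒱.vac := by
  obtain ⟨N, h0, h1, h2, h3⟩ := ((halfProduct_eventually (𝒱.Y u) (𝒱.Y v) r s 𝒱.vac).and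
    ((halfProduct_eventually (𝒱.Y u) (𝒱.Y v) (r - 1) s 𝒱.vac).and
    ((halfProduct_eventually (𝒱.Y u) (𝒱.Y v) r (s - 1) 𝒱.vac).and
      (𝒱.eventually_mode_eq_zero v 𝒱.vac (s - 1))))).exists
  rw [← h0, ← h1, ← h2, map_sum, ← sub_eq_zero, Finset.smul_sum, Finset.smul_sum,
    ← Finset.sum_sub_distrib, ← Finset.sum_sub_distrib]
  have key : ∀ j : ℕ, 𝒱.L (-1) (VertexOperator.ncoeff (𝒱.Y u) (r - 1 - j)
        (VertexOperator.ncoeff (𝒱.Y v) (s + j) 𝒱.vac)) -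
      ((-(r : ℂ)) • VertexOperator.ncoeff (𝒱.Y u) (r - 1 - 1 - j)
        (VertexOperator.ncoeff (𝒱.Y v) (s + j) 𝒱.vac) -
      (s : ℂ) • VertexOperator.ncoeff (𝒱.Y u) (r - 1 - j)
        (VertexOperator.ncoeff (𝒱.Y v) (s - 1 + j) 𝒱.vac)) =
      ((j + 1 : ℕ) : ℂ) • 𝒱.mode u (r - 1 - (j + 1 : ℕ)) (𝒱.mode v (s - 1 + (j + 1 : ℕ)) 𝒱.vac) -
        (j : ℂ) • 𝒱.mode u (r - 1 - j) (𝒱.mode v (s - 1 + j) 𝒱.vac) := by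
    intro j
    have e1 : r - 1 - ((j + 1 : ℕ) : ℤ) = r - 1 - 1 - j := by push_cast; ring
    have e2 : s - 1 + ((j + 1 : ℕ) : ℤ) = s + j := by push_cast; ring
    have e3 : r - 1 - (j : ℤ) - 1 = r - 1 - 1 - j := by ring
    have e4 : s + (j : ℤ) - 1 = s - 1 + j := by ring
    have h := 𝒱.L_neg_one_mode u (𝒱.mode v (s + j) 𝒱.vac) (r - 1 - j)
    rw [𝒱.L_neg_one_mode_vac, map_smul, e3, e4] at h
    simp only [mode] at h ⊢
    rw [h, e1, e2]
    push_cast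
    module
  simp only [key]
  rw [Finset.sum_range_sub (fun j : ℕ => (j : ℂ) • 𝒱.mode u (r - 1 - j)
    (𝒱.mode v (s - 1 + j) 𝒱.vac)), h3]
  simp

theorem L_neg_one_diffEnd_pow_fullProduct_vac (u v : V) (n : ℕ) (r s : ℤ) :
    𝒱.L (-1) ((diffEnd (1, 0) (0, 1) ^ n) (fullProduct (𝒱.Y u) (𝒱.Y v)) (r, s) 𝒱.vac) =
      (-(r : ℂ)) • (diffEnd (1, 0) (0, 1) ^ n) (fullProduct (𝒱.Y u) (𝒱.Y v)) (r - 1, s) 𝒱.vac -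
      (s : ℂ) • (diffEnd (1, 0) (0, 1) ^ n) (fullProduct (𝒱.Y u) (𝒱.Y v)) (r, s - 1) 𝒱.vac := by
  induction n generalizing r s with
  | zero =>
    simp only [pow_zero, Module.End.one_apply, fullProduct, LinearMap.add_apply, map_add,
      L_neg_one_halfProduct_vac]
    module
  | succ n ih =>
    simp only [pow_succ', Module.End.mul_apply, diffEnd_apply, Prod.mk_add_mk, add_zero,
      LinearMap.sub_apply, map_sub, ih, add_sub_cancel_right, sub_add_cancel]
    push_cast
    module

theorem diffEnd_pow_fullProduct_vac (u v : V) (n : ℕ) {r s : ℤ} (hr : 0 ≤ r) (hs : 0 ≤ s) :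
    (diffEnd (1, 0) (0, 1) ^ n) (fullProduct (𝒱.Y u) (𝒱.Y v)) (r, s) 𝒱.vac = 0 := by
  induction n generalizing r s with
  | zero => simp [fullProduct, 𝒱.halfProduct_vac hr, 𝒱.halfProduct_vac hs]
  | succ n ih =>
    simp only [pow_succ', Module.End.mul_apply, diffEnd_apply, Prod.mk_add_mk, add_zero,
      LinearMap.sub_apply]
    rw [ih (by omega) hs, ih hr (by omega), sub_zero]

/-- For `n = 0` only `u_{r-1} v₋₁ 𝟏` survives. Each further difference raises `r`, its other term
lying at `s = 0`, where the vacuum is annihilated. -/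
theorem diffEnd_pow_fullProduct_neg_one_vac (u v : V) (n : ℕ) {r : ℤ} (hr : 0 ≤ r) :
    (diffEnd (1, 0) (0, 1) ^ n) (fullProduct (𝒱.Y u) (𝒱.Y v)) (r, -1) 𝒱.vac =
      𝒱.mode u (r + n - 1) v := by
  induction n generalizing r with
  | zero =>
    have h := LinearMap.congr_fun (halfProduct_sub (𝒱.Y u) (𝒱.Y v) (r - 1) (-1)) 𝒱.vac
    rw [sub_add_cancel, LinearMap.sub_apply, 𝒱.halfProduct_vac (show (0 : ℤ) ≤ -1 + 1 by norm_num), sub_zero,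
      Module.End.mul_apply, 𝒱.creative] at h
    simp [fullProduct, 𝒱.halfProduct_vac hr, h, mode]
  | succ n ih =>
    simp only [pow_succ', Module.End.mul_apply, diffEnd_apply, Prod.mk_add_mk, add_zero,
      LinearMap.sub_apply]
    rw [ih (by omega), 𝒱.diffEnd_pow_fullProduct_vac u v n hr (by norm_num), sub_zero]
    congr 2
    push_cast
    ring

/-- The product formula for the modes of `u_{n-1} v`. -/
theorem mode_mode (u v : V) (n : ℕ) (m : ℤ) : 𝒱.mode (𝒱.mode u (n - 1) v) m =
    (diffEnd (1, 0) (0, 1) ^ n) (fullProduct (𝒱.Y u) (𝒱.Y v)) (0, m) := by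
  refine congrFun (𝒱.eq_of_local (X := 𝒱.mode (𝒱.mode u (n - 1) v))
    (X' := fun m => (diffEnd (1, 0) (0, 1) ^ n) (fullProduct (𝒱.Y u) (𝒱.Y v)) (0, m))
    (fun w => 𝒱.exists_modesLocal _ w)
    (fun w => 𝒱.exists_diffEnd_pow_fullProduct_local u v w n 0) fun m => ?_) m
  rcases le_or_gt 0 m with hm | hm
  · rw [𝒱.mode_vac hm, 𝒱.diffEnd_pow_fullProduct_vac u v n le_rfl hm]
  obtain ⟨k, rfl⟩ : ∃ k : ℕ, m = -1 - k := ⟨(-1 - m).toNat, by omega⟩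
  clear hm
  induction k with
  | zero =>
    have := 𝒱.diffEnd_pow_fullProduct_neg_one_vac u v n le_rfl
    simp only [Nat.cast_zero, sub_zero, this, mode_neg_one_vac, zero_add]
  -- Both sides obey the same rule under `L₋₁` on the vacuum, which determines the value at `m - 1`
  -- from that at `m` because `m ≠ 0`.
  | succ k ih =>
    have h1 := 𝒱.L_neg_one_mode_vac (𝒱.mode u (n - 1) v) (-1 - k)
    have h2 := 𝒱.L_neg_one_diffEnd_pow_fullProduct_vac u v n 0 (-1 - k)
    rw [ih, h2] at h1
    have hk : ((-1 - (k : ℤ) : ℤ) : ℂ) ≠ 0 := by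
      rw [Int.cast_ne_zero]; omega
    rw [show -1 - ((k + 1 : ℕ) : ℤ) = -1 - (k : ℤ) - 1 by push_cast; ring]
    refine smul_right_injective V (neg_ne_zero.mpr hk) ?_
    simp only
    rw [← h1, Int.cast_zero]
    module

/-- The right side commutes with everything, so only the action on the vacuum matters; there `L₋₁ 𝟏
= 0` and the translation axiom dispose of `n < -1`. -/
theorem mode_vac_apply (n : ℤ) : 𝒱.mode 𝒱.vac n = if n = -1 then 1 else 0 := by
  refine congrFun (𝒱.eq_of_local (X := 𝒱.mode 𝒱.vac) (X' := fun n => if n = -1 then 1 else 0)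
    (fun w => 𝒱.exists_modesLocal _ w) (fun w => ⟨0, ?_⟩) fun m => ?_) n
  · funext p
    simp only [pow_zero, Module.End.one_apply, Pi.zero_apply]
    split_ifs <;> simp [Ring.lie_def]
  · rcases lt_trichotomy m (-1) with hm | rfl | hm
    · rw [if_neg hm.ne, LinearMap.zero_apply]
      have h := 𝒱.mode_L_neg_one 𝒱.vac (m + 1)
      rw [𝒱.L_neg_one, 𝒱.mode_vac le_rfl, add_sub_cancel_right] at h
      have h' := LinearMap.congr_fun h 𝒱.vac
      have hm' : (-((m + 1 : ℤ) : ℂ)) ≠ 0 := by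
        rw [neg_ne_zero, Int.cast_ne_zero]; omega
      rw [LinearMap.smul_apply] at h'
      refine (smul_eq_zero.mp (h'.symm.trans ?_)).resolve_left hm'
      simp [mode]
    · simp [mode_neg_one_vac]
    · rw [if_neg hm.ne', 𝒱.mode_vac (by omega), LinearMap.zero_apply]

/-- The commutator formula for two states with `u_j v = 0` for `j ≥ 2`. -/
theorem mode_lie_mode {u v : V} (huv : ∀ j : ℤ, 2 ≤ j → 𝒱.mode u j v = 0) (r s : ℤ) :
    ⁅𝒱.mode u r, 𝒱.mode v s⁆ = 𝒱.mode (𝒱.mode u 0 v) (r + s) +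
      (r : ℂ) • 𝒱.mode (𝒱.mode u 1 v) (r + s - 1) := by
  set K : ℕ → ℤ × ℤ → Module.End ℂ V := fun n =>
    (diffEnd (1, 0) (0, 1) ^ n) (fullProduct (𝒱.Y u) (𝒱.Y v)) with hK
  have hstep : ∀ n r s, K (n + 1) (r, s) = K n (r + 1, s) - K n (r, s + 1) := fun n r s => by
    simp [hK, pow_succ', diffEnd_apply]
  have hzero : ∀ n s, K n (0, s) = 𝒱.mode (𝒱.mode u (n - 1) v) s := fun n s =>
    (𝒱.mode_mode u v n s).symm
  have hcomm : ∀ r s, K 1 (r, s) = ⁅𝒱.mode u r, 𝒱.mode v s⁆ := fun r s => by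
    simp only [hK, pow_one, diffEnd_fullProduct]; rfl
  -- A distribution killed by `z₁ - z₂` is supported on the diagonal: its coefficients depend on `r
  -- + s` only.
  have hconst : ∀ n, (∀ r s, K (n + 1) (r, s) = 0) → ∀ r s, K n (r, s) = K n (0, r + s) := by
    intro n hn r
    induction r using Int.induction_on with
    | zero => simp
    | succ i ih =>
      intro s
      rw [← sub_eq_zero.mp ((hstep n i s).symm.trans (hn _ _)) |>.symm, ih]
      congr 2; ring
    | pred i ih =>
      intro s
      have h := sub_eq_zero.mp ((hstep n (-i - 1) (s - 1)).symm.trans (hn _ _))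
      rw [sub_add_cancel, sub_add_cancel, ih] at h
      rw [← h]
      congr 2; ring
  -- Descent from the order of locality: if `K (n + 1) = 0` with `n ≥ 3`, then `K n` consists of the
  -- modes of `u_{n-1} v`, which is zero.
  have h3 : ∀ r s, K 3 (r, s) = 0 := by
    obtain ⟨k, hk⟩ := 𝒱.exists_modesLocal u v
    have hbig : ∀ r s, K (k + 3) (r, s) = 0 := fun r s => by
      have : (diffEnd (1, 0) (0, 1) ^ (k + 3)) (fullProduct (𝒱.Y u) (𝒱.Y v)) = 0 := by
        have h0 : (diffEnd ((1, 0) : ℤ × ℤ) (0, 1) ^ (k + 2))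
            (fun p => ⁅𝒱.mode u p.1, 𝒱.mode v p.2⁆) = 0 := hk.mono (by omega)
        rw [pow_succ, Module.End.mul_apply, diffEnd_fullProduct]
        exact h0
      simp only [hK, this, Pi.zero_apply]
    clear hk
    induction k with
    | zero => exact hbig
    | succ k ih =>
      refine ih fun r s => ?_
      rw [hconst (k + 3) (fun r s => by rw [← hbig r s]) r s, hzero,
        huv _ (by push_cast; omega)]
      ext; simp [mode]
  have h2 : ∀ r s, K 2 (r, s) = 𝒱.mode (𝒱.mode u 1 v) (r + s) := fun r s => by
    rw [hconst 2 h3 r s, hzero]; norm_num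
  have h10 : ∀ s, K 1 (0, s) = 𝒱.mode (𝒱.mode u 0 v) s := fun s => by rw [hzero]; norm_num
  rw [← hcomm]
  induction r using Int.induction_on generalizing s with
  | zero => rw [h10]; simp
  | succ i ih =>
    rw [sub_eq_iff_eq_add.mp ((hstep 1 i s).symm.trans (h2 _ _)), ih,
      show (i : ℤ) + (s + 1) = i + 1 + s by ring, show (i : ℤ) + 1 + s - 1 = i + s by ring]
    push_cast
    module
  | pred i ih =>
    have h := (hstep 1 (-i - 1) (s - 1)).symm.trans (h2 _ _)
    rw [sub_add_cancel, sub_add_cancel, ih, sub_eq_iff_eq_add] at h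
    rw [show -(i : ℤ) + (s - 1) = -i - 1 + s by ring,
      show -(i : ℤ) - 1 + (s - 1) = -i - 1 + s - 1 by ring] at h
    rw [← sub_eq_iff_eq_add'.mpr h]
    push_cast
    module

/-- The modes of the normally ordered product `u_{-1} v`. -/
theorem mode_mode_neg_one (u v w : V) (m : ℤ) : ∀ᶠ N : ℕ in Filter.atTop,
    𝒱.mode (𝒱.mode u (-1) v) m w = ∑ j ∈ Finset.range N,
      (𝒱.mode u (-1 - j) (𝒱.mode v (m + j) w) + 𝒱.mode v (m - 1 - j) (𝒱.mode u j w)) := by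
  have h := 𝒱.mode_mode u v 0 m
  filter_upwards [halfProduct_eventually (𝒱.Y u) (𝒱.Y v) 0 m w,
    halfProduct_eventually (𝒱.Y v) (𝒱.Y u) m 0 w] with N h1 h2
  simp only [Nat.cast_zero, zero_sub, pow_zero, Module.End.one_apply] at h
  rw [h, fullProduct, LinearMap.add_apply, ← h1, ← h2, Finset.sum_add_distrib]
  simp [mode]

end VertexOperatorAlgebra

/-! ### The Virasoro subalgebra -/

namespace VertexOperatorAlgebra

variable {V : Type*} [AddCommGroup V] [Module ℂ V] (𝒱 : VertexOperatorAlgebra V)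

theorem L_lie_L (m n : ℤ) : ⁅𝒱.L m, 𝒱.L n⁆ = ((m : ℂ) - n) • 𝒱.L (m + n) +
    (if m = -n then ((m : ℂ) ^ 3 - m) / 12 * 𝒱.centralCharge else 0) • (1 : Module.End ℂ V) :=
  𝒱.virasoro m n

theorem L_L_apply (m n : ℤ) (v : V) : 𝒱.L m (𝒱.L n v) = 𝒱.L n (𝒱.L m v) +
    ((m : ℂ) - n) • 𝒱.L (m + n) v +
      (if m = -n then ((m : ℂ) ^ 3 - m) / 12 * 𝒱.centralCharge else 0) • v := by
  have h := LinearMap.congr_fun (𝒱.L_lie_L m n) v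
  simp only [Ring.lie_def, LinearMap.sub_apply, Module.End.mul_apply, LinearMap.add_apply,
    LinearMap.smul_apply, Module.End.one_apply] at h
  rw [sub_eq_iff_eq_add.mp h]
  abel

theorem L_vac {n : ℤ} (hn : -1 ≤ n) : 𝒱.L n 𝒱.vac = 0 := 𝒱.mode_vac (by omega) _

theorem L_neg_two_vac : 𝒱.L (-2) 𝒱.vac = 𝒱.conf := 𝒱.mode_neg_one_vac _

theorem mem_weightSpace {n : ℤ} {v : V} : v ∈ 𝒱.weightSpace n ↔ 𝒱.L 0 v = (n : ℂ) • v :=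
  Module.End.mem_eigenspace_iff

theorem vac_mem_weightSpace : 𝒱.vac ∈ 𝒱.weightSpace 0 := by
  rw [mem_weightSpace, L_vac _ (by norm_num)]; simp

theorem L_mem_weightSpace {k : ℤ} {v : V} (hv : v ∈ 𝒱.weightSpace k) (n : ℤ) :
    𝒱.L n v ∈ 𝒱.weightSpace (k - n) := by
  rw [mem_weightSpace] at hv ⊢
  rw [𝒱.L_L_apply, hv, map_smul, zero_add]
  have : (if (0 : ℤ) = -n then (((0 : ℤ) : ℂ) ^ 3 - (0 : ℤ)) / 12 * 𝒱.centralCharge else 0) = 0 := by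
    simp
  rw [this]
  push_cast
  module

theorem bijective_coeLinearMap_weightSpace :
    Function.Bijective (DirectSum.coeLinearMap 𝒱.weightSpace) := 𝒱.grading

/-- The projection of `V` onto `Vₙ`. -/
noncomputable def weightProj (n : ℤ) : V →ₗ[ℂ] 𝒱.weightSpace n :=
  DirectSum.component ℂ ℤ (fun n => 𝒱.weightSpace n) n ∘ₗ
    (LinearEquiv.ofBijective (DirectSum.coeLinearMap 𝒱.weightSpace)
      𝒱.bijective_coeLinearMap_weightSpace).symm.toLinearMap

theorem weightProj_coe (m n : ℤ) (v : 𝒱.weightSpace m) : 𝒱.weightProj n v =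
    DirectSum.component ℂ ℤ (fun n => 𝒱.weightSpace n) n
      (DirectSum.lof ℂ ℤ (fun n => 𝒱.weightSpace n) m v) := by
  have : (LinearEquiv.ofBijective (DirectSum.coeLinearMap 𝒱.weightSpace)
      𝒱.bijective_coeLinearMap_weightSpace).symm (v : V) =
      DirectSum.lof ℂ ℤ (fun n => 𝒱.weightSpace n) m v := by
    rw [LinearEquiv.symm_apply_eq, LinearEquiv.ofBijective_apply, DirectSum.coeLinearMap_lof]
  simp only [weightProj, LinearMap.comp_apply, LinearEquiv.coe_coe, this]

theorem weightProj_self (n : ℤ) (v : 𝒱.weightSpace n) : 𝒱.weightProj n v = v := by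
  rw [weightProj_coe, DirectSum.component.lof_self]

theorem weightProj_of_ne {m n : ℤ} (h : m ≠ n) {v : V} (hv : v ∈ 𝒱.weightSpace m) :
    𝒱.weightProj n v = 0 := by
  have := 𝒱.weightProj_coe m n ⟨v, hv⟩
  rwa [DirectSum.component.of, dif_neg h] at this

/-- `w` is obtained from the vacuum by applying operators `L_{-m}`, `m ≥ 1`, of total weight
`n`. -/
inductive IsVirasoroWord : ℕ → V → Prop
  | vac : IsVirasoroWord 0 𝒱.vac
  | step (m n : ℕ) (w : V) : IsVirasoroWord n w → IsVirasoroWord (n + m + 1) (𝒱.L (-(m + 1)) w)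

/-- The span of the descendants of the vacuum. -/
def descendants : Submodule ℂ V := Submodule.span ℂ {w | ∃ n, 𝒱.IsVirasoroWord n w}

variable {𝒱}

theorem IsVirasoroWord.mem_descendants {n : ℕ} {w : V} (h : 𝒱.IsVirasoroWord n w) :
    w ∈ 𝒱.descendants := Submodule.subset_span ⟨n, h⟩

theorem IsVirasoroWord.mem_weightSpace {n : ℕ} {w : V} (h : 𝒱.IsVirasoroWord n w) :
    w ∈ 𝒱.weightSpace n := by
  induction h with
  | vac => exact 𝒱.vac_mem_weightSpace
  | step m n w _ ih =>
    have := 𝒱.L_mem_weightSpace ih (-(m + 1))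
    rwa [show (n : ℤ) - -(m + 1) = ((n + m + 1 : ℕ) : ℤ) by push_cast; ring] at this

variable (𝒱)

theorem L_mem_descendants (n : ℤ) {v : V} (hv : v ∈ 𝒱.descendants) : 𝒱.L n v ∈ 𝒱.descendants := by
  have hneg : ∀ (m : ℕ) {v : V}, v ∈ 𝒱.descendants → 𝒱.L (-(m + 1)) v ∈ 𝒱.descendants := by
    intro m v hv
    induction hv using Submodule.span_induction with
    | mem v hv => exact (hv.choose_spec.step m).mem_descendants
    | zero => simp
    | add _ _ _ _ h1 h2 => rw [map_add]; exact add_mem h1 h2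
    | smul _ _ _ h => rw [map_smul]; exact Submodule.smul_mem _ _ h
  have hword : ∀ {k : ℕ} {w : V}, 𝒱.IsVirasoroWord k w → ∀ n, 𝒱.L n w ∈ 𝒱.descendants := by
    intro k w h
    induction h with
    | vac =>
      intro n
      rcases le_or_gt (-1) n with hn | hn
      · rw [𝒱.L_vac hn]; exact zero_mem _
      · obtain ⟨m, rfl⟩ : ∃ m : ℕ, n = -(m + 1) := ⟨(-n - 1).toNat, by omega⟩
        exact (IsVirasoroWord.vac.step m).mem_descendants
    | step m k w hw ih =>
      intro n
      rw [𝒱.L_L_apply]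
      exact add_mem (add_mem (hneg m (ih n)) (Submodule.smul_mem _ _ (ih _)))
        (Submodule.smul_mem _ _ hw.mem_descendants)
  induction hv using Submodule.span_induction with
  | mem v hv => exact hword hv.choose_spec n
  | zero => simp
  | add _ _ _ _ h1 h2 => rw [map_add]; exact add_mem h1 h2
  | smul _ _ _ h => rw [map_smul]; exact Submodule.smul_mem _ _ h

/-- A state whose modes preserve a subspace yields, on application of the Virasoro modes, states
with the same property, if the Virasoro modes preserve the subspace. -/
theorem mode_L_mem {D : Submodule ℂ V} (hD : ∀ n, ∀ v ∈ D, 𝒱.L n v ∈ D) (k : ℤ) {u : V}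
    (hu : ∀ n, ∀ v ∈ D, 𝒱.mode u n v ∈ D) : ∀ n, ∀ v ∈ D, 𝒱.mode (𝒱.L k u) n v ∈ D := by
  have hω : ∀ n, ∀ v ∈ D, 𝒱.mode 𝒱.conf n v ∈ D := fun n v hv => by
    have := hD (n - 1) v hv
    rwa [L_eq, sub_add_cancel] at this
  have half : ∀ {a b : V}, (∀ n, ∀ v ∈ D, 𝒱.mode a n v ∈ D) → (∀ n, ∀ v ∈ D, 𝒱.mode b n v ∈ D) →
      ∀ r s, ∀ v ∈ D, halfProduct (𝒱.Y a) (𝒱.Y b) r s v ∈ D := by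
    intro a b ha hb r s v hv
    obtain ⟨N, hN⟩ := (halfProduct_eventually (𝒱.Y a) (𝒱.Y b) r s v).exists
    rw [← hN]
    exact Submodule.sum_mem _ fun j _ => ha _ _ (hb _ _ hv)
  have hpos : ∀ (k : ℕ) {u : V}, (∀ n, ∀ v ∈ D, 𝒱.mode u n v ∈ D) →
      ∀ n, ∀ v ∈ D, 𝒱.mode (𝒱.mode 𝒱.conf (k - 1) u) n v ∈ D := by
    intro k u hu n v hv
    rw [mode_mode]
    suffices H : ∀ p, (diffEnd (1, 0) (0, 1) ^ k) (fullProduct (𝒱.Y 𝒱.conf) (𝒱.Y u)) p v ∈ D from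
      H (0, n)
    induction k with
    | zero => exact fun p => add_mem (half hω hu _ _ _ hv) (half hu hω _ _ _ hv)
    | succ k ih =>
      intro p
      rw [pow_succ', Module.End.mul_apply, diffEnd_apply, LinearMap.sub_apply]
      exact sub_mem (ih _) (ih _)
  have hneg : ∀ (k : ℕ) {u : V}, (∀ n, ∀ v ∈ D, 𝒱.mode u n v ∈ D) →
      ∀ n, ∀ v ∈ D, 𝒱.mode (𝒱.mode 𝒱.conf (-1 - k) u) n v ∈ D := by
    intro k
    induction k with
    | zero => intro u hu; simpa using hpos 0 hu
    | succ k ih =>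
      intro u hu n v hv
      have hT : ∀ {u : V}, (∀ n, ∀ v ∈ D, 𝒱.mode u n v ∈ D) →
          ∀ n, ∀ v ∈ D, 𝒱.mode (𝒱.L (-1) u) n v ∈ D := fun {u} hu n v hv => by
        rw [mode_L_neg_one]; exact Submodule.smul_mem _ _ (hu _ _ hv)
      have h := 𝒱.L_neg_one_mode 𝒱.conf u (-1 - k)
      rw [show -1 - (k : ℤ) - 1 = -1 - ((k + 1 : ℕ) : ℤ) by push_cast; ring] at h
      have hk : ((-1 - k : ℤ) : ℂ) ≠ 0 := by rw [Int.cast_ne_zero]; omega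
      -- The product formula stops at the index `-1`; lower modes of `ω` are reached through `[L₋₁,
      -- ω_m] = -m ω_{m-1}`.
      have h' : 𝒱.mode 𝒱.conf (-1 - ((k + 1 : ℕ) : ℤ)) u = ((-1 - k : ℤ) : ℂ)⁻¹ •
          (𝒱.mode 𝒱.conf (-1 - k) (𝒱.L (-1) u) - 𝒱.L (-1) (𝒱.mode 𝒱.conf (-1 - k) u)) := by
        rw [h, sub_sub_cancel, smul_smul, inv_mul_cancel₀ hk, one_smul]
      have h2 : 𝒱.mode (𝒱.mode 𝒱.conf (-1 - ((k + 1 : ℕ) : ℤ)) u) n v = ((-1 - k : ℤ) : ℂ)⁻¹ •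
          (𝒱.mode (𝒱.mode 𝒱.conf (-1 - k) (𝒱.L (-1) u)) n v -
            𝒱.mode (𝒱.L (-1) (𝒱.mode 𝒱.conf (-1 - k) u)) n v) := by
        rw [h']; simp [mode]
      rw [h2]
      exact Submodule.smul_mem _ _ (sub_mem (ih (hT hu) _ _ hv) (hT (ih hu) _ _ hv))
  rw [L_eq]
  rcases le_or_gt (-1) (k + 1) with hk | hk
  · obtain ⟨j, hj⟩ : ∃ j : ℕ, k + 1 = j - 1 := ⟨(k + 2).toNat, by omega⟩
    rw [hj]; exact hpos j hu
  · obtain ⟨j, hj⟩ : ∃ j : ℕ, k + 1 = -1 - j := ⟨(-k - 2).toNat, by omega⟩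
    rw [hj]; exact hneg j hu

/-- The span of the descendants contains `𝟏` and `ω` and is closed under all products, the latter by
induction on the word that acts. -/
theorem virasoroSubalgebra_le_descendants : 𝒱.virasoroSubalgebra ≤ 𝒱.descendants := by
  have hword : ∀ {k : ℕ} {u : V}, 𝒱.IsVirasoroWord k u →
      ∀ n, ∀ v ∈ 𝒱.descendants, 𝒱.mode u n v ∈ 𝒱.descendants := by
    intro k u h
    induction h with
    | vac =>
      intro n v hv
      rw [mode_vac_apply]
      split_ifs
      · exact hv
      · exact zero_mem _
    | step m k w _ ih => exact 𝒱.mode_L_mem (fun n v hv => 𝒱.L_mem_descendants n hv) _ ih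
  refine sInf_le ⟨IsVirasoroWord.vac.mem_descendants, ?_, ?_⟩
  · rw [← L_neg_two_vac]
    exact 𝒱.L_mem_descendants _ IsVirasoroWord.vac.mem_descendants
  · intro u hu v hv n
    induction hu using Submodule.span_induction with
    | mem u hu => exact hword hu.choose_spec n v hv
    | zero => simp [mode]
    | add x y _ _ h1 h2 => simpa [mode] using add_mem h1 h2
    | smul a x _ h => simpa [mode] using Submodule.smul_mem _ a h

/-- Induction on words needs the lower weights too. Words ending in `L₋₁ 𝟏` vanish, and a leading
`L₋₁` is commuted through to the vacuum. -/
theorem IsVirasoroWord.eq_of_le_four {n : ℕ} {w : V} (h : 𝒱.IsVirasoroWord n w) :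
    (n = 0 → w = 𝒱.vac) ∧ (n = 1 → w = 0) ∧ (n = 2 → ∃ a : ℂ, w = a • 𝒱.L (-2) 𝒱.vac) ∧
      (n = 3 → ∃ a : ℂ, w = a • 𝒱.L (-3) 𝒱.vac) ∧
      (n = 4 → w ∈ Submodule.span ℂ {𝒱.L (-2) (𝒱.L (-2) 𝒱.vac), 𝒱.L (-4) 𝒱.vac}) := by
  have hL : 𝒱.L (-1) 𝒱.vac = 0 := 𝒱.L_vac le_rfl
  have h12 : 𝒱.L (-1) (𝒱.L (-2) 𝒱.vac) = 𝒱.L (-3) 𝒱.vac := by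
    rw [L_L_apply, hL]; norm_num
  have h13 : 𝒱.L (-1) (𝒱.L (-3) 𝒱.vac) = (2 : ℂ) • 𝒱.L (-4) 𝒱.vac := by
    rw [L_L_apply, hL]; norm_num
  induction h with
  | vac => simp
  | step m n w _ ih =>
    obtain ⟨h0, h1, h2, h3, _⟩ := ih
    refine ⟨by omega, fun h => ?_, fun h => ?_, fun h => ?_, fun h => ?_⟩
    · obtain ⟨rfl, rfl⟩ : n = 0 ∧ m = 0 := by omega
      simpa [h0] using hL
    · obtain ⟨rfl, rfl⟩ | ⟨rfl, rfl⟩ : (n = 0 ∧ m = 1) ∨ (n = 1 ∧ m = 0) := by omega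
      · exact ⟨1, by simp [h0]⟩
      · exact ⟨0, by simp [h1]⟩
    · obtain ⟨rfl, rfl⟩ | ⟨rfl, rfl⟩ | ⟨rfl, rfl⟩ :
          (n = 0 ∧ m = 2) ∨ (n = 1 ∧ m = 1) ∨ (n = 2 ∧ m = 0) := by omega
      · exact ⟨1, by simp [h0]⟩
      · exact ⟨0, by simp [h1]⟩
      · obtain ⟨a, ha⟩ := h2 rfl
        exact ⟨a, by simp [ha, h12]⟩
    · obtain ⟨rfl, rfl⟩ | ⟨rfl, rfl⟩ | ⟨rfl, rfl⟩ | ⟨rfl, rfl⟩ : (n = 0 ∧ m = 3) ∨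
          (n = 1 ∧ m = 2) ∨ (n = 2 ∧ m = 1) ∨ (n = 3 ∧ m = 0) := by omega
      · exact Submodule.subset_span (by simp [h0])
      · simp [h1]
      · obtain ⟨a, ha⟩ := h2 rfl
        rw [ha, map_smul]
        exact Submodule.smul_mem _ _ (Submodule.subset_span (by simp))
      · obtain ⟨a, ha⟩ := h3 rfl
        rw [ha, map_smul]
        simp only [Nat.cast_zero, zero_add, h13]
        exact Submodule.smul_mem _ _ (Submodule.smul_mem _ _ (Submodule.subset_span (by simp)))

theorem exists_of_mem_virasoroSubalgebra {v : V} (hv : v ∈ 𝒱.virasoroSubalgebra)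
    (h4 : v ∈ 𝒱.weightSpace 4) :
    ∃ a b : ℂ, a • 𝒱.L (-2) (𝒱.L (-2) 𝒱.vac) + b • 𝒱.L (-4) 𝒱.vac = v := by
  rw [← Submodule.mem_span_pair]
  -- Words are homogeneous, so the projection to weight four retains exactly the words of weight
  -- four.
  have key : ∀ x ∈ 𝒱.descendants, (𝒱.weightProj 4 x : V) ∈
      Submodule.span ℂ {𝒱.L (-2) (𝒱.L (-2) 𝒱.vac), 𝒱.L (-4) 𝒱.vac} := by
    intro x hx
    induction hx using Submodule.span_induction with
    | mem x hx =>
      obtain ⟨n, hn⟩ := hx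
      rcases eq_or_ne n 4 with rfl | h
      · have := 𝒱.weightProj_self 4 ⟨x, hn.mem_weightSpace⟩
        simp only at this
        rw [this]
        exact (hn.eq_of_le_four).2.2.2.2 rfl
      · rw [𝒱.weightProj_of_ne (by exact_mod_cast h) hn.mem_weightSpace]
        exact zero_mem _
    | zero => simp
    | add _ _ _ _ h1 h2 => rw [map_add]; exact add_mem h1 h2
    | smul _ _ _ h => rw [map_smul]; exact Submodule.smul_mem _ _ h
  have := key v (𝒱.virasoroSubalgebra_le_descendants hv)
  have h := 𝒱.weightProj_self 4 ⟨v, h4⟩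
  simp only at h
  rwa [h] at this

end VertexOperatorAlgebra

/-! ### States of weight one -/

namespace VertexOperatorAlgebra

variable {V : Type*} [AddCommGroup V] [Module ℂ V] {𝒱 : VertexOperatorAlgebra V}

theorem IsStrongCFTType.eq_zero (hCFT : 𝒱.IsStrongCFTType) {n : ℤ} (hn : n < 0) {v : V}
    (hv : v ∈ 𝒱.weightSpace n) : v = 0 := by
  rwa [hCFT.weightSpace_neg n hn, Submodule.mem_bot] at hv

/-- States of weight one are primary: `L₁ u = 0` is the strong CFT-type condition, and `Lₘ u` has
negative weight for `m ≥ 2`. -/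
theorem IsStrongCFTType.L_lie_mode (hCFT : 𝒱.IsStrongCFTType) {u : V} (hu : u ∈ 𝒱.weightSpace 1)
    (m n : ℤ) : ⁅𝒱.L m, 𝒱.mode u n⁆ = (-(n : ℂ)) • 𝒱.mode u (m + n) := by
  have hprim : ∀ j : ℤ, 2 ≤ j → 𝒱.mode 𝒱.conf j u = 0 := by
    intro j hj
    rcases hj.eq_or_lt with rfl | hj
    · exact hCFT.L_one u hu
    · have := hCFT.eq_zero (by omega) (𝒱.L_mem_weightSpace hu (j - 1))
      rwa [L_eq, sub_add_cancel] at this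
  have h0 : 𝒱.mode 𝒱.conf 1 u = u := by
    have := 𝒱.mem_weightSpace.mp hu
    simpa [L_eq] using this
  rw [L_eq, 𝒱.mode_lie_mode hprim, ← L_neg_one, mode_L_neg_one, h0,
    show m + 1 + n - 1 = m + n by ring]
  push_cast
  module

theorem IsStrongCFTType.L_mode (hCFT : 𝒱.IsStrongCFTType) {u : V} (hu : u ∈ 𝒱.weightSpace 1)
    (m n : ℤ) (v : V) :
    𝒱.L m (𝒱.mode u n v) = 𝒱.mode u n (𝒱.L m v) - (n : ℂ) • 𝒱.mode u (m + n) v := by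
  have h := LinearMap.congr_fun (hCFT.L_lie_mode hu m n) v
  simp only [Ring.lie_def, LinearMap.sub_apply, Module.End.mul_apply, LinearMap.smul_apply] at h
  rw [sub_eq_iff_eq_add.mp h]
  module

theorem IsStrongCFTType.mode_mem_weightSpace (hCFT : 𝒱.IsStrongCFTType) {u v : V} {k : ℤ}
    (hu : u ∈ 𝒱.weightSpace 1) (hv : v ∈ 𝒱.weightSpace k) (n : ℤ) :
    𝒱.mode u n v ∈ 𝒱.weightSpace (k - n) := by
  rw [mem_weightSpace] at hv ⊢
  rw [hCFT.L_mode hu, hv, map_smul, zero_add]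
  push_cast
  module

theorem IsStrongCFTType.mode_eq_zero (hCFT : 𝒱.IsStrongCFTType) {u v : V} {k : ℤ}
    (hu : u ∈ 𝒱.weightSpace 1) (hv : v ∈ 𝒱.weightSpace k) {n : ℤ} (hn : k < n) :
    𝒱.mode u n v = 0 := hCFT.eq_zero (by omega) (hCFT.mode_mem_weightSpace hu hv n)

theorem IsStrongCFTType.L_eq_zero (hCFT : 𝒱.IsStrongCFTType) {v : V} {k : ℤ}
    (hv : v ∈ 𝒱.weightSpace k) {n : ℤ} (hn : k < n) : 𝒱.L n v = 0 :=
  hCFT.eq_zero (by omega) (𝒱.L_mem_weightSpace hv n)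

theorem IsStrongCFTType.mode_lie_mode (hCFT : 𝒱.IsStrongCFTType) {u v : V}
    (hu : u ∈ 𝒱.weightSpace 1) (hv : v ∈ 𝒱.weightSpace 1) (r s : ℤ) :
    ⁅𝒱.mode u r, 𝒱.mode v s⁆ = 𝒱.mode (𝒱.mode u 0 v) (r + s) +
      (r : ℂ) • 𝒱.mode (𝒱.mode u 1 v) (r + s - 1) :=
  𝒱.mode_lie_mode (fun _ hj => hCFT.mode_eq_zero hu hv (by omega)) r s

theorem IsStrongCFTType.mode_one (hCFT : 𝒱.IsStrongCFTType) {B : LinearMap.BilinForm ℂ V}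
    (hB : 𝒱.IsLiZMetric B) {u v : V} (hu : u ∈ 𝒱.weightSpace 1) (hv : v ∈ 𝒱.weightSpace 1) :
    𝒱.mode u 1 v = (-B u v) • 𝒱.vac := by
  have h := hCFT.mode_mem_weightSpace hu hv 1
  rw [sub_self, hCFT.weightSpace_zero, Submodule.mem_span_singleton] at h
  obtain ⟨ξ, hξ⟩ := h
  -- The adjoint of `u₋₁` is `-u₁`, since `L₁ u = 0` removes the other term. The sign persists in
  -- all Casimir traces.
  have h1 := hB.invariant 1 u (by exact_mod_cast hu) (-1) 𝒱.vac v
  rw [𝒱.mode_neg_one_vac, adjointMode] at h1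
  have h2 : 𝒱.mode (𝒱.L 1 u) 0 v = 0 := by rw [hCFT.L_one u hu]; simp [mode]
  simp only [Nat.reduceAdd, Finset.sum_range_succ, Finset.range_zero, Finset.sum_empty] at h1
  norm_num [h2, ← hξ, hB.normalized] at h1
  rw [h1, neg_neg, hξ]

/-- Apply `[u₋₁, v₁]` to the vacuum and compare with the commutator formula. -/
theorem IsStrongCFTType.mode_one_comm (hCFT : 𝒱.IsStrongCFTType) {u v : V}
    (hu : u ∈ 𝒱.weightSpace 1) (hv : v ∈ 𝒱.weightSpace 1) : 𝒱.mode u 1 v = 𝒱.mode v 1 u := by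
  have h := LinearMap.congr_fun (hCFT.mode_lie_mode hu hv (-1) 1) 𝒱.vac
  simp only [Ring.lie_def, LinearMap.sub_apply, Module.End.mul_apply, LinearMap.add_apply,
    LinearMap.smul_apply, 𝒱.mode_vac zero_le_one, mode_neg_one_vac, map_zero] at h
  norm_num [mode_vac, mode_neg_one_vac] at h
  exact h.symm

/-- The term `(v₀ u)₀` is kept in the form of a commutator of zero modes, so that its trace visibly
vanishes. -/
theorem IsStrongCFTType.mode_lie_mode_neg (hCFT : 𝒱.IsStrongCFTType)
    {B : LinearMap.BilinForm ℂ V} (hB : 𝒱.IsLiZMetric B) {u v : V} (hu : u ∈ 𝒱.weightSpace 1)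
    (hv : v ∈ 𝒱.weightSpace 1) (k : ℤ) :
    ⁅𝒱.mode v k, 𝒱.mode u (-k)⁆ = ⁅𝒱.mode v 0, 𝒱.mode u 0⁆ - (k * B u v) • 1 := by
  rw [hCFT.mode_lie_mode hv hu, hCFT.mode_lie_mode hv hu, hCFT.mode_one_comm hv hu,
    hCFT.mode_one hB hu hv]
  have : 𝒱.mode ((-B u v) • 𝒱.vac) (-1) = (-B u v) • 1 := by
    have h := 𝒱.mode_vac_apply (-1)
    simp only [mode, if_true] at h ⊢
    rw [map_smul, map_smul, Pi.smul_apply, h]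
  simp only [add_neg_cancel, zero_sub, this]
  push_cast
  module

/-! ### Traces on the homogeneous spaces -/

variable (𝒱)

instance (n : ℤ) : FiniteDimensional ℂ (𝒱.weightSpace n) := 𝒱.finite_weightSpace n

/-- The dimension of `Vₙ`, as a complex number. -/
noncomputable def dim (n : ℤ) : ℂ := Module.finrank ℂ (𝒱.weightSpace n)

/-- The trace over `Vₙ` of the diagonal block of an operator. -/
noncomputable def wtrace (n : ℤ) : Module.End ℂ V →ₗ[ℂ] ℂ :=
  LinearMap.trace ℂ (𝒱.weightSpace n) ∘ₗ
    (LinearMap.lcomp ℂ (𝒱.weightSpace n) (𝒱.weightSpace n).subtype) ∘ₗ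
      LinearMap.llcomp ℂ V V (𝒱.weightSpace n) (𝒱.weightProj n)

theorem wtrace_apply (n : ℤ) (O : Module.End ℂ V) : 𝒱.wtrace n O =
    LinearMap.trace ℂ (𝒱.weightSpace n)
      (𝒱.weightProj n ∘ₗ O ∘ₗ (𝒱.weightSpace n).subtype) := rfl

theorem wtrace_congr {n : ℤ} {O O' : Module.End ℂ V} (h : ∀ v ∈ 𝒱.weightSpace n, O v = O' v) :
    𝒱.wtrace n O = 𝒱.wtrace n O' := by
  rw [wtrace_apply, wtrace_apply]
  congr 1
  ext v
  simp [h v v.2]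

theorem wtrace_one (n : ℤ) : 𝒱.wtrace n 1 = 𝒱.dim n := by
  rw [wtrace_apply, dim, ← LinearMap.trace_one]
  congr 1
  ext v
  simp [weightProj_self]

theorem wtrace_mul_comm {m n : ℤ} {A B : Module.End ℂ V}
    (hA : ∀ v ∈ 𝒱.weightSpace m, A v ∈ 𝒱.weightSpace n)
    (hB : ∀ v ∈ 𝒱.weightSpace n, B v ∈ 𝒱.weightSpace m) :
    𝒱.wtrace n (A * B) = 𝒱.wtrace m (B * A) := by
  have h : ∀ {m n : ℤ} {A B : Module.End ℂ V} (hB : ∀ v ∈ 𝒱.weightSpace n, B v ∈ 𝒱.weightSpace m),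
      𝒱.weightProj n ∘ₗ (A * B) ∘ₗ (𝒱.weightSpace n).subtype =
        (𝒱.weightProj n ∘ₗ A ∘ₗ (𝒱.weightSpace m).subtype) ∘ₗ
          (𝒱.weightProj m ∘ₗ B ∘ₗ (𝒱.weightSpace n).subtype) := by
    intro m n A B hB
    ext v
    have := 𝒱.weightProj_self m ⟨B v, hB v v.2⟩
    simp only at this
    simp [this]
  rw [wtrace_apply, wtrace_apply, h hB, h hA, LinearMap.trace_comp_comm']

variable {𝒱}

theorem IsStrongCFTType.dim_neg (hCFT : 𝒱.IsStrongCFTType) {n : ℤ} (hn : n < 0) :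
    𝒱.dim n = 0 := by
  rw [dim, hCFT.weightSpace_neg n hn, finrank_bot, Nat.cast_zero]

theorem IsStrongCFTType.dim_zero (hCFT : 𝒱.IsStrongCFTType) : 𝒱.dim 0 = 1 := by
  rw [dim, hCFT.weightSpace_zero, finrank_span_singleton 𝒱.vac_ne_zero, Nat.cast_one]

theorem IsStrongCFTType.wtrace_neg (hCFT : 𝒱.IsStrongCFTType) {n : ℤ} (hn : n < 0)
    (O : Module.End ℂ V) : 𝒱.wtrace n O = 0 := by
  rw [𝒱.wtrace_congr (O' := 0) fun v hv => by rw [hCFT.eq_zero hn hv]; simp, map_zero]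

/-- The solution of the recursion `t(n) = t(n - k) + f(n - k)`. -/
theorem eq_sum_of_recursion {t f : ℤ → ℂ} {k : ℕ} (hk : 0 < k) (ht : ∀ n < 0, t n = 0)
    (hf : ∀ n < 0, f n = 0) (h : ∀ n, t n = t (n - k) + f (n - k)) (n : ℕ) :
    t n = ∑ l ∈ Finset.range n, if k ∣ l + 1 then f (n - (l + 1)) else 0 := by
  induction n using Nat.strong_induction_on with
  | _ n ih =>
    rcases lt_or_ge n k with hn | hn
    · rw [h, ht _ (by omega), hf _ (by omega), add_zero, Finset.sum_eq_zero]
      intro l hl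
      rw [if_neg]
      intro hd
      have := Nat.le_of_dvd (by omega) hd
      have := Finset.mem_range.mp hl
      omega
    · obtain ⟨m, rfl⟩ := Nat.exists_eq_add_of_le hn
      rw [h, show ((k + m : ℕ) : ℤ) - k = m by push_cast; ring, ih m (by omega),
        Finset.sum_range_add, add_comm]
      congr 1
      · rw [Finset.sum_eq_single (k - 1)]
        · rw [if_pos (by rw [Nat.sub_add_cancel hk])]
          congr 1
          push_cast [Nat.cast_sub (show 1 ≤ k by omega)]
          ring
        · intro l hl hne
          rw [if_neg]
          intro hd
          have := Nat.le_of_dvd (by omega) hd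
          have := Finset.mem_range.mp hl
          omega
        · intro hh; exact absurd (Finset.mem_range.mpr (by omega)) hh
      · refine Finset.sum_congr rfl fun l _ => ?_
        simp only [add_assoc, Nat.dvd_add_right (dvd_refl k)]
        congr 2
        push_cast
        ring

/-- Cyclicity moves the trace of `A B` from weight `n` to that of `B A = A B + [B, A]` in weight `n
- k`. Iteration ends because negative weights are absent. -/
theorem IsStrongCFTType.wtrace_mul_eq_sum (hCFT : 𝒱.IsStrongCFTType) {κ : Type*} (s : Finset κ)
    {A B : κ → Module.End ℂ V} {k : ℕ} (hk : 0 < k)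
    (hA : ∀ i m, ∀ v ∈ 𝒱.weightSpace m, A i v ∈ 𝒱.weightSpace (m + k))
    (hB : ∀ i m, ∀ v ∈ 𝒱.weightSpace m, B i v ∈ 𝒱.weightSpace (m - k)) (n : ℕ) :
    ∑ i ∈ s, 𝒱.wtrace n (A i * B i) = ∑ l ∈ Finset.range n,
      if k ∣ l + 1 then ∑ i ∈ s, 𝒱.wtrace (n - (l + 1)) ⁅B i, A i⁆ else 0 := by
  refine eq_sum_of_recursion (t := fun n => ∑ i ∈ s, 𝒱.wtrace n (A i * B i))
    (f := fun n => ∑ i ∈ s, 𝒱.wtrace n ⁅B i, A i⁆) hk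
    (fun n hn => Finset.sum_eq_zero fun i _ => hCFT.wtrace_neg hn _)
    (fun n hn => Finset.sum_eq_zero fun i _ => hCFT.wtrace_neg hn _) (fun n => ?_) n
  rw [← Finset.sum_add_distrib]
  refine Finset.sum_congr rfl fun i _ => ?_
  rw [𝒱.wtrace_mul_comm (m := n - k) (fun v hv => by simpa using hA i _ v hv) (hB i n), ← map_add,
    Ring.lie_def, add_sub_cancel]

/-- Summation over the divisors. -/
theorem sum_pow_mul_sum_dvd (m n N : ℕ) (hN : n < N) (f : ℕ → ℂ) :
    ∑ k ∈ Finset.range N, (k : ℂ) ^ m * ∑ l ∈ Finset.range n, (if k ∣ l + 1 then f l else 0) =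
      ∑ l ∈ Finset.range n, (ArithmeticFunction.sigma m (l + 1) : ℂ) * f l := by
  simp only [Finset.mul_sum]
  rw [Finset.sum_comm]
  refine Finset.sum_congr rfl fun l hl => ?_
  have hl := Finset.mem_range.mp hl
  rw [ArithmeticFunction.sigma_apply, Nat.cast_sum, Finset.sum_mul]
  have : (l + 1).divisors = (Finset.range N).filter (· ∣ l + 1) := by
    ext d
    simp only [Nat.mem_divisors, Finset.mem_filter, Finset.mem_range]
    refine ⟨fun h => ⟨?_, h.1⟩, fun h => ⟨h.2, by omega⟩⟩
    have := Nat.le_of_dvd (by omega) h.1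
    omega
  rw [this, Finset.sum_filter]
  refine Finset.sum_congr rfl fun d _ => ?_
  split_ifs <;> simp

end VertexOperatorAlgebra

namespace VertexOperatorAlgebra

variable {V : Type*} [AddCommGroup V] [Module ℂ V] {𝒱 : VertexOperatorAlgebra V}

theorem mode_mode_neg_one_eq_sum {u v w : V} {m : ℤ} {M : ℕ}
    (hv : ∀ j : ℕ, M ≤ j → 𝒱.mode v (m + j) w = 0) (hu : ∀ j : ℕ, M ≤ j → 𝒱.mode u j w = 0) :
    𝒱.mode (𝒱.mode u (-1) v) m w = ∑ j ∈ Finset.range M,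
      (𝒱.mode u (-1 - j) (𝒱.mode v (m + j) w) + 𝒱.mode v (m - 1 - j) (𝒱.mode u j w)) := by
  obtain ⟨N, hN, hMN⟩ := ((𝒱.mode_mode_neg_one u v w m).and (Filter.eventually_ge_atTop M)).exists
  rw [hN]
  refine (Finset.sum_subset (Finset.range_mono hMN) fun j _ hj => ?_).symm
  have hj : M ≤ j := by simpa using hj
  rw [hv j hj, hu j hj, map_zero, map_zero, add_zero]

theorem IsStrongCFTType.bilin_comm (hCFT : 𝒱.IsStrongCFTType) {B : LinearMap.BilinForm ℂ V}
    (hB : 𝒱.IsLiZMetric B) {u v : V} (hu : u ∈ 𝒱.weightSpace 1) (hv : v ∈ 𝒱.weightSpace 1) :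
    B u v = B v u := by
  have h := hCFT.mode_one_comm hu hv
  rw [hCFT.mode_one hB hu hv, hCFT.mode_one hB hv hu] at h
  simpa using smul_left_injective ℂ 𝒱.vac_ne_zero h

/-! ### Traces of the Casimir vectors -/

section Casimir

variable {ι : Type*} [Fintype ι]

theorem IsStrongCFTType.sum_wtrace_mode_mul_mode (hCFT : 𝒱.IsStrongCFTType)
    {B : LinearMap.BilinForm ℂ V} (hB : 𝒱.IsLiZMetric B) {u v : ι → V}
    (hu : ∀ α, u α ∈ 𝒱.weightSpace 1) (hv : ∀ α, v α ∈ 𝒱.weightSpace 1)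
    (huv : ∀ α, B (u α) (v α) = 1) {k : ℕ} (hk : 0 < k) (n : ℕ) :
    ∑ α, 𝒱.wtrace n (𝒱.mode (u α) (-k) * 𝒱.mode (v α) k) =
      -(Fintype.card ι : ℂ) * (k * ∑ l ∈ Finset.range n,
        if k ∣ l + 1 then 𝒱.dim (n - (l + 1)) else 0) := by
  have key : ∀ m, ∑ α, 𝒱.wtrace m ⁅𝒱.mode (v α) k, 𝒱.mode (u α) (-k)⁆ =
      -(Fintype.card ι : ℂ) * (k * 𝒱.dim m) := by
    intro m
    rw [Finset.sum_congr rfl (g := fun _ => -((k : ℂ) * 𝒱.dim m)) fun α _ => ?_]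
    · simp
    rw [hCFT.mode_lie_mode_neg hB (hu α) (hv α), map_sub, map_smul, wtrace_one, huv, Ring.lie_def,
      map_sub, 𝒱.wtrace_mul_comm (m := m), sub_self]
    · simp
    · intro w hw; simpa using hCFT.mode_mem_weightSpace (hv α) hw 0
    · intro w hw; simpa using hCFT.mode_mem_weightSpace (hu α) hw 0
  rw [hCFT.wtrace_mul_eq_sum Finset.univ hk
    (fun α m w hw => by simpa using hCFT.mode_mem_weightSpace (hu α) hw (-k))
    (fun α m w hw => hCFT.mode_mem_weightSpace (hv α) hw k)]
  simp only [key, Finset.mul_sum, mul_ite, mul_zero]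

theorem sum_range_shift_one {h : ℕ → ℂ} (h0 : h 0 = 0) {M : ℕ} (hM : h M = 0) :
    ∑ j ∈ Finset.range M, h (j + 1) = ∑ j ∈ Finset.range M, h j := by
  have := Finset.sum_range_succ' h M
  rw [Finset.sum_range_succ, hM, h0] at this
  simpa using this.symm

theorem sum_range_add_of_eq_zero {h : ℕ → ℂ} {M : ℕ} (hM : ∀ i, M ≤ i → h i = 0) (k : ℕ) :
    ∑ j ∈ Finset.range (M + k), h j = ∑ j ∈ Finset.range M, h j := by
  rw [Finset.sum_range_add, Finset.sum_eq_zero (s := Finset.range k) fun i _ => hM _ (by omega),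
    add_zero]

theorem sum_range_shift_three {h : ℕ → ℂ} (h0 : h 0 = 0) (h1 : h 1 = 0) (h2 : h 2 = 0) {M : ℕ}
    (hM : ∀ i, M ≤ i → h i = 0) :
    ∑ j ∈ Finset.range (M + 2), h (j + 3) = ∑ j ∈ Finset.range M, h j := by
  rw [← sum_range_add_of_eq_zero hM 5, Finset.sum_range_succ' h (M + 4),
    Finset.sum_range_succ' _ (M + 3), Finset.sum_range_succ' _ (M + 2), h0, h1, h2]
  simp

/-- The difference is taken because both traces contain the same trace `t` of the zero modes, which
this method does not determine. -/
theorem IsStrongCFTType.wtrace_casimir (hCFT : 𝒱.IsStrongCFTType)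
    {B : LinearMap.BilinForm ℂ V} (hB : 𝒱.IsLiZMetric B) {u v : ι → V}
    (hu : ∀ α, u α ∈ 𝒱.weightSpace 1) (hv : ∀ α, v α ∈ 𝒱.weightSpace 1)
    (huv : ∀ α, B (u α) (v α) = 1) (n : ℕ) :
    𝒱.wtrace n (𝒱.mode (𝒱.casimir u v 4) 3) - 𝒱.wtrace n (𝒱.mode (𝒱.casimir u v 2) 1) =
      -(Fintype.card ι : ℂ) * ∑ l ∈ Finset.range n,
        (ArithmeticFunction.sigma 3 (l + 1) : ℂ) * 𝒱.dim (n - (l + 1)) := by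
  have hvu : ∀ α, B (v α) (u α) = 1 := fun α => by rw [hCFT.bilin_comm hB (hv α) (hu α), huv]
  set h : ℕ → ℂ := fun k => -(Fintype.card ι : ℂ) * (k * ∑ l ∈ Finset.range n,
        if k ∣ l + 1 then 𝒱.dim (n - (l + 1)) else 0) with hh
  have h0 : h 0 = 0 := by simp [hh]
  have hbig : ∀ k, n + 1 ≤ k → h k = 0 := by
    intro k hk
    simp only [hh]
    rw [Finset.sum_eq_zero, mul_zero, mul_zero]
    intro l hl
    rw [if_neg]
    intro hd
    have := Nat.le_of_dvd (by omega) hd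
    have := Finset.mem_range.mp hl
    omega
  set t : ℂ := ∑ α, 𝒱.wtrace n (𝒱.mode (v α) 0 * 𝒱.mode (u α) 0) with ht
  have hT : ∀ k : ℕ, ∑ α, 𝒱.wtrace n (𝒱.mode (u α) (-((k + 1 : ℕ) : ℤ)) *
      𝒱.mode (v α) ((k + 1 : ℕ) : ℤ)) = h (k + 1) := fun k =>
    hCFT.sum_wtrace_mode_mul_mode hB hu hv huv k.succ_pos n
  have hT' : ∀ k : ℕ, ∑ α, 𝒱.wtrace n (𝒱.mode (v α) (-(k : ℤ)) * 𝒱.mode (u α) (k : ℤ)) =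
      (if k = 0 then t else 0) + h k := by
    intro k
    split_ifs with hk
    · subst hk; rw [h0, ht]; simp
    · rw [zero_add]; exact hCFT.sum_wtrace_mode_mul_mode hB hv hu hvu (Nat.pos_of_ne_zero hk) n
  have two : 𝒱.wtrace n (𝒱.mode (𝒱.casimir u v 2) 1) =
      t + ∑ k ∈ Finset.range (n + 1), 2 * h k := by
    have e1 : 𝒱.wtrace n (𝒱.mode (𝒱.casimir u v 2) 1) = ∑ j ∈ Finset.range (n + 1),
        (∑ α, 𝒱.wtrace n (𝒱.mode (u α) (-((j + 1 : ℕ) : ℤ)) * 𝒱.mode (v α) ((j + 1 : ℕ) : ℤ)) +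
          ∑ α, 𝒱.wtrace n (𝒱.mode (v α) (-(j : ℤ)) * 𝒱.mode (u α) (j : ℤ))) := by
      simp only [← Finset.sum_add_distrib]
      rw [Finset.sum_comm]
      have : 𝒱.mode (𝒱.casimir u v 2) 1 = ∑ α, 𝒱.mode (𝒱.mode (u α) (-1) (v α)) 1 := by
        simp [casimir, mode]
      rw [this, map_sum]
      refine Finset.sum_congr rfl fun α _ => ?_
      simp only [← map_add, ← map_sum]
      refine 𝒱.wtrace_congr fun w hw => ?_
      rw [mode_mode_neg_one_eq_sum (M := n + 1)
        (fun j hj => hCFT.mode_eq_zero (hv α) hw (by omega))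
        (fun j hj => hCFT.mode_eq_zero (hu α) hw (by omega)), LinearMap.sum_apply]
      refine Finset.sum_congr rfl fun j _ => ?_
      rw [LinearMap.add_apply, Module.End.mul_apply, Module.End.mul_apply,
        show (-1 - (j : ℤ)) = -((j + 1 : ℕ) : ℤ) by push_cast; ring,
        show (1 + (j : ℤ)) = ((j + 1 : ℕ) : ℤ) by push_cast; ring,
        show (1 - 1 - (j : ℤ)) = -(j : ℤ) by ring]
    rw [e1]
    simp only [hT, hT', Finset.sum_add_distrib, sum_range_shift_one h0 (hbig _ le_rfl),
      Finset.sum_ite_eq', two_mul]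
    simp
    ring
  have four : 2 * 𝒱.wtrace n (𝒱.mode (𝒱.casimir u v 4) 3) =
      2 * t + ∑ k ∈ Finset.range (n + 1),
        (((k : ℂ) - 1) * (k - 2) + (k + 1) * (k + 2)) * h k := by
    have e1 : 2 * 𝒱.wtrace n (𝒱.mode (𝒱.casimir u v 4) 3) =
        ∑ j ∈ Finset.range (n + 1 + 2), (((j : ℂ) + 1) * (j + 2)) *
          ∑ α, 𝒱.wtrace n (𝒱.mode (u α) (-((j + 2 + 1 : ℕ) : ℤ)) *
            𝒱.mode (v α) ((j + 2 + 1 : ℕ) : ℤ)) +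
        ∑ j ∈ Finset.range (n + 1), (((j : ℂ) + 1) * (j + 2)) *
          ∑ α, 𝒱.wtrace n (𝒱.mode (v α) (-(j : ℤ)) * 𝒱.mode (u α) (j : ℤ)) := by
      -- Writing `2 u₋₃ ū = (L₋₁² u)₋₁ ū` reduces `λ⁽⁴⁾` to a normally ordered product.
      have hTT : ∀ (x : V) (r : ℤ), 𝒱.mode (𝒱.L (-1) (𝒱.L (-1) x)) r =
          ((r : ℂ) * (r - 1)) • 𝒱.mode x (r - 2) := fun x r => by
        rw [mode_L_neg_one, mode_L_neg_one, smul_smul, show r - 1 - 1 = r - 2 by ring]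
        congr 1
        push_cast
        ring
      have : (2 : ℂ) • 𝒱.mode (𝒱.casimir u v 4) 3 =
          ∑ α, 𝒱.mode (𝒱.mode (𝒱.L (-1) (𝒱.L (-1) (u α))) (-1) (v α)) 3 := by
        have h2 : ∀ α, 𝒱.mode (𝒱.L (-1) (𝒱.L (-1) (u α))) (-1) (v α) =
            (2 : ℂ) • 𝒱.mode (u α) (-3) (v α) := fun α => by
          rw [hTT, LinearMap.smul_apply]; norm_num
        simp only [h2]
        simp [casimir, mode, Finset.smul_sum]
      rw [← smul_eq_mul, ← map_smul, this, map_sum]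
      simp only [Finset.mul_sum]
      rw [Finset.sum_comm, Finset.sum_comm (s := Finset.range (n + 1)), ← Finset.sum_add_distrib]
      refine Finset.sum_congr rfl fun α _ => ?_
      have hlin : ∀ (s : Finset ℕ) (a : ℕ → ℂ) (X : ℕ → Module.End ℂ V),
          ∑ j ∈ s, a j * 𝒱.wtrace n (X j) = 𝒱.wtrace n (∑ j ∈ s, a j • X j) := by
        intro s a X; simp
      rw [hlin, hlin, ← map_add]
      refine 𝒱.wtrace_congr fun w hw => ?_
      rw [mode_mode_neg_one_eq_sum (M := n + 1 + 2)
        (fun j hj => hCFT.mode_eq_zero (hv α) hw (by omega))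
        (fun j hj => by
          rw [hTT, LinearMap.smul_apply, hCFT.mode_eq_zero (hu α) hw (by omega), smul_zero]),
        Finset.sum_add_distrib, LinearMap.add_apply, LinearMap.sum_apply, LinearMap.sum_apply]
      congr 1
      · refine Finset.sum_congr rfl fun j _ => ?_
        rw [hTT, LinearMap.smul_apply, LinearMap.smul_apply, Module.End.mul_apply,
          show (-1 - (j : ℤ) - 2) = -((j + 2 + 1 : ℕ) : ℤ) by push_cast; ring,
          show (3 + (j : ℤ)) = ((j + 2 + 1 : ℕ) : ℤ) by push_cast; ring]
        congr 1
        push_cast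
        ring
      -- The terms `j = 0, 1` carry the factor `j (j - 1) = 0`; the remaining ones are reindexed by
      -- `k = j - 2`.
      · rw [Finset.sum_range_succ', Finset.sum_range_succ']
        simp only [hTT, LinearMap.smul_apply, map_smul]
        simp only [Nat.cast_zero, Int.cast_zero, zero_mul, zero_smul, add_zero, zero_add,
          Nat.cast_one, Int.cast_one, sub_self, mul_zero]
        refine Finset.sum_congr rfl fun j _ => ?_
        rw [Module.End.mul_apply,
          show (3 - 1 - ((j + 1 + 1 : ℕ) : ℤ)) = -(j : ℤ) by push_cast; ring,
          show (((j + 1 + 1 : ℕ) : ℤ) - 2) = (j : ℤ) by push_cast; ring]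
        congr 1
        push_cast
        ring
    have e2 := sum_range_shift_three (h := fun k => (((k : ℂ) - 1) * (k - 2)) * h k)
      (by simp [h0]) (by simp) (by simp) (M := n + 1) (fun i hi => by simp [hbig i hi])
    have e3 : ∑ j ∈ Finset.range (n + 1), (((j : ℂ) + 1) * (j + 2)) *
        ((if j = 0 then t else 0) + h j) = 2 * t + ∑ j ∈ Finset.range (n + 1),
          (((j : ℂ) + 1) * (j + 2)) * h j := by
      simp only [mul_add _ (ite _ _ _), Finset.sum_add_distrib, mul_ite, mul_zero,
        Finset.sum_ite_eq']
      simp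
    simp only [e1, hT, hT', e3, add_mul _ _ (h _), Finset.sum_add_distrib]
    rw [← e2, add_left_comm]
    congr 2
    refine Finset.sum_congr rfl fun j _ => ?_
    push_cast
    ring
  -- Here `(k-1)(k-2) + (k+1)(k+2) - 4 = 2k²`. With the factor `k` in `h k` this gives `k³`, hence
  -- `σ₃`.
  have key : 2 * (𝒱.wtrace n (𝒱.mode (𝒱.casimir u v 4) 3) -
      𝒱.wtrace n (𝒱.mode (𝒱.casimir u v 2) 1)) = 2 * (-(Fintype.card ι : ℂ) *
        ∑ l ∈ Finset.range n,
          (ArithmeticFunction.sigma 3 (l + 1) : ℂ) * 𝒱.dim (n - (l + 1))) := by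
    rw [mul_sub, four, two, ← sum_pow_mul_sum_dvd 3 n (n + 1) (by omega)
      (fun l => 𝒱.dim (n - (l + 1))), Finset.mul_sum, Finset.mul_sum, mul_add, Finset.mul_sum,
      Finset.mul_sum, add_sub_add_left_eq_sub, ← Finset.sum_sub_distrib, Finset.mul_sum]
    refine Finset.sum_congr rfl fun k _ => ?_
    simp only [hh]
    ring
  exact mul_left_cancel₀ two_ne_zero key

end Casimir

/-! ### Traces of the Virasoro descendants -/

theorem wtrace_smul_one_add (n : ℤ) (x y : ℂ) :
    𝒱.wtrace n (x • 𝒱.L 0 + y • 1) = (x * n + y) * 𝒱.dim n := by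
  have : 𝒱.wtrace n (x • 𝒱.L 0 + y • 1) = 𝒱.wtrace n ((x * n + y) • 1) := by
    refine 𝒱.wtrace_congr fun v hv => ?_
    simp [𝒱.mem_weightSpace.mp hv, add_smul, smul_smul]
  rw [this, map_smul, wtrace_one, smul_eq_mul]

theorem wtrace_L_zero (n : ℤ) : 𝒱.wtrace n (𝒱.L 0) = n * 𝒱.dim n := by
  simpa using wtrace_smul_one_add (𝒱 := 𝒱) n 1 0

theorem wtrace_L_neg_four (n : ℤ) :
    𝒱.wtrace n (𝒱.mode (𝒱.L (-4) 𝒱.vac) 3) = 3 * (n * 𝒱.dim n) := by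
  have h1 : (2 : ℂ) • 𝒱.L (-4) 𝒱.vac = 𝒱.L (-1) (𝒱.L (-1) 𝒱.conf) := by
    have h : 𝒱.L (-1) 𝒱.vac = 0 := 𝒱.L_vac le_rfl
    rw [← L_neg_two_vac, 𝒱.L_L_apply (-1) (-2), h]
    norm_num
    rw [𝒱.L_L_apply (-1) (-3), h]
    norm_num
  have h2 : (2 : ℂ) • 𝒱.mode (𝒱.L (-4) 𝒱.vac) 3 = (6 : ℂ) • 𝒱.L 0 := by
    have : (2 : ℂ) • 𝒱.mode (𝒱.L (-4) 𝒱.vac) 3 = 𝒱.mode ((2 : ℂ) • 𝒱.L (-4) 𝒱.vac) 3 := by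
      simp [mode]
    rw [this, h1, mode_L_neg_one, mode_L_neg_one, smul_smul, L_eq]
    norm_num
  have h3 := congrArg (𝒱.wtrace n) h2
  rw [map_smul, map_smul, wtrace_L_zero, smul_eq_mul, smul_eq_mul] at h3
  linear_combination h3 / 2

theorem IsStrongCFTType.wtrace_L_neg_two_sq (hCFT : 𝒱.IsStrongCFTType) (n : ℕ) :
    𝒱.wtrace n (𝒱.mode (𝒱.L (-2) (𝒱.L (-2) 𝒱.vac)) 3) = ((n : ℂ) ^ 2 + 2 * n) * 𝒱.dim n +
      2 * ∑ l ∈ Finset.range n, (2 * (ArithmeticFunction.sigma 1 (l + 1) : ℂ) * (n - (l + 1)) +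
        𝒱.centralCharge / 12 * ((ArithmeticFunction.sigma 3 (l + 1) : ℂ) -
          (ArithmeticFunction.sigma 1 (l + 1) : ℂ))) * 𝒱.dim (n - (l + 1)) := by
  set S : ℕ → ℂ := fun k => 𝒱.wtrace n (𝒱.L (-k) * 𝒱.L k) with hS
  set h : ℕ → ℂ := fun k => ∑ l ∈ Finset.range n, if k ∣ l + 1 then
    (2 * (k : ℂ) * (n - (l + 1)) + ((k : ℂ) ^ 3 - k) / 12 * 𝒱.centralCharge) *
      𝒱.dim (n - (l + 1)) else 0 with hh
  have h0 : h 0 = 0 := by simp [hh]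
  have hbig : ∀ k, n + 1 ≤ k → h k = 0 := by
    intro k hk
    refine Finset.sum_eq_zero fun l hl => if_neg fun hd => ?_
    have := Nat.le_of_dvd (by omega) hd
    have := Finset.mem_range.mp hl
    omega
  have hlie : ∀ (k : ℤ), ⁅𝒱.L k, 𝒱.L (-k)⁆ =
      (2 * (k : ℂ)) • 𝒱.L 0 + (((k : ℂ) ^ 3 - k) / 12 * 𝒱.centralCharge) • 1 := fun k => by
    rw [L_lie_L, if_pos (by ring), add_neg_cancel]
    push_cast
    congr 2
    ring
  have hSh : ∀ k, S k = (if k = 0 then (n : ℂ) ^ 2 * 𝒱.dim n else 0) + h k := by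
    intro k
    split_ifs with hk
    · subst hk
      rw [h0, add_zero, hS]
      have : 𝒱.wtrace n (𝒱.L 0 * 𝒱.L 0) = 𝒱.wtrace n ((n : ℂ) ^ 2 • 1) := by
        refine 𝒱.wtrace_congr fun v hv => ?_
        rw [Module.End.mul_apply, 𝒱.mem_weightSpace.mp hv, map_smul, 𝒱.mem_weightSpace.mp hv,
          smul_smul]
        simp [pow_two]
      simp only [Nat.cast_zero, neg_zero, this, map_smul, wtrace_one, smul_eq_mul]
    · rw [zero_add]
      have := hCFT.wtrace_mul_eq_sum ({()} : Finset Unit) (A := fun _ => 𝒱.L (-k))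
        (B := fun _ => 𝒱.L k) (Nat.pos_of_ne_zero hk)
        (fun _ m v hv => by simpa using 𝒱.L_mem_weightSpace hv (-k))
        (fun _ m v hv => 𝒱.L_mem_weightSpace hv k) n
      simp only [Finset.sum_singleton, hlie, wtrace_smul_one_add] at this
      simp only [hS, hh, this]
      push_cast
      rfl
  have e1 : 𝒱.wtrace n (𝒱.mode (𝒱.L (-2) (𝒱.L (-2) 𝒱.vac)) 3) =
      ∑ j ∈ Finset.range (n + 1 + 2), S (j + 2) +
        (∑ j ∈ Finset.range (n + 1 + 1), S j + 𝒱.wtrace n (𝒱.L 1 * 𝒱.L (-1))) := by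
    have : ∀ w ∈ 𝒱.weightSpace n, 𝒱.mode (𝒱.L (-2) (𝒱.L (-2) 𝒱.vac)) 3 w =
        (∑ j ∈ Finset.range (n + 1 + 2), 𝒱.L (-((j + 2 : ℕ) : ℤ)) * 𝒱.L ((j + 2 : ℕ) : ℤ) +
        (∑ j ∈ Finset.range (n + 1 + 1), 𝒱.L (-(j : ℤ)) * 𝒱.L (j : ℤ) + 𝒱.L 1 * 𝒱.L (-1))) w := by
      intro w hw
      have hω : ∀ m : ℤ, 𝒱.mode 𝒱.conf m = 𝒱.L (m - 1) := fun m => by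
        rw [L_eq, sub_add_cancel]
      rw [L_neg_two_vac, L_eq, show (-2 + 1 : ℤ) = -1 by norm_num,
        mode_mode_neg_one_eq_sum (M := n + 1 + 2)
        (fun j hj => by rw [hω]; exact hCFT.L_eq_zero hw (by omega))
        (fun j hj => by rw [hω]; exact hCFT.L_eq_zero hw (by omega)), Finset.sum_add_distrib,
        LinearMap.add_apply, LinearMap.add_apply, LinearMap.sum_apply, LinearMap.sum_apply]
      congr 1
      · refine Finset.sum_congr rfl fun j _ => ?_
        rw [hω, hω, Module.End.mul_apply,
          show (-1 - (j : ℤ) - 1) = -((j + 2 : ℕ) : ℤ) by push_cast; ring,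
          show (3 + (j : ℤ) - 1) = ((j + 2 : ℕ) : ℤ) by push_cast; ring]
      · rw [Finset.sum_range_succ']
        congr 1
        refine Finset.sum_congr rfl fun j _ => ?_
        rw [hω, hω, Module.End.mul_apply,
          show (3 - 1 - ((j + 1 : ℕ) : ℤ) - 1) = -(j : ℤ) by push_cast; ring,
          show (((j + 1 : ℕ) : ℤ) - 1) = (j : ℤ) by push_cast; ring]
    rw [𝒱.wtrace_congr this, map_add, map_add, map_sum, map_sum]
  -- The one product in the wrong order; reordering it gives `2 L₀`, the source of the term `2 n`.
  have e2 : 𝒱.wtrace n (𝒱.L 1 * 𝒱.L (-1)) = S 1 + 2 * n * 𝒱.dim n := by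
    have h1 : 𝒱.L 1 * 𝒱.L (-1) = 𝒱.L (-1) * 𝒱.L 1 + ⁅𝒱.L 1, 𝒱.L (-1)⁆ := by
      rw [Ring.lie_def]; abel
    rw [h1, map_add, hlie 1, wtrace_smul_one_add]
    simp [hS]
  have e3 : ∑ j ∈ Finset.range (n + 1 + 2), S (j + 2) + S 1 = ∑ k ∈ Finset.range (n + 1), h k := by
    rw [← sum_range_add_of_eq_zero hbig 4, Finset.sum_range_succ' h (n + 1 + 3),
      Finset.sum_range_succ' _ (n + 1 + 2), h0]
    simp [hSh]
  have e4 : ∑ j ∈ Finset.range (n + 1 + 1), S j =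
      (n : ℂ) ^ 2 * 𝒱.dim n + ∑ k ∈ Finset.range (n + 1), h k := by
    rw [Finset.sum_range_succ, hSh (n + 1), hbig _ le_rfl]
    simp [hSh, Finset.sum_add_distrib]
  have e5 : ∑ k ∈ Finset.range (n + 1), h k =
      ∑ l ∈ Finset.range n, (2 * (ArithmeticFunction.sigma 1 (l + 1) : ℂ) * (n - (l + 1)) +
        𝒱.centralCharge / 12 * ((ArithmeticFunction.sigma 3 (l + 1) : ℂ) -
          (ArithmeticFunction.sigma 1 (l + 1) : ℂ))) * 𝒱.dim (n - (l + 1)) := by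
    have s1 := sum_pow_mul_sum_dvd 1 n (n + 1) (by omega)
      (fun l => ((2 : ℂ) * (n - (l + 1)) - 𝒱.centralCharge / 12) * 𝒱.dim (n - (l + 1)))
    have s3 := sum_pow_mul_sum_dvd 3 n (n + 1) (by omega)
      (fun l => (𝒱.centralCharge / 12) * 𝒱.dim (n - (l + 1)))
    have : ∀ k ∈ Finset.range (n + 1), h k = (k : ℂ) ^ 1 * ∑ l ∈ Finset.range n, (if k ∣ l + 1 then
        ((2 : ℂ) * (n - (l + 1)) - 𝒱.centralCharge / 12) * 𝒱.dim (n - (l + 1)) else 0) +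
        (k : ℂ) ^ 3 * ∑ l ∈ Finset.range n, (if k ∣ l + 1 then
          (𝒱.centralCharge / 12) * 𝒱.dim (n - (l + 1)) else 0) := by
      intro k _
      simp only [hh, Finset.mul_sum, ← Finset.sum_add_distrib]
      refine Finset.sum_congr rfl fun l _ => ?_
      split_ifs
      · ring
      · simp
    rw [Finset.sum_congr rfl this, Finset.sum_add_distrib, s1, s3, ← Finset.sum_add_distrib]
    refine Finset.sum_congr rfl fun l _ => ?_
    ring
  rw [e1, e2, e4, ← e5]
  linear_combination e3

end VertexOperatorAlgebra

namespace VertexOperatorAlgebra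

variable {V : Type*} [AddCommGroup V] [Module ℂ V] {𝒱 : VertexOperatorAlgebra V}

/-! ### The recursion for the dimensions -/

/-- The coefficients of the expansion of the Casimir vectors in Virasoro descendants. -/
theorem IsStrongCFTType.casimir_coefficients (hCFT : 𝒱.IsStrongCFTType)
    {B : LinearMap.BilinForm ℂ V} (hB : 𝒱.IsLiZMetric B) {ι : Type*} [Fintype ι] {u v : ι → V}
    (hu : ∀ α, u α ∈ 𝒱.weightSpace 1) (hv : ∀ α, v α ∈ 𝒱.weightSpace 1)
    (huv : ∀ α, B (u α) (v α) = 1) {a b : ℂ}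
    (hab : a • 𝒱.L (-2) (𝒱.L (-2) 𝒱.vac) + b • 𝒱.L (-4) 𝒱.vac = 𝒱.casimir u v 4) :
    (3 : ℂ) • 𝒱.casimir u v 2 = ((8 + 𝒱.centralCharge) * a + 6 * b) • 𝒱.conf ∧
      ((8 + 𝒱.centralCharge) * a + 6 * b) * 𝒱.centralCharge = -6 * Fintype.card ι ∧
      (3 * a + 5 * b) * 𝒱.centralCharge = -3 * Fintype.card ι := by
  set c := 𝒱.centralCharge
  have hL : ∀ m : ℕ, 𝒱.L m 𝒱.vac = 0 := fun m => 𝒱.L_vac (by omega)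
  have hinj := smul_left_injective ℂ 𝒱.vac_ne_zero
  have hLu : ∀ (m : ℕ) α n, 𝒱.L (m + 2) (𝒱.mode (u α) n (v α)) =
      (-(n : ℂ)) • 𝒱.mode (u α) (m + 2 + n) (v α) := fun m α n => by
    rw [hCFT.L_mode (hu α), hCFT.L_eq_zero (hv α) (by omega), map_zero]
    module
  have hone : ∑ α, 𝒱.mode (u α) 1 (v α) = (-(Fintype.card ι : ℂ)) • 𝒱.vac := by
    simp only [hCFT.mode_one hB (hu _) (hv _), huv]
    simp [Nat.cast_smul_eq_nsmul]
  -- By `[Lₘ, uₙ] = -n u_{m+n}`, the operators `L₂` and `L₄` send `u₋₃ ū` to `3 u₋₁ ū` and `3 u₁ ū`.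
  have h24 : 𝒱.L 2 (𝒱.casimir u v 4) = (3 : ℂ) • 𝒱.casimir u v 2 := by
    have := fun α => hLu 0 α (-3)
    norm_num at this
    simp [casimir, this, Finset.smul_sum]
  have h22 : 𝒱.L 2 (𝒱.casimir u v 2) = (-(Fintype.card ι : ℂ)) • 𝒱.vac := by
    have := fun α => hLu 0 α (-1)
    norm_num at this
    rw [← hone]
    simp [casimir, this]
  have h44 : 𝒱.L 4 (𝒱.casimir u v 4) = (-3 * (Fintype.card ι : ℂ)) • 𝒱.vac := by
    have := fun α => hLu 2 α (-3)
    norm_num at this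
    rw [show (-3 * (Fintype.card ι : ℂ)) = 3 * -(Fintype.card ι : ℂ) by ring, mul_smul, ← hone]
    simp [casimir, this, Finset.smul_sum]
  have v2 : 𝒱.L 2 𝒱.vac = 0 := hL 2
  have v4 : 𝒱.L 4 𝒱.vac = 0 := hL 4
  have v0 : 𝒱.L 0 𝒱.vac = 0 := hL 0
  have ω0 : 𝒱.L 0 (𝒱.L (-2) 𝒱.vac) = (2 : ℂ) • 𝒱.L (-2) 𝒱.vac := by
    rw [𝒱.L_L_apply 0 (-2), v0]; norm_num
  have ω2 : 𝒱.L 2 (𝒱.L (-2) 𝒱.vac) = (c / 2) • 𝒱.vac := by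
    rw [𝒱.L_L_apply 2 (-2), v2]
    norm_num [v0]
    congr 1
    ring
  have ω4 : 𝒱.L 4 (𝒱.L (-2) 𝒱.vac) = 0 := by
    rw [𝒱.L_L_apply 4 (-2), v4]; norm_num [v2]
  have e1 : 𝒱.L 2 (𝒱.L (-2) (𝒱.L (-2) 𝒱.vac)) = (8 + c) • 𝒱.conf := by
    rw [𝒱.L_L_apply 2 (-2), ω2, map_smul, show (2 + -2 : ℤ) = 0 by norm_num, ω0, if_pos (by norm_num),
      L_neg_two_vac]
    push_cast
    module
  have e2 : 𝒱.L 2 (𝒱.L (-4) 𝒱.vac) = (6 : ℂ) • 𝒱.conf := by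
    rw [𝒱.L_L_apply 2 (-4), v2, ← L_neg_two_vac]; norm_num
  have e3 : 𝒱.L 4 (𝒱.L (-2) (𝒱.L (-2) 𝒱.vac)) = (3 * c) • 𝒱.vac := by
    rw [𝒱.L_L_apply 4 (-2), ω4, show (4 + -2 : ℤ) = 2 by norm_num, ω2, if_neg (by norm_num),
      map_zero]
    push_cast
    module
  have e4 : 𝒱.L 4 (𝒱.L (-4) 𝒱.vac) = (5 * c) • 𝒱.vac := by
    rw [𝒱.L_L_apply 4 (-4), v4, show (4 + -4 : ℤ) = 0 by norm_num, v0, if_pos (by norm_num),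
      map_zero]
    push_cast
    module
  have main : (3 : ℂ) • 𝒱.casimir u v 2 = ((8 + c) * a + 6 * b) • 𝒱.conf := by
    rw [← h24, ← hab, map_add, map_smul, map_smul, e1, e2]
    module
  refine ⟨main, ?_, ?_⟩
  · have := congrArg (𝒱.L 2) main
    rw [map_smul, map_smul, h22, ← L_neg_two_vac, ω2, smul_smul, smul_smul] at this
    have : 3 * -(Fintype.card ι : ℂ) = ((8 + c) * a + 6 * b) * (c / 2) := hinj this
    linear_combination -2 * this
  · rw [← hab, map_add, map_smul, map_smul, e3, e4, smul_smul, smul_smul, ← add_smul] at h44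
    have : a * (3 * c) + b * (5 * c) = -3 * (Fintype.card ι : ℂ) := hinj h44
    linear_combination this

/-- The coefficientwise form of the differential equation for the partition function. -/
theorem IsStrongCFTType.dim_recursion (hCFT : 𝒱.IsStrongCFTType)
    {B : LinearMap.BilinForm ℂ V} (hB : 𝒱.IsLiZMetric B) {ι : Type*} [Fintype ι] [Nonempty ι]
    {u v : ι → V} (hu : ∀ α, u α ∈ 𝒱.weightSpace 1) (hv : ∀ α, v α ∈ 𝒱.weightSpace 1)
    (huv : ∀ α, B (u α) (v α) = 1) (hcas : 𝒱.casimir u v 4 ∈ 𝒱.virasoroSubalgebra) (n : ℕ) :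
    ((n : ℂ) ^ 2 - (𝒱.centralCharge + 2) / 12 * n) * 𝒱.dim n +
      ∑ l ∈ Finset.range n, (4 * (ArithmeticFunction.sigma 1 (l + 1) : ℂ) * (n - (l + 1)) -
        5 * 𝒱.centralCharge * (𝒱.centralCharge + 4) / 12 *
          (ArithmeticFunction.sigma 3 (l + 1) : ℂ) -
        𝒱.centralCharge / 6 * (ArithmeticFunction.sigma 1 (l + 1) : ℂ)) *
          𝒱.dim (n - (l + 1)) = 0 := by
  have hwt : 𝒱.casimir u v 4 ∈ 𝒱.weightSpace 4 := by
    refine Submodule.sum_mem _ fun α _ => ?_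
    simpa using hCFT.mode_mem_weightSpace (hu α) (hv α) (1 - 4)
  obtain ⟨a, b, hab⟩ := 𝒱.exists_of_mem_virasoroSubalgebra hcas hwt
  obtain ⟨h1, h2, h3⟩ := hCFT.casimir_coefficients hB hu hv huv hab
  have htr := hCFT.wtrace_casimir hB hu hv huv n
  have t2 : 3 * 𝒱.wtrace n (𝒱.mode (𝒱.casimir u v 2) 1) =
      ((8 + 𝒱.centralCharge) * a + 6 * b) * (n * 𝒱.dim n) := by
    have e : (3 : ℂ) • 𝒱.mode (𝒱.casimir u v 2) 1 =
        ((8 + 𝒱.centralCharge) * a + 6 * b) • 𝒱.L 0 := by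
      have := congrArg (fun x => 𝒱.mode x 1) h1
      simp only [mode, map_smul, Pi.smul_apply] at this ⊢
      rw [this]; rfl
    have := congrArg (𝒱.wtrace n) e
    rw [map_smul, map_smul, wtrace_L_zero] at this
    simpa using this
  have t4 : 𝒱.wtrace n (𝒱.mode (𝒱.casimir u v 4) 3) =
      a * 𝒱.wtrace n (𝒱.mode (𝒱.L (-2) (𝒱.L (-2) 𝒱.vac)) 3) +
        b * 𝒱.wtrace n (𝒱.mode (𝒱.L (-4) 𝒱.vac) 3) := by
    rw [← hab]; simp [mode]
  rw [hCFT.wtrace_L_neg_two_sq, wtrace_L_neg_four] at t4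
  set c := 𝒱.centralCharge
  set d : ℂ := (Fintype.card ι : ℂ) with hd
  have hd0 : d ≠ 0 := by rw [hd]; exact_mod_cast Fintype.card_ne_zero
  -- Positivity of `d` makes `c` and `a` nonzero; the relations then give `b` and `d` as multiples
  -- of `a`, and `a` can be cancelled.
  have hc : c ≠ 0 := by
    intro hc
    rw [hc] at h3
    exact hd0 (by linear_combination h3 / 3)
  have hb : b = (c + 2) * a / 4 := by
    apply mul_left_cancel₀ hc
    linear_combination h3 / 2 - h2 / 4
  have hda : d = -(a * (c * (5 * c + 22) / 12)) := by
    rw [hb] at h3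
    linear_combination h3 / 3
  have ha : a ≠ 0 := by
    intro ha
    exact hd0 (by rw [hda, ha]; ring)
  set σ₁ : ℕ → ℂ := fun l => (ArithmeticFunction.sigma 1 (l + 1) : ℂ)
  set σ₃ : ℕ → ℂ := fun l => (ArithmeticFunction.sigma 3 (l + 1) : ℂ)
  have hsum : ∑ l ∈ Finset.range n, (4 * σ₁ l * (n - (l + 1)) - 5 * c * (c + 4) / 12 * σ₃ l -
        c / 6 * σ₁ l) * 𝒱.dim (n - (l + 1)) =
      2 * ∑ l ∈ Finset.range n, (2 * σ₁ l * (n - (l + 1)) + c / 12 * (σ₃ l - σ₁ l)) *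
        𝒱.dim (n - (l + 1)) - c * (5 * c + 22) / 12 *
          ∑ l ∈ Finset.range n, σ₃ l * 𝒱.dim (n - (l + 1)) := by
    rw [Finset.mul_sum, Finset.mul_sum, ← Finset.sum_sub_distrib]
    refine Finset.sum_congr rfl fun l _ => ?_
    ring
  refine (mul_eq_zero.mp ?_).resolve_left ha
  change a * (_ + ∑ l ∈ Finset.range n, (4 * σ₁ l * (n - (l + 1)) - 5 * c * (c + 4) / 12 * σ₃ l -
        c / 6 * σ₁ l) * 𝒱.dim (n - (l + 1))) = 0
  rw [hsum]
  rw [t4, hda] at htr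
  rw [hb] at htr t2
  linear_combination htr + t2 / 3

end VertexOperatorAlgebra

/-! ### Series in `q` -/

section QSeries

open Derivative

theorem hasDerivAt_exp_mul (s z : ℂ) :
    HasDerivAt (fun z : ℂ => Complex.exp (2 * Real.pi * Complex.I * s * z))
      (2 * Real.pi * Complex.I * (s * Complex.exp (2 * Real.pi * Complex.I * s * z))) z := by
  have h := ((hasDerivAt_id z).const_mul (2 * Real.pi * Complex.I * s)).cexp
  simp only [id_eq, mul_one] at h
  convert! h using 1
  ring

theorem comp_ofComplex_eventuallyEq {F : ℍ → ℂ} {F' : ℂ → ℂ} (h : ∀ τ : ℍ, F τ = F' τ) (τ : ℍ) :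
    F ∘ ofComplex =ᶠ[nhds (τ : ℂ)] F' := by
  filter_upwards [isOpen_upperHalfPlaneSet.mem_nhds τ.im_pos] with z hz
  rw [Function.comp_apply, h, ofComplex_apply_of_im_pos hz]

theorem normalizedDeriv_of_hasDerivAt {F : ℍ → ℂ} {F' : ℂ → ℂ} (h : ∀ τ : ℍ, F τ = F' τ) {d : ℂ}
    {τ : ℍ} (hd : HasDerivAt F' (2 * Real.pi * Complex.I * d) τ) :
    normalizedDerivOfComplex F τ = d := by
  rw [normalizedDerivOfComplex, (comp_ofComplex_eventuallyEq h τ).deriv_eq, hd.deriv,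
    inv_mul_cancel_left₀ Complex.two_pi_I_ne_zero]

theorem qPow_mdifferentiable (s : ℂ) : MDifferentiable 𝓘(ℂ) 𝓘(ℂ) (qPow s) := fun τ =>
  UpperHalfPlane.mdifferentiableAt_iff.mpr ((hasDerivAt_exp_mul s τ).congr_of_eventuallyEq
    (comp_ofComplex_eventuallyEq (fun _ => rfl) τ)).differentiableAt

theorem normalizedDeriv_qPow (s : ℂ) : normalizedDerivOfComplex (qPow s) = s • qPow s := by
  funext τ
  exact normalizedDeriv_of_hasDerivAt (fun _ => rfl) (hasDerivAt_exp_mul s τ)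

theorem qPow_add (s t : ℂ) (τ : ℍ) : qPow (s + t) τ = qPow s τ * qPow t τ := by
  rw [qPow, qPow, qPow, ← Complex.exp_add]
  congr 1
  ring

theorem qPow_zero (τ : ℍ) : qPow 0 τ = 1 := by simp [qPow]

theorem qPow_ne_zero (s : ℂ) (τ : ℍ) : qPow s τ ≠ 0 := Complex.exp_ne_zero _

theorem qPow_natCast (n : ℕ) (τ : ℍ) : qPow n τ = qPow 1 τ ^ n := by
  rw [qPow, qPow, ← Complex.exp_nat_mul]
  congr 1
  ring

theorem norm_qPow (s : ℂ) (τ : ℍ) :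
    ‖qPow s τ‖ = Real.exp (-(2 * Real.pi) * (s.re * τ.im + s.im * τ.re)) := by
  rw [qPow, Complex.norm_exp]
  congr 1
  simp
  ring

theorem norm_qPow_one (τ : ℍ) : ‖qPow 1 τ‖ = Real.exp (-(2 * Real.pi) * τ.im) := by
  simp [norm_qPow]

theorem norm_qPow_one_lt (τ : ℍ) : ‖qPow 1 τ‖ < 1 := by
  rw [norm_qPow_one, Real.exp_lt_one_iff]
  have := mul_pos Real.two_pi_pos τ.im_pos
  linarith

/-- Subexponential growth of a sequence. -/
def Subexp (a : ℕ → ℂ) : Prop := ∀ r : ℝ, 1 < r → ∃ M, ∀ n, ‖a n‖ ≤ M * r ^ n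

/-- Bound each factor at the rate `√r > 1`. -/
theorem Subexp.mul {a b : ℕ → ℂ} (ha : Subexp a) (hb : Subexp b) : Subexp (fun n => a n * b n) := by
  intro r hr
  have hs : 1 < √r := Real.lt_sqrt_of_sq_lt (by simpa using hr)
  obtain ⟨M, hM⟩ := ha _ hs
  obtain ⟨M', hM'⟩ := hb _ hs
  refine ⟨M * M', fun n => ?_⟩
  calc ‖a n * b n‖ = ‖a n‖ * ‖b n‖ := norm_mul _ _
    _ ≤ (M * √r ^ n) * (M' * √r ^ n) := mul_le_mul (hM n) (hM' n) (norm_nonneg _)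
        ((norm_nonneg _).trans (hM n))
    _ = M * M' * r ^ n := by
        rw [mul_mul_mul_comm, ← mul_pow, Real.mul_self_sqrt (by linarith)]

theorem Subexp.of_le_pow {a : ℕ → ℂ} {C : ℝ} {k : ℕ} (h : ∀ n, ‖a n‖ ≤ C * (n : ℝ) ^ k) :
    Subexp a := by
  intro r hr
  obtain ⟨M, hM⟩ := (tendsto_pow_const_div_const_pow_of_one_lt k hr).bddAbove_range
  refine ⟨|C| * M, fun n => (h n).trans ?_⟩
  have h1 : (n : ℝ) ^ k / r ^ n ≤ M := hM ⟨n, rfl⟩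
  rw [div_le_iff₀ (by positivity)] at h1
  calc C * (n : ℝ) ^ k ≤ |C| * (n : ℝ) ^ k := by gcongr; exact le_abs_self C
    _ ≤ |C| * (M * r ^ n) := by gcongr
    _ = |C| * M * r ^ n := by ring

theorem Subexp.const (c : ℂ) : Subexp (fun _ => c) :=
  Subexp.of_le_pow (C := ‖c‖) (k := 0) (by simp)

theorem Subexp.natCast : Subexp (fun n => n) :=
  Subexp.of_le_pow (C := 1) (k := 1) (by simp)

theorem Subexp.add {a b : ℕ → ℂ} (ha : Subexp a) (hb : Subexp b) : Subexp (fun n => a n + b n) := by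
  intro r hr
  obtain ⟨M, hM⟩ := ha _ hr
  obtain ⟨M', hM'⟩ := hb _ hr
  exact ⟨M + M', fun n => (norm_add_le _ _).trans (by rw [add_mul]; exact add_le_add (hM n) (hM' n))⟩

theorem norm_sigma_le (k n : ℕ) : ‖(ArithmeticFunction.sigma k n : ℂ)‖ ≤ (n : ℝ) ^ (k + 1) := by
  rw [Complex.norm_natCast]
  exact_mod_cast ArithmeticFunction.sigma_le_pow_succ k n

theorem Subexp.sigma (k : ℕ) : Subexp (fun n => (ArithmeticFunction.sigma k n : ℂ)) :=
  Subexp.of_le_pow (C := 1) (k := k + 1) fun n => by rw [one_mul]; exact norm_sigma_le k n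

theorem Subexp.summable {a : ℕ → ℂ} (ha : Subexp a) {r : ℝ} (h0 : 0 ≤ r) (h1 : r < 1) :
    Summable fun n => ‖a n‖ * r ^ n := by
  -- For `r < 1` the rate `2 / (1 + r)` exceeds `1`, while its product with `r` stays below `1`.
  obtain ⟨M, hM⟩ := ha (2 / (1 + r)) (by rw [lt_div_iff₀ (by linarith)]; linarith)
  have hlt : 2 / (1 + r) * r < 1 := by
    rw [div_mul_eq_mul_div, div_lt_iff₀ (by linarith)]; linarith
  refine Summable.of_nonneg_of_le (fun n => by positivity) (fun n => ?_)
    ((summable_geometric_of_lt_one (by positivity) hlt).mul_left M)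
  calc ‖a n‖ * r ^ n ≤ M * (2 / (1 + r)) ^ n * r ^ n := by gcongr; exact hM n
    _ = M * (2 / (1 + r) * r) ^ n := by rw [mul_pow, mul_assoc]

/-- The series `∑ aₙ qⁿ`. -/
noncomputable def qSeries (a : ℕ → ℂ) (τ : ℍ) : ℂ := ∑' n, a n * qPow 1 τ ^ n

theorem Subexp.summable_norm {a : ℕ → ℂ} (ha : Subexp a) (τ : ℍ) :
    Summable fun n => ‖a n * qPow 1 τ ^ n‖ := by
  simpa [norm_mul, norm_pow] using ha.summable (norm_nonneg _) (norm_qPow_one_lt τ)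

theorem Subexp.hasDerivAt {a : ℕ → ℂ} (ha : Subexp a) {z : ℂ} (hz : ‖z‖ < 1) :
    HasDerivAt (fun z => ∑' n, a n * z ^ n) (∑' n : ℕ, a n * (n * z ^ (n - 1))) z := by
  obtain ⟨r, hr1, hr2⟩ := exists_between hz
  have hr0 : 0 ≤ r := (norm_nonneg _).trans hr1.le
  have hd : ∀ n : ℕ, DifferentiableOn ℂ (fun z : ℂ => a n * z ^ n) (Metric.ball 0 r) := fun n =>
    ((differentiable_id.pow n).const_mul (a n)).differentiableOn
  have hle : ∀ (n : ℕ) (w : ℂ), w ∈ Metric.ball (0 : ℂ) r → ‖a n * w ^ n‖ ≤ ‖a n‖ * r ^ n := by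
    intro n w hw
    rw [norm_mul, norm_pow]
    gcongr
    exact (mem_ball_zero_iff.mp hw).le
  have hmem : z ∈ Metric.ball (0 : ℂ) r := mem_ball_zero_iff.mpr hr1
  have h1 := Complex.hasSum_deriv_of_summable_norm (ha.summable hr0 hr2) hd Metric.isOpen_ball hle
    hmem
  have h2 := (Complex.differentiableOn_tsum_of_summable_norm (ha.summable hr0 hr2) hd
    Metric.isOpen_ball hle).differentiableAt (Metric.isOpen_ball.mem_nhds hmem)
  have h3 := h2.hasDerivAt
  rw [← h1.tsum_eq] at h3
  convert! h3 using 1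
  refine tsum_congr fun n => ?_
  rw [deriv_const_mul _ (differentiableAt_pow n), deriv_pow_field]

theorem Subexp.hasDerivAt_exp {a : ℕ → ℂ} (ha : Subexp a) (τ : ℍ) :
    HasDerivAt (fun z => ∑' n, a n * Complex.exp (2 * Real.pi * Complex.I * 1 * z) ^ n)
      (2 * Real.pi * Complex.I * qSeries (fun n => n * a n) τ) τ := by
  have h := (ha.hasDerivAt (norm_qPow_one_lt τ)).comp (τ : ℂ) (hasDerivAt_exp_mul 1 (τ : ℂ))
  convert! h using 1
  rw [qSeries, mul_left_comm, one_mul]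
  congr 1
  rw [← tsum_mul_right]
  refine tsum_congr fun n => ?_
  rcases n with _ | n
  · simp
  · rw [pow_succ, Nat.add_sub_cancel, qPow]
    ring

theorem Subexp.qSeries_mdifferentiable {a : ℕ → ℂ} (ha : Subexp a) :
    MDifferentiable 𝓘(ℂ) 𝓘(ℂ) (qSeries a) := fun τ =>
  UpperHalfPlane.mdifferentiableAt_iff.mpr ((ha.hasDerivAt_exp τ).congr_of_eventuallyEq
    (comp_ofComplex_eventuallyEq (fun _ => rfl) τ)).differentiableAt

theorem Subexp.normalizedDeriv_qSeries {a : ℕ → ℂ} (ha : Subexp a) :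
    normalizedDerivOfComplex (qSeries a) = qSeries (fun n => n * a n) := by
  funext τ
  exact normalizedDeriv_of_hasDerivAt (fun _ => rfl) (ha.hasDerivAt_exp τ)

theorem Subexp.qSeries_mul {a b : ℕ → ℂ} (ha : Subexp a) (hb : Subexp b) (τ : ℍ) :
    HasSum (fun n => (∑ k ∈ Finset.range (n + 1), a k * b (n - k)) * qPow 1 τ ^ n)
      (qSeries a τ * qSeries b τ) := by
  have h := hasSum_sum_range_mul_of_summable_norm (ha.summable_norm τ) (hb.summable_norm τ)
  convert! h using 2 with n
  rw [Finset.sum_mul]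
  refine Finset.sum_congr rfl fun k hk => ?_
  have hk : k ≤ n := Nat.lt_succ_iff.mp (Finset.mem_range.mp hk)
  rw [mul_mul_mul_comm, ← pow_add, Nat.add_sub_cancel' hk]

theorem Subexp.hasSum {a : ℕ → ℂ} (ha : Subexp a) (τ : ℍ) :
    HasSum (fun n => a n * qPow 1 τ ^ n) (qSeries a τ) := (ha.summable_norm τ).of_norm.hasSum

/-- `∑ aₙ qⁿ - a₀ = O(q)`. -/
theorem Subexp.qSeries_sub_isBigO {a : ℕ → ℂ} (ha : Subexp a) :
    (fun τ => qSeries a τ - a 0) =O[atImInfty] (qPow 1) := by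
  set S := ∑' n : ℕ, ‖a (n + 1)‖ * Real.exp (-(2 * Real.pi)) ^ n with hS
  have hr : Real.exp (-(2 * Real.pi)) < 1 := by
    rw [Real.exp_lt_one_iff]; linarith [Real.two_pi_pos]
  have hsum : Summable fun n : ℕ => ‖a (n + 1)‖ * Real.exp (-(2 * Real.pi)) ^ n := by
    have := ((summable_nat_add_iff 1).mpr (ha.summable (Real.exp_pos _).le hr)).mul_right
      (Real.exp (-(2 * Real.pi)))⁻¹
    refine this.congr fun n => ?_
    rw [pow_succ]
    field_simp
  refine Asymptotics.IsBigO.of_bound S ?_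
  filter_upwards [(atImInfty_mem _).mpr ⟨1, fun _ h => h⟩] with τ hτ
  have hq : ‖qPow 1 τ‖ ≤ Real.exp (-(2 * Real.pi)) := by
    rw [norm_qPow_one, Real.exp_le_exp]
    have := mul_le_mul_of_nonneg_left (show (1 : ℝ) ≤ τ.im from hτ) Real.two_pi_pos.le
    linarith
  have h1 : qSeries a τ - a 0 = ∑' n : ℕ, a (n + 1) * qPow 1 τ ^ (n + 1) := by
    rw [qSeries, (ha.hasSum τ).summable.tsum_eq_zero_add]
    simp
  rw [h1, hS, ← tsum_mul_right]
  refine tsum_of_norm_bounded (hsum.mul_right _).hasSum fun n => ?_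
  rw [norm_mul, norm_pow, pow_succ, ← mul_assoc]
  gcongr

theorem tendsto_qPow_one : Filter.Tendsto (qPow 1) atImInfty (nhds 0) := by
  rw [tendsto_zero_iff_norm_tendsto_zero]
  have h : Filter.Tendsto (fun τ : ℍ => -(2 * Real.pi) * τ.im) atImInfty Filter.atBot :=
    Filter.Tendsto.const_mul_atTop_of_neg (by linarith [Real.two_pi_pos]) Filter.tendsto_comap
  exact (Real.tendsto_exp_atBot.comp h).congr fun τ => (norm_qPow_one τ).symm

theorem Subexp.tendsto_qSeries {a : ℕ → ℂ} (ha : Subexp a) :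
    Filter.Tendsto (qSeries a) atImInfty (nhds (a 0)) := by
  have := (ha.qSeries_sub_isBigO.trans_tendsto tendsto_qPow_one).add_const (a 0)
  simpa using this

/-- The coefficients of the Eisenstein series. -/
noncomputable def eisensteinCoeff (k n : ℕ) : ℂ :=
  if n = 0 then -((bernoulli k : ℚ) : ℂ) / (k.factorial : ℂ) else
    2 / ((k - 1).factorial : ℂ) * (ArithmeticFunction.sigma (k - 1) n : ℂ)

theorem eisensteinCoeff_succ (k n : ℕ) : eisensteinCoeff k (n + 1) =
    2 / ((k - 1).factorial : ℂ) * (ArithmeticFunction.sigma (k - 1) (n + 1) : ℂ) := by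
  simp [eisensteinCoeff]

theorem subexp_eisensteinCoeff (k : ℕ) : Subexp (eisensteinCoeff k) := by
  intro r hr
  obtain ⟨M, hM⟩ := ((Subexp.const (2 / ((k - 1).factorial : ℂ))).mul (Subexp.sigma (k - 1))) r hr
  refine ⟨max M ‖eisensteinCoeff k 0‖, fun n => ?_⟩
  rcases n with _ | n
  · simp
  · rw [eisensteinCoeff_succ]
    exact (hM (n + 1)).trans (by gcongr; exact le_max_left _ _)

theorem eisensteinE_eq_qSeries (k : ℕ) : eisensteinE k = qSeries (eisensteinCoeff k) := by
  funext τ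
  rw [qSeries, ((subexp_eisensteinCoeff k).hasSum τ).summable.tsum_eq_zero_add, eisensteinE,
    ← tsum_mul_left]
  congr 1
  · simp [eisensteinCoeff]
  · refine tsum_congr fun n => ?_
    rw [eisensteinCoeff_succ, ← qPow_natCast]
    push_cast
    ring

theorem modularD_zero (f : ℍ → ℂ) : modularD 0 f = normalizedDerivOfComplex f := by
  funext τ; simp [modularD]

theorem modularD_two_modularD_zero (f : ℍ → ℂ) (τ : ℍ) : modularD 2 (modularD 0 f) τ =
    normalizedDerivOfComplex (normalizedDerivOfComplex f) τ +
      2 * eisensteinE 2 τ * normalizedDerivOfComplex f τ := by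
  rw [modularD_zero, modularD, Nat.cast_ofNat]

/-- Growth of the solutions of a recursion of Frobenius type. -/
theorem Subexp.of_recursion {a : ℕ → ℂ} {κ : ℂ} {C : ℝ} (hC : 0 ≤ C)
    (h : ∀ n : ℕ, 0 < n → ‖(n : ℂ) - κ‖ * ‖a n‖ ≤
      C * ∑ l ∈ Finset.range n, ((l : ℝ) + 1) ^ 4 * ‖a (n - (l + 1))‖) : Subexp a := by
  intro r hr
  have hr0 : 0 < r := by linarith
  have hs : Summable fun l : ℕ => ((l : ℝ) + 1) ^ 4 * r⁻¹ ^ (l + 1) := by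
    have := summable_pow_mul_geometric_of_norm_lt_one 4 (r := r⁻¹)
      (by rw [Real.norm_eq_abs, abs_of_pos (by positivity)]; exact inv_lt_one_of_one_lt₀ hr)
    exact_mod_cast (summable_nat_add_iff 1).mpr this
  set S := ∑' l : ℕ, ((l : ℝ) + 1) ^ 4 * r⁻¹ ^ (l + 1) with hS
  have hS0 : 0 ≤ S := tsum_nonneg fun l => by positivity
  -- Beyond `N` the factor `‖n - κ‖` exceeds `C * S`, so a bound `M * r ^ i` for all `i < n`
  -- propagates to `n`.
  obtain ⟨N, hN⟩ := exists_nat_gt (C * S + ‖κ‖)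
  refine ⟨∑ i ∈ Finset.range (N + 1), ‖a i‖, fun n => ?_⟩
  set M := ∑ i ∈ Finset.range (N + 1), ‖a i‖ with hM
  have hM0 : 0 ≤ M := Finset.sum_nonneg fun _ _ => norm_nonneg _
  induction n using Nat.strong_induction_on with
  | _ n ih =>
    rcases lt_or_ge n (N + 1) with hn | hn
    · calc ‖a n‖ ≤ M := Finset.single_le_sum (f := fun i => ‖a i‖) (fun _ _ => norm_nonneg _)
            (Finset.mem_range.mpr hn)
        _ ≤ M * r ^ n := le_mul_of_one_le_right hM0 (one_le_pow₀ hr.le)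
    · have hnN : (N : ℝ) ≤ n := by exact_mod_cast (by omega : N ≤ n)
      have hκ : C * S < ‖(n : ℂ) - κ‖ := by
        have := norm_sub_norm_le (n : ℂ) κ
        rw [Complex.norm_natCast] at this
        linarith
      have hpos : 0 < ‖(n : ℂ) - κ‖ := (mul_nonneg hC hS0).trans_lt hκ
      have hsum : ∑ l ∈ Finset.range n, ((l : ℝ) + 1) ^ 4 * ‖a (n - (l + 1))‖ ≤ M * r ^ n * S := by
        calc ∑ l ∈ Finset.range n, ((l : ℝ) + 1) ^ 4 * ‖a (n - (l + 1))‖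
            ≤ ∑ l ∈ Finset.range n, M * r ^ n * (((l : ℝ) + 1) ^ 4 * r⁻¹ ^ (l + 1)) := by
              refine Finset.sum_le_sum fun l hl => ?_
              have hl := Finset.mem_range.mp hl
              have e : r ^ n * r⁻¹ ^ (l + 1) = r ^ (n - (l + 1)) := by
                rw [inv_pow, ← pow_sub₀ r hr0.ne' (show l + 1 ≤ n from hl)]
              calc ((l : ℝ) + 1) ^ 4 * ‖a (n - (l + 1))‖
                  ≤ ((l : ℝ) + 1) ^ 4 * (M * r ^ (n - (l + 1))) := by
                    gcongr; exact ih _ (by omega)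
                _ = _ := by rw [← e]; ring
          _ = M * r ^ n * ∑ l ∈ Finset.range n, (((l : ℝ) + 1) ^ 4 * r⁻¹ ^ (l + 1)) := by
              rw [Finset.mul_sum]
          _ ≤ M * r ^ n * S := by
              gcongr
              exact hs.sum_le_tsum _ fun l _ => by positivity
      have h1 := (h n (by omega)).trans (mul_le_mul_of_nonneg_left hsum hC)
      refine le_of_mul_le_mul_left (h1.trans ?_) hpos
      calc C * (M * r ^ n * S) = C * S * (M * r ^ n) := by ring
        _ ≤ ‖(n : ℂ) - κ‖ * (M * r ^ n) := by gcongr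

end QSeries

/-! ### The modular linear differential equation -/

section MLDE

open Derivative

/-- The leading factor is `n (n - (c+2)/12)`, the other coefficients grow at most linearly in `n`,
and `σ₁`, `σ₃` at `l + 1` are at most `(l + 1)^4`; divide by `n`. -/
theorem subexp_of_mldeRecursion {a : ℕ → ℂ} {c : ℂ}
    (h : ∀ n : ℕ, ((n : ℂ) ^ 2 - (c + 2) / 12 * n) * a n +
      ∑ l ∈ Finset.range n, (4 * (ArithmeticFunction.sigma 1 (l + 1) : ℂ) * (n - (l + 1)) -
        5 * c * (c + 4) / 12 * (ArithmeticFunction.sigma 3 (l + 1) : ℂ) -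
        c / 6 * (ArithmeticFunction.sigma 1 (l + 1) : ℂ)) * a (n - (l + 1)) = 0) : Subexp a := by
  set C : ℝ := 4 + ‖5 * c * (c + 4) / 12‖ + ‖c / 6‖ with hC
  refine Subexp.of_recursion (κ := (c + 2) / 12) (C := C) (by positivity) fun n hn => ?_
  have hn0 : (0 : ℝ) < n := by exact_mod_cast hn
  have hn1 : (1 : ℝ) ≤ n := by exact_mod_cast hn
  refine le_of_mul_le_mul_left ?_ hn0
  calc (n : ℝ) * (‖(n : ℂ) - (c + 2) / 12‖ * ‖a n‖)
      = ‖((n : ℂ) ^ 2 - (c + 2) / 12 * n) * a n‖ := by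
        rw [show ((n : ℂ) ^ 2 - (c + 2) / 12 * n) = n * (n - (c + 2) / 12) by ring, norm_mul,
          norm_mul, Complex.norm_natCast, mul_assoc]
    _ ≤ ∑ l ∈ Finset.range n, n * (C * (((l : ℝ) + 1) ^ 4 * ‖a (n - (l + 1))‖)) := by
        rw [eq_neg_of_add_eq_zero_left (h n), norm_neg]
        refine norm_sum_le_of_le _ fun l hl => ?_
        rw [norm_mul]
        have hl : l + 1 ≤ n := Finset.mem_range.mp hl
        have h1 : ‖(ArithmeticFunction.sigma 1 (l + 1) : ℂ)‖ ≤ ((l : ℝ) + 1) ^ 4 := by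
          refine (norm_sigma_le 1 (l + 1)).trans ?_
          push_cast
          exact pow_le_pow_right₀ (by linarith [Nat.cast_nonneg (α := ℝ) l]) (by norm_num)
        have h3 : ‖(ArithmeticFunction.sigma 3 (l + 1) : ℂ)‖ ≤ ((l : ℝ) + 1) ^ 4 := by
          have := norm_sigma_le 3 (l + 1)
          push_cast at this
          exact this
        have hnl : ‖(n : ℂ) - (l + 1)‖ ≤ n := by
          rw [show (n : ℂ) - (l + 1) = ((n - (l + 1) : ℕ) : ℂ) by
            rw [Nat.cast_sub hl]; push_cast; ring, Complex.norm_natCast]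
          exact_mod_cast Nat.sub_le _ _
        calc _ ≤ (4 * ((l : ℝ) + 1) ^ 4 * n + ‖5 * c * (c + 4) / 12‖ * ((l : ℝ) + 1) ^ 4 +
              ‖c / 6‖ * ((l : ℝ) + 1) ^ 4) * ‖a (n - (l + 1))‖ := by
              gcongr
              refine (norm_sub_le _ _).trans (add_le_add ((norm_sub_le _ _).trans
                (add_le_add ?_ ?_)) ?_)
              · rw [norm_mul, norm_mul, Complex.norm_ofNat]
                gcongr
              · rw [norm_mul]; gcongr
              · rw [norm_mul]; gcongr
          _ ≤ (4 * ((l : ℝ) + 1) ^ 4 * n + ‖5 * c * (c + 4) / 12‖ * ((l : ℝ) + 1) ^ 4 * n +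
              ‖c / 6‖ * ((l : ℝ) + 1) ^ 4 * n) * ‖a (n - (l + 1))‖ := by
              refine mul_le_mul_of_nonneg_right (add_le_add (add_le_add le_rfl ?_) ?_)
                (norm_nonneg _) <;> exact le_mul_of_one_le_right (by positivity) hn1
          _ = n * (C * (((l : ℝ) + 1) ^ 4 * ‖a (n - (l + 1))‖)) := by rw [hC]; ring
    _ = n * (C * ∑ l ∈ Finset.range n, ((l : ℝ) + 1) ^ 4 * ‖a (n - (l + 1))‖) := by
        rw [Finset.mul_sum, Finset.mul_sum]

theorem Subexp.natCast_add_mul {a : ℕ → ℂ} (ha : Subexp a) (s : ℂ) :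
    Subexp (fun n => (n + s) * a n) :=
  (Subexp.natCast.add (Subexp.const s)).mul ha

theorem Subexp.normalizedDeriv_qPow_mul_qSeries {a : ℕ → ℂ} (ha : Subexp a) (s : ℂ) :
    normalizedDerivOfComplex (qPow s * qSeries a) = qPow s * qSeries (fun n => (n + s) * a n) := by
  rw [normalizedDerivOfComplex_mul _ _ (qPow_mdifferentiable s) ha.qSeries_mdifferentiable,
    normalizedDeriv_qPow, ha.normalizedDeriv_qSeries]
  funext τ
  have h1 := (ha.natCast_add_mul s).hasSum τ
  have h2 := ((Subexp.natCast.mul ha).hasSum τ).add ((ha.hasSum τ).mul_left s)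
  have h3 : qSeries (fun n => (n + s) * a n) τ = qSeries (fun n => n * a n) τ + s * qSeries a τ :=
    h1.unique (by convert! h2 using 2 with n; ring)
  simp only [Pi.add_apply, Pi.mul_apply, Pi.smul_apply, smul_eq_mul, h3]
  ring

theorem bernoulli_four : bernoulli 4 = -1 / 30 := by
  rw [bernoulli_eq_bernoulli'_of_ne_one (by norm_num), bernoulli'_four]

/-- The constant terms `-1/12` of `E₂` and `1/720` of `E₄` turn `(n - c/24)²` into the indicial
polynomial `n² - (c+2)n/12`; the higher coefficients give the convolution. -/
theorem solvesMLDE_of_recursion {a : ℕ → ℂ} {c : ℂ} (ha : Subexp a)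
    (h : ∀ n : ℕ, ((n : ℂ) ^ 2 - (c + 2) / 12 * n) * a n +
      ∑ l ∈ Finset.range n, (4 * (ArithmeticFunction.sigma 1 (l + 1) : ℂ) * (n - (l + 1)) -
        5 * c * (c + 4) / 12 * (ArithmeticFunction.sigma 3 (l + 1) : ℂ) -
        c / 6 * (ArithmeticFunction.sigma 1 (l + 1) : ℂ)) * a (n - (l + 1)) = 0) :
    SolvesMLDE c (qPow (-c / 24) * qSeries a) := by
  intro τ
  set s : ℂ := -c / 24 with hs
  have ha1 := ha.natCast_add_mul s
  have ha2 := ha1.natCast_add_mul s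
  have h2 := (ha2.hasSum τ).add
    ((((subexp_eisensteinCoeff 2).qSeries_mul ha1 τ).mul_left 2).sub
      (((subexp_eisensteinCoeff 4).qSeries_mul ha τ).mul_left (5 / 4 * c * (c + 4))))
  have h0 : qSeries (fun n => (n + s) * ((n + s) * a n)) τ +
      (2 * (qSeries (eisensteinCoeff 2) τ * qSeries (fun n => (n + s) * a n) τ) -
        5 / 4 * c * (c + 4) * (qSeries (eisensteinCoeff 4) τ * qSeries a τ)) = 0 := by
    refine h2.unique ?_
    convert! hasSum_zero using 2 with n
    have e2 : eisensteinCoeff 2 0 = -1 / 12 := by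
      norm_num [eisensteinCoeff, bernoulli_two, Nat.factorial]
    have e4 : eisensteinCoeff 4 0 = 1 / 720 := by
      norm_num [eisensteinCoeff, bernoulli_four, Nat.factorial]
    have key : (n + s) * ((n + s) * a n) +
        (2 * ∑ k ∈ Finset.range (n + 1), eisensteinCoeff 2 k * (((n - k : ℕ) + s) * a (n - k)) -
          5 / 4 * c * (c + 4) * ∑ k ∈ Finset.range (n + 1), eisensteinCoeff 4 k * a (n - k)) =
        0 := by
      rw [Finset.sum_range_succ', Finset.sum_range_succ', e2, e4, Nat.sub_zero, ← h n]
      have hsum : ∑ l ∈ Finset.range n, (4 * (ArithmeticFunction.sigma 1 (l + 1) : ℂ) *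
          (n - (l + 1)) - 5 * c * (c + 4) / 12 * (ArithmeticFunction.sigma 3 (l + 1) : ℂ) -
          c / 6 * (ArithmeticFunction.sigma 1 (l + 1) : ℂ)) * a (n - (l + 1)) =
          2 * ∑ k ∈ Finset.range n,
            eisensteinCoeff 2 (k + 1) * (((n - (k + 1) : ℕ) + s) * a (n - (k + 1))) -
          5 / 4 * c * (c + 4) *
            ∑ k ∈ Finset.range n, eisensteinCoeff 4 (k + 1) * a (n - (k + 1)) := by
        rw [Finset.mul_sum, Finset.mul_sum, ← Finset.sum_sub_distrib]
        refine Finset.sum_congr rfl fun l hl => ?_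
        have hl : l + 1 ≤ n := Finset.mem_range.mp hl
        rw [eisensteinCoeff_succ, eisensteinCoeff_succ, Nat.cast_sub hl, hs]
        norm_num [Nat.factorial]
        ring
      rw [hsum, hs]
      ring
    linear_combination (qPow 1 τ ^ n) * key
  rw [modularD_two_modularD_zero, ha.normalizedDeriv_qPow_mul_qSeries,
    ha1.normalizedDeriv_qPow_mul_qSeries, eisensteinE_eq_qSeries, eisensteinE_eq_qSeries]
  simp only [Pi.mul_apply]
  linear_combination (qPow s τ) * h0

/-! ### Uniqueness by the Wronskian. -/

theorem deriv_comp_ofComplex {g : ℍ → ℂ} (τ : ℍ) :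
    deriv (g ∘ ofComplex) τ = 2 * Real.pi * Complex.I * normalizedDerivOfComplex g τ := by
  rw [normalizedDerivOfComplex, mul_inv_cancel_left₀ Complex.two_pi_I_ne_zero]

/-- Cauchy's estimate for functions that are `O(q)` at `i∞`. -/
theorem normalizedDeriv_isBigO {g : ℍ → ℂ} (hg : MDifferentiable 𝓘(ℂ) 𝓘(ℂ) g)
    (h : g =O[atImInfty] (qPow 1)) : normalizedDerivOfComplex g =O[atImInfty] (qPow 1) := by
  obtain ⟨C, hC0, hC⟩ := h.exists_nonneg
  obtain ⟨A, hA⟩ := (atImInfty_mem _).mp hC.bound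
  refine Asymptotics.IsBigO.of_bound
    (‖(2 * Real.pi * Complex.I : ℂ)⁻¹‖ * (C * Real.exp (2 * Real.pi))) ?_
  filter_upwards [(atImInfty_mem _).mpr ⟨max A 0 + 2, fun _ h => h⟩] with τ hτ
  have hτ : max A 0 + 2 ≤ τ.im := hτ
  rw [normalizedDerivOfComplex, norm_mul]
  refine (mul_le_mul_of_nonneg_left ?_ (norm_nonneg _)).trans_eq (mul_assoc _ _ _).symm
  have him : ∀ z ∈ Metric.closedBall (τ : ℂ) 1, τ.im - 1 ≤ z.im := by
    intro z hz
    have h1 := (Complex.abs_im_le_norm (z - τ)).trans (mem_closedBall_iff_norm.mp hz)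
    rw [Complex.sub_im, UpperHalfPlane.coe_im] at h1
    linarith [(abs_le.mp h1).1]
  have hpos : ∀ z ∈ Metric.closedBall (τ : ℂ) 1, 0 < z.im := fun z hz => by
    linarith [him z hz, le_max_right A 0]
  have hd : DiffContOnCl ℂ (g ∘ ofComplex) (Metric.ball (τ : ℂ) 1) := by
    refine DifferentiableOn.diffContOnCl ?_
    rw [closure_ball _ one_ne_zero]
    exact (UpperHalfPlane.mdifferentiable_iff.mp hg).mono hpos
  -- On the unit disc around `τ` the imaginary part drops by at most `1`, so `‖q‖` grows at most by
  -- the factor `exp(2π)`.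
  have := Complex.norm_deriv_le_of_forall_mem_sphere_norm_le one_pos hd
    (C := C * Real.exp (2 * Real.pi) * ‖qPow 1 τ‖) fun z hz => ?_
  · rwa [div_one] at this
  · have hz' := Metric.sphere_subset_closedBall hz
    have hAz : A ≤ (⟨z, hpos z hz'⟩ : ℍ).im := by
      have := him z hz'
      change A ≤ z.im
      linarith [le_max_left A 0]
    have h1 : ‖g ⟨z, hpos z hz'⟩‖ ≤ C * ‖qPow 1 ⟨z, hpos z hz'⟩‖ := hA _ hAz
    rw [Function.comp_apply, ofComplex_apply_of_im_pos (hpos z hz')]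
    refine h1.trans ?_
    rw [mul_assoc]
    gcongr
    rw [norm_qPow_one, norm_qPow_one, ← Real.exp_add, Real.exp_le_exp]
    have h2 := mul_le_mul_of_nonneg_left (him z hz') Real.two_pi_pos.le
    change -(2 * Real.pi) * z.im ≤ _
    linarith

theorem eq_const_of_normalizedDeriv_eq_zero {F : ℍ → ℂ} (hF : MDifferentiable 𝓘(ℂ) 𝓘(ℂ) F)
    (h : ∀ τ, normalizedDerivOfComplex F τ = 0) (τ τ' : ℍ) : F τ = F τ' := by
  have := isOpen_upperHalfPlaneSet.is_const_of_deriv_eq_zero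
    (convex_halfSpace_im_gt 0).isPreconnected (UpperHalfPlane.mdifferentiable_iff.mp hF)
    (fun z hz => by
      have := deriv_comp_ofComplex (g := F) ⟨z, hz⟩
      rwa [h, mul_zero] at this) τ.im_pos τ'.im_pos
  simpa using this

theorem tendsto_qPow {s : ℂ} (him : s.im = 0) (hre : 0 < s.re) :
    Filter.Tendsto (qPow s) atImInfty (nhds 0) := by
  rw [tendsto_zero_iff_norm_tendsto_zero]
  have h : Filter.Tendsto (fun τ : ℍ => (-(2 * Real.pi) * s.re) * τ.im) atImInfty Filter.atBot :=
    Filter.Tendsto.const_mul_atTop_of_neg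
      (mul_neg_of_neg_of_pos (by linarith [Real.two_pi_pos]) hre) Filter.tendsto_comap
  refine (Real.tendsto_exp_atBot.comp h).congr fun τ => ?_
  rw [Function.comp_apply, norm_qPow, him]
  congr 1
  ring

/-- A solution `w` of the differential equation with `q^(c/24) w = O(q)` vanishes, if another
solution has leading term `q^(-c/24)` and `c < 10`. -/
theorem eq_zero_of_solvesMLDE {a : ℕ → ℂ} {c : ℂ} (ha : Subexp a) (ha0 : a 0 = 1)
    (him : c.im = 0) (hre : c.re < 10) (hZ : SolvesMLDE c (qPow (-c / 24) * qSeries a)) {g : ℍ → ℂ}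
    (hg : MDifferentiable 𝓘(ℂ) 𝓘(ℂ) g) (hw : SolvesMLDE c (qPow (-c / 24) * g))
    (hO : g =O[atImInfty] (qPow 1)) : g = 0 := by
  set s : ℂ := -c / 24 with hs
  set P := qSeries a with hP
  have hPd : MDifferentiable 𝓘(ℂ) 𝓘(ℂ) P := ha.qSeries_mdifferentiable
  have hZd := (qPow_mdifferentiable s).mul hPd
  have hwd := (qPow_mdifferentiable s).mul hg
  have hD : ∀ {x : ℍ → ℂ}, MDifferentiable 𝓘(ℂ) 𝓘(ℂ) x → ∀ τ,
      normalizedDerivOfComplex (qPow s * x) τ =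
        qPow s τ * (s * x τ + normalizedDerivOfComplex x τ) := fun {x} hx τ => by
    rw [normalizedDerivOfComplex_mul _ _ (qPow_mdifferentiable s) hx, normalizedDeriv_qPow]
    simp only [Pi.add_apply, Pi.mul_apply, Pi.smul_apply, smul_eq_mul]
    ring
  -- the integrating factor
  set b : ℕ → ℂ := fun n => 4 * (ArithmeticFunction.sigma 1 n : ℂ) * (n : ℂ)⁻¹ with hb
  have hinv : Subexp (fun n : ℕ => (n : ℂ)⁻¹) := Subexp.of_le_pow (C := 1) (k := 0) fun n => by
    rw [norm_inv, Complex.norm_natCast, pow_zero, one_mul]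
    exact Nat.cast_inv_le_one n
  have hbs : Subexp b := ((Subexp.const 4).mul (Subexp.sigma 1)).mul hinv
  set E : ℍ → ℂ := fun τ => Complex.exp (qSeries b τ) with hE
  have hEat : ∀ τ : ℍ, HasDerivAt (fun z => Complex.exp (∑' n, b n *
      Complex.exp (2 * Real.pi * Complex.I * 1 * z) ^ n))
      (2 * Real.pi * Complex.I * (E τ * qSeries (fun n => n * b n) τ)) τ := fun τ => by
    convert! (hbs.hasDerivAt_exp τ).cexp using 1
    simp only [hE, qSeries, qPow]
    ring
  have hEd : MDifferentiable 𝓘(ℂ) 𝓘(ℂ) E := fun τ =>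
    UpperHalfPlane.mdifferentiableAt_iff.mpr ((hEat τ).congr_of_eventuallyEq
      (comp_ofComplex_eventuallyEq (fun _ => rfl) τ)).differentiableAt
  have hED : ∀ τ, normalizedDerivOfComplex E τ = E τ * qSeries (fun n => n * b n) τ := fun τ =>
    normalizedDeriv_of_hasDerivAt (fun _ => rfl) (hEat τ)
  have hE2 : ∀ τ, 2 * eisensteinE 2 τ = -1 / 6 + qSeries (fun n => n * b n) τ := fun τ => by
    rw [qSeries, ((Subexp.natCast.mul hbs).hasSum τ).summable.tsum_eq_zero_add, eisensteinE]
    have : ∀ n : ℕ, ((n + 1 : ℕ) : ℂ) * b (n + 1) * qPow 1 τ ^ (n + 1) =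
        4 * ((ArithmeticFunction.sigma (2 - 1) (n + 1) : ℂ) * qPow ((n : ℂ) + 1) τ) := fun n => by
      have hne : ((n + 1 : ℕ) : ℂ) ≠ 0 := Nat.cast_ne_zero.mpr n.succ_ne_zero
      rw [← qPow_natCast, hb, Nat.cast_succ]
      rw [Nat.cast_succ] at hne
      field_simp
      push_cast
      ring
    simp only [this, tsum_mul_left]
    norm_num [bernoulli_two, Nat.factorial]
    ring
  set H : ℍ → ℂ := qPow (-1 / 6) * E with hH
  have hHd : MDifferentiable 𝓘(ℂ) 𝓘(ℂ) H := (qPow_mdifferentiable _).mul hEd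
  have hHD : ∀ τ, normalizedDerivOfComplex H τ = 2 * eisensteinE 2 τ * H τ := fun τ => by
    rw [hH, normalizedDerivOfComplex_mul _ _ (qPow_mdifferentiable _) hEd, normalizedDeriv_qPow,
      hE2]
    simp only [Pi.add_apply, Pi.mul_apply, Pi.smul_apply, smul_eq_mul, hED]
    ring
  -- the Wronskian
  set Z := qPow s * P with hZdef
  set w := qPow s * g with hwdef
  have hDZ := normalizedDerivOfComplex_mdifferentiable hZd
  have hDw := normalizedDerivOfComplex_mdifferentiable hwd
  set W : ℍ → ℂ := Z * normalizedDerivOfComplex w - w * normalizedDerivOfComplex Z with hW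
  have hWd : MDifferentiable 𝓘(ℂ) 𝓘(ℂ) W := (hZd.mul hDw).sub (hwd.mul hDZ)
  -- Abel's identity: the `E₄` terms cancel, so `W * H` is constant.
  have hWD : ∀ τ, normalizedDerivOfComplex W τ = -(2 * eisensteinE 2 τ * W τ) := fun τ => by
    have h1 := hZ τ
    have h2 := hw τ
    rw [modularD_two_modularD_zero] at h1 h2
    rw [hW, normalizedDerivOfComplex_sub _ _ (hZd.mul hDw) (hwd.mul hDZ),
      normalizedDerivOfComplex_mul _ _ hZd hDw, normalizedDerivOfComplex_mul _ _ hwd hDZ]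
    simp only [Pi.add_apply, Pi.sub_apply, Pi.mul_apply]
    linear_combination Z τ * h2 - w τ * h1
  have hWeq : ∀ τ, W τ = qPow s τ * qPow s τ *
      (P τ * normalizedDerivOfComplex g τ - g τ * normalizedDerivOfComplex P τ) := fun τ => by
    simp only [hW, Pi.sub_apply, Pi.mul_apply, hZdef, hwdef, hD hg, hD hPd]
    ring
  have hconst : ∀ τ τ', (W * H) τ = (W * H) τ' :=
    eq_const_of_normalizedDeriv_eq_zero (hWd.mul hHd) fun τ => by
      rw [normalizedDerivOfComplex_mul _ _ hWd hHd]
      simp only [Pi.add_apply, Pi.mul_apply, hWD, hHD]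
      ring
  have hlim : Filter.Tendsto (W * H) atImInfty (nhds 0) := by
    have hP1 : P =O[atImInfty] (fun _ => (1 : ℂ)) := ha.tendsto_qSeries.isBigO_one ℂ
    have hDP1 : normalizedDerivOfComplex P =O[atImInfty] (fun _ => (1 : ℂ)) := by
      rw [hP, ha.normalizedDeriv_qSeries]
      exact (Subexp.natCast.mul ha).tendsto_qSeries.isBigO_one ℂ
    have hE1 : E =O[atImInfty] (fun _ => (1 : ℂ)) :=
      (hbs.tendsto_qSeries.cexp).isBigO_one ℂ
    have hX : (fun τ => P τ * normalizedDerivOfComplex g τ - g τ * normalizedDerivOfComplex P τ)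
        =O[atImInfty] (qPow 1) := by
      refine Asymptotics.IsBigO.sub ?_ ?_
      · simpa using hP1.mul (normalizedDeriv_isBigO hg hO)
      · simpa using hO.mul hDP1
    -- The exponent is `(10 - c)/12`, positive precisely because `c < 10`; so the constant is zero.
    have hWH : (W * H) =O[atImInfty] (qPow (s + s + (-1 / 6) + 1)) := by
      have h1 : (W * H) = fun τ => qPow (s + s + (-1 / 6)) τ * ((P τ * normalizedDerivOfComplex g τ -
          g τ * normalizedDerivOfComplex P τ) * E τ) := by
        funext τ
        simp only [Pi.mul_apply, hWeq, hH, qPow_add]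
        ring
      rw [h1]
      refine ((Asymptotics.isBigO_refl (qPow (s + s + (-1 / 6))) _).mul (hX.mul hE1)).trans
        (Asymptotics.IsBigO.of_bound 1 (Filter.Eventually.of_forall fun τ => ?_))
      rw [qPow_add _ 1, one_mul, mul_one]
    refine hWH.trans_tendsto (tendsto_qPow ?_ ?_)
    · simp [hs, him]
    · have : s.re = -c.re / 24 := by simp [hs]
      norm_num [this]
      linarith
  have hW0 : ∀ τ, W τ = 0 := fun τ => by
    have h1 : Filter.Tendsto (W * H) atImInfty (nhds ((W * H) τ)) :=
      tendsto_const_nhds.congr fun τ' => hconst τ τ'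
    have h2 := tendsto_nhds_unique h1 hlim
    rw [Pi.mul_apply] at h2
    exact (mul_eq_zero.mp h2).resolve_right
      (mul_ne_zero (qPow_ne_zero _ _) (Complex.exp_ne_zero _))
  have hPg : ∀ τ, P τ * normalizedDerivOfComplex g τ = g τ * normalizedDerivOfComplex P τ :=
    fun τ => by
      have := hWeq τ
      rw [hW0] at this
      exact sub_eq_zero.mp ((mul_eq_zero.mp this.symm).resolve_left
        (mul_ne_zero (qPow_ne_zero _ _) (qPow_ne_zero _ _)))
  -- the quotient is constant near `i∞`
  have hPlim : Filter.Tendsto P atImInfty (nhds 1) := ha0 ▸ ha.tendsto_qSeries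
  obtain ⟨A, hA⟩ := (atImInfty_mem _).mp (hPlim.eventually_ne one_ne_zero)
  set U : Set ℂ := {z | max A 0 < z.im} with hU
  have hUpos : ∀ z ∈ U, 0 < z.im := fun z hz => (le_max_right A 0).trans_lt hz
  have hUopen : IsOpen U := isOpen_lt continuous_const Complex.continuous_im
  have hPne : ∀ z ∈ U, (P ∘ ofComplex) z ≠ 0 := fun z hz => by
    rw [Function.comp_apply, ofComplex_apply_of_im_pos (hUpos z hz)]
    exact hA _ ((le_max_left A 0).trans hz.le)
  have hgU := (UpperHalfPlane.mdifferentiable_iff.mp hg)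
  have hPU := (UpperHalfPlane.mdifferentiable_iff.mp hPd)
  obtain ⟨k, hk⟩ := hUopen.exists_is_const_of_deriv_eq_zero
    (f := fun z => (g ∘ ofComplex) z / (P ∘ ofComplex) z)
    (convex_halfSpace_im_gt _).isPreconnected
    ((hgU.mono hUpos).fun_div (hPU.mono hUpos) hPne) fun z hz => by
      have hzd : ∀ {x : ℍ → ℂ}, MDifferentiable 𝓘(ℂ) 𝓘(ℂ) x →
          DifferentiableAt ℂ (x ∘ ofComplex) z := fun hx =>
        UpperHalfPlane.mdifferentiableAt_iff.mp (hx ⟨z, hUpos z hz⟩)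
      rw [deriv_fun_div (hzd hg) (hzd hPd) (hPne z hz)]
      have e1 := deriv_comp_ofComplex (g := g) ⟨z, hUpos z hz⟩
      have e2 := deriv_comp_ofComplex (g := P) ⟨z, hUpos z hz⟩
      have e3 := hPg ⟨z, hUpos z hz⟩
      simp only at e1 e2
      rw [e1, e2, Function.comp_apply, Function.comp_apply,
        ofComplex_apply_of_im_pos (hUpos z hz), Pi.zero_apply, div_eq_zero_iff]
      left
      linear_combination 2 * Real.pi * Complex.I * e3
  -- The quotient tends to `0 / 1` at `i∞`, since `g = O(q)` and `P` tends to `1`.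
  have hk0 : k = 0 := by
    have h1 : Filter.Tendsto (fun τ => g τ / P τ) atImInfty (nhds (0 / 1)) :=
      (hO.trans_tendsto tendsto_qPow_one).div hPlim one_ne_zero
    have h2 : Filter.Tendsto (fun τ => g τ / P τ) atImInfty (nhds k) := by
      refine tendsto_const_nhds.congr' ?_
      filter_upwards [(atImInfty_mem _).mpr ⟨max A 0 + 1, fun _ h => h⟩] with τ hτ
      have : (τ : ℂ) ∈ U := by
        change max A 0 < τ.im
        have : max A 0 + 1 ≤ τ.im := hτ
        linarith
      have := hk τ this
      simpa using this.symm
    rw [zero_div] at h1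
    exact tendsto_nhds_unique h2 h1
  -- `P` may have zeros lower down, so the vanishing of `g` is extended to all of `ℍ` by the
  -- identity theorem.
  have hgan := hgU.analyticOnNhd isOpen_upperHalfPlaneSet
  set z₀ : ℂ := ((max A 0 + 1 : ℝ) : ℂ) * Complex.I with hz₀
  have hz₀U : z₀ ∈ U := by
    simp only [hU, hz₀, Set.mem_ofPred_eq, Complex.im_ofReal_mul,
      Complex.I_im, mul_one]
    linarith
  have hev : (g ∘ ofComplex) =ᶠ[nhds z₀] 0 := by
    filter_upwards [hUopen.mem_nhds hz₀U] with z hz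
    have := hk z hz
    rw [hk0] at this
    exact (div_eq_zero_iff.mp this).resolve_right (hPne z hz)
  have hzero := hgan.eqOn_zero_of_preconnected_of_eventuallyEq_zero
    (convex_halfSpace_im_gt 0).isPreconnected (hUpos z₀ hz₀U) hev
  funext τ
  have := hzero τ.im_pos
  simpa using this

end MLDE

/-! ### The partition function -/

section PartitionFunction

open Derivative

/-- The quadratic `5c² + (22 + d)c - 10d` has positive discriminant, so `c` is real. If `c ≥ 10`,
the left side would be nonpositive and the right side positive. -/
theorem real_and_lt_of_quadratic {c : ℂ} {d : ℕ} (hd : 0 < d)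
    (h : (d : ℂ) * (10 - c) = c * (5 * c + 22)) : c.im = 0 ∧ c.re < 10 := by
  have hd' : (0 : ℝ) < d := by exact_mod_cast hd
  have hre := congrArg Complex.re h
  have him := congrArg Complex.im h
  simp at hre him
  have him0 : c.im = 0 := by
    by_contra hne
    have h1 : 10 * c.re = -(22 + d) := mul_right_cancel₀ hne (by linarith)
    nlinarith [sq_pos_of_ne_zero hne, mul_pos hd' hd']
  refine ⟨him0, ?_⟩
  rw [him0] at hre
  by_contra! hle
  nlinarith

variable {V : Type*} [AddCommGroup V] [Module ℂ V] {𝒱 : VertexOperatorAlgebra V}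

theorem VertexOperatorAlgebra.partitionTerm_natCast (τ : ℍ) (n : ℕ) :
    𝒱.partitionTerm τ n =
      qPow (-𝒱.centralCharge / 24) τ * (𝒱.dim n * qPow 1 τ ^ n) := by
  rw [partitionTerm, ← qPow_natCast, show ((n : ℤ) : ℂ) - 𝒱.centralCharge / 24 =
    -𝒱.centralCharge / 24 + n by push_cast; ring, qPow_add, dim]
  ring

theorem VertexOperatorAlgebra.IsStrongCFTType.hasSum_partitionTerm (hCFT : 𝒱.IsStrongCFTType)
    (ha : Subexp fun n => 𝒱.dim n) (τ : ℍ) : HasSum (𝒱.partitionTerm τ)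
      (qPow (-𝒱.centralCharge / 24) τ * qSeries (fun n => 𝒱.dim n) τ) := by
  refine (Function.Injective.hasSum_iff Nat.cast_injective fun n hn => ?_).mp
    (((ha.hasSum τ).mul_left _).congr_fun fun n => ?_)
  · have hneg : n < 0 := by
      by_contra! h
      exact hn ⟨n.toNat, Int.toNat_of_nonneg h⟩
    have h0 := hCFT.dim_neg hneg
    rw [dim] at h0
    rw [partitionTerm, h0, zero_mul]
  · exact partitionTerm_natCast τ n

theorem HasLeadingTerm.sub_isBigO {c : ℂ} {f g : ℍ → ℂ} (hf : HasLeadingTerm c f)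
    (hg : HasLeadingTerm c g) :
    (fun τ => qPow (c / 24) τ * (f τ - g τ)) =O[atImInfty] (qPow 1) := by
  refine (Asymptotics.IsBigO.sub hf hg).congr_left fun τ => ?_
  ring

theorem SolvesMLDE.sub {c : ℂ} {f g : ℍ → ℂ} (hf : SolvesMLDE c f) (hg : SolvesMLDE c g)
    (hfd : MDifferentiable 𝓘(ℂ) 𝓘(ℂ) f) (hgd : MDifferentiable 𝓘(ℂ) 𝓘(ℂ) g) :
    SolvesMLDE c (f - g) := fun τ => by
  have h1 := hf τ
  have h2 := hg τ
  rw [modularD_two_modularD_zero] at h1 h2 ⊢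
  rw [normalizedDerivOfComplex_sub _ _ hfd hgd, normalizedDerivOfComplex_sub _ _
    (normalizedDerivOfComplex_mdifferentiable hfd) (normalizedDerivOfComplex_mdifferentiable hgd)]
  simp only [Pi.sub_apply]
  linear_combination h1 - h2

theorem qPow_neg_mul_qPow (c : ℂ) (τ : ℍ) : qPow (-c / 24) τ * qPow (c / 24) τ = 1 := by
  rw [← qPow_add, show -c / 24 + c / 24 = 0 by ring, qPow_zero]

end PartitionFunction

theorem mainTheorem2 {V : Type*} [AddCommGroup V] [Module ℂ V] (𝒱 : VertexOperatorAlgebra V)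
    (hsimple : 𝒱.IsSimple) (hCFT : 𝒱.IsStrongCFTType)
    (hd : 0 < Module.finrank ℂ (𝒱.weightSpace 1))
    (B : LinearMap.BilinForm ℂ V) (hB : 𝒱.IsLiZMetric B)
    {ι : Type*} [Fintype ι] [DecidableEq ι]
    (u ubar : Module.Basis ι ℂ (𝒱.weightSpace 1))
    (hdual : ∀ α β, B (u α : V) (ubar β : V) = if α = β then 1 else 0)
    (hcasimir : 𝒱.casimir (fun α => (u α : V)) (fun α => (ubar α : V)) 4 ∈
      𝒱.virasoroSubalgebra) :
    (∀ τ : ℍ, Summable (𝒱.partitionTerm τ)) ∧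
      MDifferentiable 𝓘(ℂ) 𝓘(ℂ) 𝒱.partitionFunction ∧
      SolvesMLDE 𝒱.centralCharge 𝒱.partitionFunction ∧
      HasLeadingTerm 𝒱.centralCharge 𝒱.partitionFunction ∧
      ∀ f : ℍ → ℂ, MDifferentiable 𝓘(ℂ) 𝓘(ℂ) f → SolvesMLDE 𝒱.centralCharge f →
        HasLeadingTerm 𝒱.centralCharge f → f = 𝒱.partitionFunction := by
  have hι : Nonempty ι := by
    rw [Module.finrank_eq_card_basis u] at hd
    exact Fintype.card_pos_iff.mp hd
  set c := 𝒱.centralCharge with hc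
  set a : ℕ → ℂ := fun n => 𝒱.dim n with ha_def
  have hrec : ∀ n : ℕ, ((n : ℂ) ^ 2 - (c + 2) / 12 * n) * a n +
      ∑ l ∈ Finset.range n, (4 * (ArithmeticFunction.sigma 1 (l + 1) : ℂ) * (n - (l + 1)) -
        5 * c * (c + 4) / 12 * (ArithmeticFunction.sigma 3 (l + 1) : ℂ) -
        c / 6 * (ArithmeticFunction.sigma 1 (l + 1) : ℂ)) * a (n - (l + 1)) = 0 := fun n => by
    rw [← hCFT.dim_recursion hB (fun α => (u α).2) (fun α => (ubar α).2)
      (fun α => by simp [hdual]) hcasimir n]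
    refine congrArg _ (Finset.sum_congr rfl fun l hl => ?_)
    have hl : l + 1 ≤ n := Finset.mem_range.mp hl
    simp only [ha_def, Nat.cast_sub hl, Nat.cast_add, Nat.cast_one, hc]
  have ha : Subexp a := subexp_of_mldeRecursion hrec
  have ha0 : a 0 = 1 := hCFT.dim_zero
  have hZ : 𝒱.partitionFunction = qPow (-c / 24) * qSeries a :=
    funext fun τ => (hCFT.hasSum_partitionTerm ha τ).tsum_eq
  have hZd : MDifferentiable 𝓘(ℂ) 𝓘(ℂ) (qPow (-c / 24) * qSeries a) :=
    (qPow_mdifferentiable _).mul ha.qSeries_mdifferentiable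
  have hsol : SolvesMLDE c (qPow (-c / 24) * qSeries a) := solvesMLDE_of_recursion ha hrec
  have hlead : HasLeadingTerm c (qPow (-c / 24) * qSeries a) := by
    refine ha.qSeries_sub_isBigO.congr_left fun τ => ?_
    rw [ha0, Pi.mul_apply, ← mul_assoc, mul_comm (qPow _ τ), qPow_neg_mul_qPow, one_mul]
  rw [hZ]
  refine ⟨fun τ => (hCFT.hasSum_partitionTerm ha τ).summable, hZd, hsol, hlead,
    fun f hfd hf hfl => ?_⟩
  -- The recursion at `n = 1` with `dim V₀ = 1` is the quadratic relation between `d` and `c`.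
  obtain ⟨him, hre⟩ := real_and_lt_of_quadratic (c := c) hd (by
    have h1 := hrec 1
    have e : a 1 = (Module.finrank ℂ (𝒱.weightSpace 1) : ℂ) := rfl
    simp [ha0] at h1
    rw [← e]
    linear_combination 12 * h1)
  -- Equal leading terms make the difference of the two solutions `q^(-c/24)` times a holomorphic
  -- function that is `O(q)`.
  have hfg : f - qPow (-c / 24) * qSeries a = qPow (-c / 24) * fun τ =>
      qPow (c / 24) τ * (f τ - (qPow (-c / 24) * qSeries a) τ) := by
    funext τ
    rw [Pi.mul_apply (qPow _) (fun τ => _), ← mul_assoc, qPow_neg_mul_qPow, one_mul, Pi.sub_apply]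
  have hzero := eq_zero_of_solvesMLDE ha ha0 him hre hsol
    ((qPow_mdifferentiable (c / 24)).mul (hfd.sub hZd)) (hfg ▸ hf.sub hsol hfd hZd)
    (hfl.sub_isBigO hlead)
  rw [← sub_eq_zero, hfg]
  exact (congrArg (qPow (-c / 24) * ·) hzero).trans (mul_zero _)
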